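/- **Setting.** Work over $\mathbb{C}(q)$ with bar involution $q\mapsto q^{-1}$ (over $\mathbb C$), $[r]=(q^r-q^{-r})/(q-q^{-1})$, $[r]!=[1]\cdots[r]$. Let $\mathbf m=(m_1,\dots,m_n)$ be positive integers, $L=\sum_i m_i$, and $I_{\mathbf m}=\{\mathbf k: -m_i\le k_i\le m_i,\ k_i\equiv m_i \bmod 2\}$. Let $V_m$ be the irreducible $U_q(\mathfrak{sl}_2)$-module with basis $v_m,v_{m-2},\dots,v_{-m}$ and $Ev_k=[\frac{m+k}2+1]v_{k+2}$, $Fv_k=[\frac{m-k}2+1]v_{k-2}$, $K^{\pm1}v_k=q^{\pm k}v_k$, and let $v^{k}$ be the dual basis with respect to the form with $\langle xu,w\rangle=\langle u,\omega(x)w\rangle$, where $\omega$ is the antiautomorphism exchanging $E,F$ and fixing $K^{\pm1}$. Thus $Ev^k=[\frac{m-k}2]v^{k+2}$, $Fv^k=[\frac{m+k}2]v^{k-2}$, $K^{\pm1}v^k=q^{\pm k}v^k$. Tensor products are formed with $\Delta(K^{\pm1})=K^{\pm1}\otimes K^{\pm1}$, $\Delta(E)=E\otimes K^{-1}+1\otimes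 E$, $\Delta(F)=F\otimes1+K\otimes F$. Let $Y=F+q^{-1}KE+K$ act on $M=V_{m_1}\otimes\cdots\otimes V_{m_n}$. Put $\Theta=\sum_{r\ge0}q^{r(r-1)/2}\frac{(q-q^{-1})^r}{[r]!}E^r\otimes F^r$, $\Theta^{(1)}=1$, $\Theta^{(j)}=(1\otimes\Delta^{j-2})\Theta\cdot\Theta^{(j-1)}_{2,\dots,j}$, and $\Upsilon=\sum_{r\ge0}\overline{c_r}\,E^r/[r]!$ with $c_{-1}=0$, $c_0=1$, $c_r=-q^{-(r-1)}(q-q^{-1})(q[r-1]c_{r-2}+c_{r-1})$ for $r\ge1$. Let $\psi^\iota=\Upsilon\circ\Theta^{(n)}\circ(\psi\otimes\cdots\otimes\psi)$ on $M$ (with $\Theta^{(0)}=1$), where $\psi\otimes\cdots\otimes\psi$ is the bar-semilinear map fixing every $v^{k_1}\otimes\cdots\otimes v^{k_n}$. The dual canonical basis element $b_{\mathbf k}$ is the unique $x\in M$ with $\psi^\iota(x)=x$ and $x-v^{k_1}\otimes\cdots\otimes v^{k_n}$ in the $q^{-1}\mathbb Z[q^{-1}]$-span of the vectors $v^{l_1}\otimes\cdots\otimes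 v^{l_n}$. **Diagrams.** The diagram $D$ of $\mathbf k$ has $N=L$ arrows at positions $1,\dots,N$: for $i=1,\dots,n$ in turn, $(m_i+k_i)/2$ up arrows followed by $(m_i-k_i)/2$ down arrows. Repeatedly join adjacent (not yet joined) down and up arrows, in this order, by an arc, until all remaining up arrows are left of all remaining down arrows. Put a star on the rightmost remaining down arrow (if any), at position $s$. Join the other remaining down arrows two by two from the right by dashed arcs; at most one down arrow is left, the unpaired one. Let $N_1\in\{0,1\}$ be the number of unpaired down arrows, $S$ the set of arcs and $T$ the set of dashed arcs. A (dashed) arc $A$ joining the positions $i<j$ has size $m_A=(j-i+1)/2$. "Up arrow" below means an up arrow that is not part of an arc. If $D$ has a star, let $S_R$ be the set of arcs to the right of the star; $S_M$ the set of arcs not in $S_R$ to the right of the unpaired down arrow if $N_1=1$, respectively to the right of the leftmost down arrow of a dashed arc if $N_1=0$ (empty if also $T=\emptyset$); $S_L$ the set of arcs not in $S_R\cup S_M$ to the right of the rightmost up arrow (all arcs not in $S_R\cup S_M$ if there is no up arrow). If $D$ has no star, $S_R=S_M=S_L=\emptyset$. A superscript $+$ selects the arcs that are not inside another arc or dashed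 arc. Set - $N_2=|S|$ if $D$ has no star, $N_2=|S|+|T|+1$ if it has one; $N_3=|S_M|+|T|$; $N_4=N-|S|+|S_R|+|S_M|+|S_L|+1$; - $N_5=[N_4]/[N_3+1]$ if $D$ has a star and $N_1=0$; $N_5=1$ otherwise; - $N_6=\prod_A\frac{[1+m_A+d_{1,A}]}{[1+2m_A+d_{1,A}]}$ over $A\in S_L^+\cup S_M^+$ if $N_1=0$ and over $A\in S_M^+$ if $N_1=1$, where $d_{1,A}=N-j$ for $A=(i,j)$; - $N_7=\prod_{A\in S_R^+}\Big(\prod_{i=0}^{N_3}\frac{[d_{2,A}+i]}{[d_{2,A}+m_A+i]}\prod_{B\in S_M}\frac{[d_{2,A}+m_A+c_B]}{[d_{2,A}+c_B]}\Big)$, where $d_{2,A}=(i-s+1)/2$ for $A=(i,j)$ and $c_B$ is the number of arcs of $S_M$ to the right of $B$, outside $B$ or equal to $B$, plus the number of dashed arcs to the right of $B$; - $N_8=\prod_A[d_{3,A}+m_A]^{-1}$ over all dashed arcs if $N_1=1$ and over all but the leftmost one if $N_1=0$, where $d_{3,A}=(s-l+1)/2$ for $A=(k,l)$; - $N_9=\prod_{i=1}^{N-N_2}(q^i+q^{-i})\big/\prod_{A}(q^{d_{4,A}}+q^{-d_{4,A}})$,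 where $A$ runs over the dashed arcs and the star, $d_{4,A}=1+(N-k)/2$ for a dashed arc $A=(k,l)$ and $d_{4,A}=1+(N-s)/2$ for the star; - enumerate the up arrows, arcs, dashed arcs and the unpaired down arrow by $1,2,\dots$ from left to right according to their left ends; $N_{10}$ is the product of $[N_A]$ over all arcs and dashed arcs $A$, times $[N_\downarrow]$ if $N_1=1$, where $N_A$ and $N_\downarrow$ are the assigned integers. **Theorem.** For every $\mathbf k\in I_{\mathbf m}$ the element $b_{\mathbf k}$ exists and is unique, and the $b_{\mathbf k}$ form a basis of $M$. The eigenspace of $Y$ on $M$ for the eigenvalue $[L+1]$ is one-dimensional, and it is spanned by a unique vector $\Psi=\sum_{\mathbf k}\Psi_{\mathbf k}b_{\mathbf k}$ with $\Psi_{(-m_1,\dots,-m_n)}=1$. For every $\mathbf k\in I_{\mathbf m}$, with $D$ the diagram of $\mathbf k$, $$\Psi_{\mathbf k}=\prod_{A\in S}[m_A]^{-1}\cdot N_5\cdot N_6\cdot N_7\cdot N_8\cdot N_9\cdot N_{10}.$$ -/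

import Mathlib

open scoped TensorProduct

namespace CoidealSl2

/-! ### Scalars -/

/-- The field `ℂ(q)` of rational functions in one indeterminate. -/
abbrev Kq : Type := RatFunc ℂ

/-- The indeterminate `q`. -/
noncomputable def q : Kq := RatFunc.X

/-- The quantum integer `[z] = (q^z - q^{-z}) / (q - q^{-1})`. -/
noncomputable def qint (z : ℤ) : Kq := (q ^ z - q ^ (-z)) / (q - q⁻¹)

/-- The quantum factorial `[n]! = [1][2]⋯[n]`. -/
noncomputable def qfact (n : ℕ) : Kq := ∏ i ∈ Finset.Icc 1 n, qint i

theorem q_inv_transcendental : Transcendental ℂ (q⁻¹ : Kq) := by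
  intro h
  have h2 : IsAlgebraic ℂ (q : Kq) := by simpa using h.inv
  exact RatFunc.transcendental_X h2

theorem aeval_q_inv_injective :
    Function.Injective (Polynomial.aeval (R := ℂ) (q⁻¹ : Kq)) :=
  transcendental_iff_injective.1 q_inv_transcendental

/-- The bar involution of `ℂ(q)`: the `ℂ`-algebra endomorphism with `q ↦ q⁻¹`. -/
noncomputable def bar : Kq →ₐ[ℂ] Kq :=
  RatFunc.liftAlgHom (Polynomial.aeval (R := ℂ) (q⁻¹ : Kq))
    (nonZeroDivisors_le_comap_nonZeroDivisors_of_injective _ aeval_q_inv_injective)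

theorem bar_q : bar q = q⁻¹ := by
  have h := RatFunc.liftAlgHom_apply_div (Polynomial.aeval (R := ℂ) (q⁻¹ : Kq))
    (nonZeroDivisors_le_comap_nonZeroDivisors_of_injective _ aeval_q_inv_injective)
    Polynomial.X 1
  simpa [q, bar, RatFunc.algebraMap_X] using h

/-! ### The irreducible representations of `U_q(sl₂)`

`V_n` has the canonical basis `v_k`, `k = n, n-2, …, -n`; the vector with `k = n - 2a` is indexed by
`a : Fin (n + 1)`.  The generators act by
`E v_k = [(n+k)/2 + 1] v_{k+2}`, `F v_k = [(n-k)/2 + 1] v_{k-2}`, `K^{±1} v_k = q^{±k} v_k`. -/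

/-- The matrix of `E` in the canonical basis. -/
noncomputable def canE (n : ℕ) : Matrix (Fin (n + 1)) (Fin (n + 1)) Kq :=
  Matrix.of fun r c => if (c : ℕ) = r + 1 then qint ((n : ℤ) - c + 1) else 0

/-- The matrix of `F` in the canonical basis. -/
noncomputable def canF (n : ℕ) : Matrix (Fin (n + 1)) (Fin (n + 1)) Kq :=
  Matrix.of fun r c => if (r : ℕ) = c + 1 then qint ((c : ℤ) + 1) else 0

/-- The matrix of `K ^ e` (`e = ±1`) in the canonical basis. -/
noncomputable def canK (n : ℕ) (e : ℤ) : Matrix (Fin (n + 1)) (Fin (n + 1)) Kq :=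
  Matrix.diagonal fun a => q ^ (e * ((n : ℤ) - 2 * a))

/-- The space `V_n`, in coordinates with respect to the dual basis `v^k` of the canonical basis for
the form with `⟨x u, v⟩ = ⟨u, ω(x) v⟩`, where `ω` is the antiautomorphism exchanging `E` and `F` and
fixing `K^{±1}`. -/
abbrev V (n : ℕ) : Type := Fin (n + 1) → Kq

/-- `E` acts in the dual basis by the transpose of `ω(E) = F` in the canonical basis. -/
noncomputable def opE (n : ℕ) : Module.End Kq (V n) := Matrix.toLin' (canF n).transpose

/-- `F` acts in the dual basis by the transpose of `ω(F) = E` in the canonical basis. -/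
noncomputable def opF (n : ℕ) : Module.End Kq (V n) := Matrix.toLin' (canE n).transpose

/-- `K ^ e` acts in the dual basis by the transpose of `K ^ e` in the canonical basis. -/
noncomputable def opK (n : ℕ) (e : ℤ) : Module.End Kq (V n) := Matrix.toLin' (canK n e).transpose

/-! ### Tensor products

The action on tensor products is through the comultiplication
`Δ(E) = E ⊗ K⁻¹ + 1 ⊗ E`, `Δ(F) = F ⊗ 1 + K ⊗ F`, `Δ(K^{±1}) = K^{±1} ⊗ K^{±1}`. -/

variable {n : ℕ} (m : Fin n → ℕ)

/-- The index set `I_m`; the index `a` stands for `(m_1 - 2 a_1, …, m_n - 2 a_n)`. -/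
abbrev Idx : Type := ∀ i, Fin (m i + 1)

/-- The index `(-m_1, …, -m_n)`. -/
def lowest : Idx m := fun i => Fin.last (m i)

/-- The tensor product `V_{m_1} ⊗ ⋯ ⊗ V_{m_n}`. -/
abbrev T : Type := ⨂[Kq] i, V (m i)

/-- The standard basis `v^{k_1} ⊗ ⋯ ⊗ v^{k_n}`. -/
noncomputable def stdBasis : Module.Basis (Idx m) Kq (T m) :=
  Basis.piTensorProduct fun i => Pi.basisFun Kq (Fin (m i + 1))

/-- `1 ⊗ Δ^{(r)}(E)`, where `E` acts on the tensor factors at the places `≥ p` (places are counted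
from `0`): the sum over `i ≥ p` of `1 ⊗ ⋯ ⊗ 1 ⊗ E ⊗ K⁻¹ ⊗ ⋯ ⊗ K⁻¹` with `E` at the place `i`. -/
noncomputable def tailE (p : ℕ) : Module.End Kq (T m) :=
  ∑ i : Fin n, if p ≤ (i : ℕ) then
    PiTensorProduct.map fun j =>
      if j = i then opE (m j) else if i < j then opK (m j) (-1) else LinearMap.id
  else 0

/-- `1 ⊗ Δ^{(r)}(F)`, where `F` acts on the tensor factors at the places `≥ p`: the sum over `i ≥ p`
of `1 ⊗ ⋯ ⊗ 1 ⊗ K ⊗ ⋯ ⊗ K ⊗ F ⊗ 1 ⊗ ⋯ ⊗ 1` with `K` at the places from `p` to `i - 1` and `F` at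
the place `i`. -/
noncomputable def tailF (p : ℕ) : Module.End Kq (T m) :=
  ∑ i : Fin n, if p ≤ (i : ℕ) then
    PiTensorProduct.map fun j =>
      if j = i then opF (m j) else if p ≤ (j : ℕ) ∧ j < i then opK (m j) 1 else LinearMap.id
  else 0

/-- `K` on the whole tensor product. -/
noncomputable def tensorK : Module.End Kq (T m) := PiTensorProduct.map fun j => opK (m j) 1

/-- The generator `Y = F + q⁻¹ K E + K` of the coideal subalgebra, acting on the tensor product. -/
noncomputable def opY : Module.End Kq (T m) :=
  tailF m 0 + q⁻¹ • (tensorK m * tailE m 0) + tensorK m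

/-- `E` on the single tensor factor at the place `p`. -/
noncomputable def siteE (p : Fin n) : Module.End Kq (T m) :=
  PiTensorProduct.map fun j => if j = p then opE (m j) else LinearMap.id

/-! ### The bar involution of the coideal subalgebra on tensor products -/

/-- The quasi-`R`-matrix `Θ = ∑_k q^{k(k-1)/2} (q - q⁻¹)^k / [k]! · E^k ⊗ F^k`, with the first leg on
the factor at the place `p` and the second leg on all later factors.  The sum stops at `k = m_p`
because `E ^ (m_p + 1) = 0` on `V_{m_p}`. -/
noncomputable def thetaAt (p : Fin n) : Module.End Kq (T m) :=
  ∑ k ∈ Finset.range (m p + 1),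
    (q ^ (k * (k - 1) / 2) * (q - q⁻¹) ^ k / qfact k) • (siteE m p ^ k * tailF m (p + 1) ^ k)

/-- The iterated quasi-`R`-matrix `Θ^{(n)} = (1 ⊗ Δ^{n-2})Θ · Θ^{(n-1)}_{2,…,n}`. -/
noncomputable def theta : Module.End Kq (T m) := ((List.finRange n).map (thetaAt m)).prod

/-- The coefficients `c_r` of the intertwiner: `c_0 = 1` (and `c_{-1} = 0`),
`c_r = -q^{-(r-1)} (q - q⁻¹) (q [r-1] c_{r-2} + c_{r-1})`. -/
noncomputable def upsilonCoeff : ℕ → Kq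
  | 0 => 1
  | 1 => -(q - q⁻¹)
  | r + 2 => -(q⁻¹) ^ (r + 1) * (q - q⁻¹) *
      (q * qint ((r : ℤ) + 1) * upsilonCoeff r + upsilonCoeff (r + 1))

/-- The intertwiner `Υ = ∑_r bar(c_r) E^r / [r]!` on the tensor product.  The sum stops at
`r = m_1 + ⋯ + m_n` because higher powers of `E` vanish. -/
noncomputable def upsilon : Module.End Kq (T m) :=
  ∑ r ∈ Finset.range ((∑ i, m i) + 1), (bar (upsilonCoeff r) / qfact r) • tailE m 0 ^ r

/-- `ψ ⊗ ⋯ ⊗ ψ`: the map which is semilinear over `bar` and fixes every `v^{k_1} ⊗ ⋯ ⊗ v^{k_n}`. -/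
noncomputable def psi (x : T m) : T m :=
  (stdBasis m).repr.symm (((stdBasis m).repr x).mapRange bar (map_zero bar))

/-- The bar involution `ψ^ι = Υ ∘ Θ^{(n)} ∘ (ψ ⊗ ⋯ ⊗ ψ)` of the `U`-module `V_{m_1} ⊗ ⋯ ⊗ V_{m_n}`. -/
noncomputable def psiIota (x : T m) : T m := upsilon m (theta m (psi m x))

/-- `x` is the dual canonical basis element with index `a`: it is `ψ^ι`-invariant and
`x - v^{k_1} ⊗ ⋯ ⊗ v^{k_n}` has all coordinates in `q⁻¹ ℤ[q⁻¹]`. -/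
def IsDualCanonical (a : Idx m) (x : T m) : Prop :=
  psiIota m x = x ∧
    ∀ l : Idx m, ∃ f : Polynomial ℤ,
      (stdBasis m).repr (x - stdBasis m a) l = q⁻¹ * Polynomial.aeval (q⁻¹ : Kq) f

/-! ### Diagrams -/

/-- An up arrow or a down arrow. -/
inductive Arrow
  | up
  | down

/-- The sequence of arrows of the index `a`: for `i = 1, …, n` in turn, `m_i - a_i` up arrows followed
by `a_i` down arrows. -/
def arrows (a : Idx m) : List Arrow :=
  (List.finRange n).flatMap fun i =>
    List.replicate (m i - (a i : ℕ)) Arrow.up ++ List.replicate (a i : ℕ) Arrow.down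

/-- The result of joining down arrows with up arrows: the arcs (pairs of positions), the positions of
the remaining up arrows, the positions of the remaining down arrows (from right to left). -/
structure Pairing where
  arcs : Finset (ℕ × ℕ)
  ups : Finset ℕ
  downs : List ℕ

/-- Join adjacent down and up arrows (in this order) by arcs, until all remaining up arrows are to the
left of all remaining down arrows.  The word is read from left to right; `p` is the position of its
first arrow and the list holds the not yet joined down arrows before `p`, from right to left. -/
def joinArcs : ℕ → List ℕ → List Arrow → Pairing
  | _, ds, [] => ⟨∅, ∅, ds⟩
  | p, ds, Arrow.down :: w => joinArcs (p + 1) (p :: ds) w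
  | p, d :: ds, Arrow.up :: w =>
      let P := joinArcs (p + 1) ds w
      ⟨insert (d, p) P.arcs, P.ups, P.downs⟩
  | p, [], Arrow.up :: w =>
      let P := joinArcs (p + 1) [] w
      ⟨P.arcs, insert p P.ups, P.downs⟩

/-- Join two by two, from the right, down arrows that are listed from right to left. -/
def joinDashed : List ℕ → Finset (ℕ × ℕ)
  | l :: k :: ds => insert (k, l) (joinDashed ds)
  | _ => ∅

/-- The down arrow (if any) left over by `joinDashed`. -/
def leftOver : List ℕ → Option ℕ
  | _ :: _ :: ds => leftOver ds
  | [d] => some d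
  | [] => none

/-- A diagram of a dual canonical basis element: `size` arrows at the positions `1, 2, …, size`, some
joined by arcs or dashed arcs `(i, j)`, `i < j`, the others being up arrows, at most one down arrow
with a star and at most one unpaired down arrow. -/
structure Diagram where
  size : ℕ
  arcs : Finset (ℕ × ℕ)
  ups : Finset ℕ
  star : Option ℕ
  dashed : Finset (ℕ × ℕ)
  unpaired : Option ℕ

/-- The diagram of a word of arrows: after the arcs are drawn, the rightmost remaining down arrow gets
the star and the other ones are joined two by two from the right by dashed arcs. -/
def diagramOfWord (w : List Arrow) : Diagram :=
  let P := joinArcs 1 [] w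
  { size := w.length
    arcs := P.arcs
    ups := P.ups
    star := P.downs.head?
    dashed := joinDashed P.downs.tail
    unpaired := leftOver P.downs.tail }

/-- The diagram of the dual canonical basis element with index `a`. -/
def diagram (a : Idx m) : Diagram := diagramOfWord (arrows m a)

/-- The size `(j - i + 1) / 2` of an arc or a dashed arc `(i, j)`. -/
def arcSize (A : ℕ × ℕ) : ℕ := (A.2 - A.1 + 1) / 2

/-- `B` is outside of (encloses) `A`. -/
def Encloses (B A : ℕ × ℕ) : Prop := B.1 < A.1 ∧ A.2 < B.2

instance (B A : ℕ × ℕ) : Decidable (Encloses B A) := inferInstanceAs (Decidable (_ ∧ _))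

namespace Diagram

variable (D : Diagram)

/-- The position `s` of the down arrow with a star (used only if there is one). -/
def starPos : ℕ := D.star.getD 0

/-- `S_R`: the arcs to the right of the star. -/
def SR : Finset (ℕ × ℕ) :=
  match D.star with
  | none => ∅
  | some s => D.arcs.filter fun A => s < A.1

/-- `S_M`: the arcs not in `S_R` that are to the right of the unpaired down arrow or, if there is no
such arrow, to the right of the leftmost (equivalently, of some) down arrow forming a dashed arc. -/
def SM : Finset (ℕ × ℕ) :=
  match D.star, D.unpaired with
  | none, _ => ∅
  | some _, some u => (D.arcs \ D.SR).filter fun A => u < A.1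
  | some _, none => (D.arcs \ D.SR).filter fun A => ∃ B ∈ D.dashed, B.1 < A.1

/-- `S_L`: the arcs not in `S_R ∪ S_M` that are to the right of the rightmost (equivalently, of every)
up arrow; no condition if there are no up arrows. -/
def SL : Finset (ℕ × ℕ) :=
  match D.star with
  | none => ∅
  | some _ => (D.arcs \ (D.SR ∪ D.SM)).filter fun A => ∀ u ∈ D.ups, u < A.1

/-- The arcs of `X` that are outer arcs of `D`, i.e. without arc or dashed arc outside of them. -/
def outer (X : Finset (ℕ × ℕ)) : Finset (ℕ × ℕ) :=
  X.filter fun A => ∀ B ∈ D.arcs ∪ D.dashed, ¬ Encloses B A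

def N2 : ℕ := if D.star.isSome then D.arcs.card + D.dashed.card + 1 else D.arcs.card

def N3 : ℕ := D.SM.card + D.dashed.card

def N4 : ℕ := D.size - D.arcs.card + D.SR.card + D.SM.card + D.SL.card + 1

noncomputable def N5 : Kq :=
  if D.star.isSome ∧ D.unpaired = none then qint D.N4 / qint (D.N3 + 1) else 1

/-- `d_{1,A}`. -/
def d1 (A : ℕ × ℕ) : ℕ := D.size - A.2

/-- `d_{2,A}`, for an arc `A` to the right of the star. -/
def d2 (A : ℕ × ℕ) : ℕ := (A.1 - D.starPos + 1) / 2

/-- `d_{3,A}`, for a dashed arc `A`. -/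
def d3 (A : ℕ × ℕ) : ℕ := (D.starPos - A.2 + 1) / 2

/-- `d_{4,A}`, where `k` is the position of the star or of the left end of a dashed arc. -/
def d4 (k : ℕ) : ℕ := 1 + (D.size - k) / 2

noncomputable def N6 : Kq :=
  ∏ A ∈ D.outer (if D.unpaired = none then D.SL ∪ D.SM else D.SM),
    qint (1 + arcSize A + D.d1 A) / qint (1 + 2 * arcSize A + D.d1 A)

/-- `c_B`: the number of arcs of `S_M` that are to the right of `B`, outside of `B` or equal to `B`,
plus the number of dashed arcs to the right of `B`. -/
def c (B : ℕ × ℕ) : ℕ :=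
  (D.SM.filter fun A => B.2 < A.1 ∨ Encloses A B ∨ A = B).card +
    (D.dashed.filter fun A => B.2 < A.1).card

noncomputable def N7 : Kq :=
  ∏ A ∈ D.outer D.SR,
    ((∏ i ∈ Finset.range (D.N3 + 1), qint (D.d2 A + i) / qint (D.d2 A + arcSize A + i)) *
      ∏ B ∈ D.SM, qint (D.d2 A + arcSize A + D.c B) / qint (D.d2 A + D.c B))

/-- The product runs over all dashed arcs if there is an unpaired down arrow, and over all dashed arcs
except the leftmost one otherwise. -/
noncomputable def N8 : Kq :=
  ∏ A ∈ (if D.unpaired = none then D.dashed.filter fun A => ∃ B ∈ D.dashed, B.1 < A.1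
      else D.dashed),
    (qint (D.d3 A + arcSize A))⁻¹

noncomputable def N9 : Kq :=
  (∏ i ∈ Finset.Icc 1 (D.size - D.N2), (q ^ i + (q⁻¹) ^ i)) /
    ((∏ A ∈ D.dashed, (q ^ D.d4 A.1 + (q⁻¹) ^ D.d4 A.1)) *
      ∏ s ∈ D.star.toFinset, (q ^ D.d4 s + (q⁻¹) ^ D.d4 s))

/-- The integer assigned to the object with left end `p` when the up arrows, arcs, dashed arcs and the
unpaired down arrow are enumerated `1, 2, …` from left to right by their left ends. -/
def number (p : ℕ) : ℕ :=
  ((D.ups ∪ D.arcs.image Prod.fst ∪ D.dashed.image Prod.fst ∪ D.unpaired.toFinset).filter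
    fun x => x ≤ p).card

noncomputable def N10 : Kq :=
  (∏ u ∈ D.unpaired.toFinset, qint (D.number u)) * ∏ A ∈ D.arcs ∪ D.dashed, qint (D.number A.1)

/-- The product formula. -/
noncomputable def productFormula : Kq :=
  (∏ A ∈ D.arcs, (qint (arcSize A))⁻¹) * D.N5 * D.N6 * D.N7 * D.N8 * D.N9 * D.N10

end Diagram

end CoidealSl2

/-!
The theorem follows from the case where all `m_i` are `1`, which is treated by putting one arrow after
the other in front of a word.

*Reduction to words.*  The dual of the embedding of `V_m` into `V_1 ⊗ ⋯ ⊗ V_1` presents `V_m`, in the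
basis `v^k`, as a quotient of the `m`-th tensor power of `V_1`.  Hence `M` is a quotient of the space
with basis the words of `L` arrows, and all tensor powers of `V_1` together form the space `WordSpace`
of all words.  There `E`, `F`, `K` and the bar involutions are given by recursions on the first
letter; for `ψ^ι` it is

  `ψ^ι(↑ ⊗ y) = ↑ ⊗ ψ^ι(y)`, `ψ^ι(↓ ⊗ y) = ↓ ⊗ ψ^ι(y) + (q - q⁻¹) ↑ ⊗ Y ψ^ι(y)`,

where the recursion for `Υ` has turned `F` into `Y` (`wordUpsilon_wordPsi`).  The projection `wordMap`
intertwines `Y` and `ψ^ι` (`wordMap_wordY`, `psiIota_wordMap`).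

*The dual canonical basis.*  In the tensor powers of `V_1` it is explicit (`dualVec`): an arc stands for
`↓ ⊗ ↑ - q⁻¹ ↑ ⊗ ↓`, a dashed arc for `↓ ⊗ ↓ - q⁻¹ ↑ ⊗ ↑`, the star for `↓ - q⁻¹ ↑`.  The vectors of
arcs commute with `Y`, and the vector of a star with dashed arcs is killed by `Y`, so that the
recursion gives the invariance (`wordIota_dualVec`).  The terms other than
the leading one are words of smaller `depth` and have coefficients in `q⁻¹ ℤ[q⁻¹]`
(`hasLead_dualVec`).  The projection multiplies words by powers of `q⁻¹`, so these
properties persist in `M`; since only `0` is both bar invariant and in `q⁻¹ ℤ[q⁻¹]`, this gives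
existence and uniqueness (`isDualCanonical_iff`), and it shows that the words which do not belong to
an index are sent to zero (`wordMap_dualVec_eq_zero`).

*The eigenvector.*  An eigenvector `y` of `Y` for `[l]` yields the two eigenvectors
`↓ ⊗ y + q^l ↑ ⊗ y` and `↓ ⊗ y - q^{-l} ↑ ⊗ y`, for `[l + 1]` and `[l - 1]`.  So the words of length `N`
are spanned by eigenvectors, and only `eigenVec N = (↓ + q^N ↑) ⊗ ⋯ ⊗ (↓ + q ↑)` among them belongs to
`[N + 1]` (`degree_le_eigenSum`, `eigenspace_opY`).

*The coefficients.*  The difference of `↓ ⊗ b` and the dual canonical basis element of the extended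
word is an explicit combination of elements `↑ ⊗ b'`, in which `b'` arises from `b` by turning round one
arrow (`X_down_dualVec`).  This gives a recursion for the coefficients of `eigenVec N`: they do not
change if a down arrow is put in front (`weight_down`), and with an up arrow in front they are a sum
over arrows that are turned round.  The latter recursion is solved by `weight_recursion`, which is
proved for words with a prescribed number of objects on their left, so that an induction on the up
arrows is possible; the sums over outer arcs telescope.

*The product formula.*  It remains to identify `weight 0 w` with the product formula of the diagram
(`productFormula_diagramOfWord`).  The numbers of the arcs and dashed arcs fill up the numbers that are
not taken by up arrows (`prod_sizes_mul_prod_numbers`), the product over the outer arcs to the right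
of the star telescopes (`prod_outerAt_telescope`), and the numbers `c_B` together with the half
distances of the dashed arcs from the star take every value `1, …, N_3` exactly once
(`prod_rank_midArcsAt`).  So `N_7 N_8 N_9` collapses to the factors `[2 d_{4,A}]⁻¹` (`N7_mul_N9`).
-/
open scoped TensorProduct

namespace CoidealSl2

/-! ### Quantum integers -/

theorem q_ne_zero : q ≠ 0 := RatFunc.X_ne_zero

theorem q_pow_injective : Function.Injective fun n : ℕ => q ^ n := by
  intro a b h
  have h1 : (algebraMap (Polynomial ℂ) Kq) (Polynomial.X ^ a)
      = algebraMap (Polynomial ℂ) Kq (Polynomial.X ^ b) := by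
    simpa [q, RatFunc.algebraMap_X] using h
  have h2 := RatFunc.algebraMap_injective ℂ h1
  simpa using congrArg Polynomial.natDegree h2

theorem q_zpow_eq_one {z : ℤ} (h : q ^ z = 1) : z = 0 := by
  have key : ∀ n : ℕ, q ^ n = 1 → n = 0 := fun n hn => q_pow_injective (by simpa using hn)
  obtain ⟨n, rfl | rfl⟩ := z.eq_nat_or_neg
  · simp [key n (by simpa using h)]
  · simp [key n (by simpa using h)]

theorem q_zpow_injective : Function.Injective fun z : ℤ => q ^ z := by
  intro a b h
  have : q ^ (a - b) = 1 := by
    rw [zpow_sub₀ q_ne_zero]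
    exact div_eq_one_iff_eq (zpow_ne_zero _ q_ne_zero) |>.2 h
  have := q_zpow_eq_one this
  omega

theorem q_sub_inv_ne_zero : q - q⁻¹ ≠ 0 := by
  intro h
  have h1 : q ^ (1 : ℤ) = q ^ (-1 : ℤ) := by simpa [sub_eq_zero] using h
  have := q_zpow_injective h1
  omega

theorem qint_injective : Function.Injective qint := by
  intro a b h
  have h1 : q ^ a - q ^ (-a) = q ^ b - q ^ (-b) := by
    unfold qint at h
    exact (div_left_inj' q_sub_inv_ne_zero).1 h
  have ha : q ^ a ≠ 0 := zpow_ne_zero _ q_ne_zero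
  have hb : q ^ b ≠ 0 := zpow_ne_zero _ q_ne_zero
  rw [zpow_neg, zpow_neg] at h1
  have h2 : (q ^ a - q ^ b) * (q ^ a * q ^ b + 1) = 0 := by
    field_simp at h1
    linear_combination h1
  rcases mul_eq_zero.1 h2 with h3 | h3
  · exact q_zpow_injective (sub_eq_zero.1 h3)
  · exfalso
    have h4 : q ^ (2 * (a + b)) = 1 := by
      rw [mul_comm, zpow_mul, zpow_add₀ q_ne_zero]
      have : q ^ a * q ^ b = -1 := by linear_combination h3
      rw [this]; norm_num
    have h5 : a + b = 0 := by have := q_zpow_eq_one h4; omega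
    rw [← zpow_add₀ q_ne_zero, h5] at h3
    norm_num at h3

@[simp] theorem qint_zero : qint 0 = 0 := by simp [qint]

@[simp] theorem qint_one : qint 1 = 1 := by
  simp [qint, div_self q_sub_inv_ne_zero]

theorem qint_ne_zero {z : ℤ} (h : z ≠ 0) : qint z ≠ 0 := by
  rw [← qint_zero]
  exact qint_injective.ne h

theorem qint_pos_ne_zero {z : ℤ} (h : 0 < z) : qint z ≠ 0 := qint_ne_zero h.ne'

theorem qint_neg (z : ℤ) : qint (-z) = - qint z := by
  unfold qint; rw [neg_neg]; ring

theorem qint_add (a b : ℤ) : qint (a + b) = q ^ a * qint b + q ^ (-b) * qint a := by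
  unfold qint
  rw [neg_add, zpow_add₀ q_ne_zero, zpow_add₀ q_ne_zero]
  ring

theorem qint_add' (a b : ℤ) : qint (a + b) = q ^ (-a) * qint b + q ^ b * qint a := by
  rw [add_comm, qint_add]; ring

theorem qint_two_mul (a : ℤ) : qint (2 * a) = qint a * (q ^ a + q ^ (-a)) := by
  rw [two_mul, qint_add]; ring

theorem q_zpow_add_zpow_neg_ne_zero (a : ℤ) : q ^ a + q ^ (-a) ≠ 0 := by
  by_cases ha : a = 0
  · subst ha; norm_num
  · intro h
    have h1 := qint_two_mul a
    rw [h, mul_zero] at h1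
    exact qint_ne_zero (by omega) h1

/-- The three-term identity behind all telescoping sums over arcs. -/
theorem qint_mul_sub_mul (y P m : ℤ) :
    qint (y + m) * qint (P + m) - qint y * qint P = qint m * qint (y + P + m) := by
  have hc := q_sub_inv_ne_zero
  have h : ∀ z, qint z * (q - q⁻¹) = q ^ z - q ^ (-z) := fun z => div_mul_cancel₀ _ hc
  have hn : (q - q⁻¹) * (q - q⁻¹) ≠ 0 := mul_ne_zero hc hc
  apply mul_right_cancel₀ hn
  have e : (qint (y + m) * qint (P + m) - qint y * qint P) * ((q - q⁻¹) * (q - q⁻¹))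
    = (qint (y + m) * (q - q⁻¹)) * (qint (P + m) * (q - q⁻¹))
      - (qint y * (q - q⁻¹)) * (qint P * (q - q⁻¹)) := by ring
  have e' : qint m * qint (y + P + m) * ((q - q⁻¹) * (q - q⁻¹))
    = (qint m * (q - q⁻¹)) * (qint (y + P + m) * (q - q⁻¹)) := by ring
  rw [e, e']
  simp only [h, zpow_neg, zpow_add₀ q_ne_zero]
  have hy : q ^ y ≠ 0 := zpow_ne_zero _ q_ne_zero
  have hP : q ^ P ≠ 0 := zpow_ne_zero _ q_ne_zero
  have hm : q ^ m ≠ 0 := zpow_ne_zero _ q_ne_zero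
  field_simp
  ring

/-! ### The shape of a word of arrows -/

instance : DecidableEq Arrow
  | .up, .up => isTrue rfl
  | .down, .down => isTrue rfl
  | .up, .down => isFalse nofun
  | .down, .up => isFalse nofun

/-- A system of arcs without other arrows, as a binary tree: `node a b` is an arc around `a`, followed
by `b`. -/
inductive Forest
  | nil
  | node (a b : Forest)

namespace Forest

/-- The number of arcs. -/
def size : Forest → ℕ
  | nil => 0
  | node a b => a.size + b.size + 1

/-- Juxtaposition. -/
def append : Forest → Forest → Forest
  | nil, v => v
  | node a b, v => node a (b.append v)

/-- The word of a system of arcs. -/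
def toList : Forest → List Arrow
  | nil => []
  | node a b => Arrow.down :: (a.toList ++ Arrow.up :: b.toList)

@[simp] theorem length_toList (u : Forest) : u.toList.length = 2 * u.size := by
  induction u with
  | nil => rfl
  | node a b iha ihb => simp [toList, size, iha, ihb]; ring

@[simp] theorem toList_append (u v : Forest) : (u.append v).toList = u.toList ++ v.toList := by
  induction u with
  | nil => rfl
  | node a b _ ihb => simp [toList, append, ihb]

@[simp] theorem size_append (u v : Forest) : (u.append v).size = u.size + v.size := by
  induction u with
  | nil => simp [append, size]
  | node a b _ ihb => simp [append, size, ihb]; ring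

@[simp] theorem append_nil (u : Forest) : u.append nil = u := by
  induction u with
  | nil => rfl
  | node a b _ ihb => simp [append, ihb]

end Forest

/-- The shape `u₀ ↑ u₁ ↑ ⋯ ↑ u ↓ w₁ ↓ w₂ ⋯ ↓ w_d` of a word of arrows, where all `u_i`, `u`, `w_i` are
systems of arcs: `ups` lists the `u_i`, `mid` is `u` and `core` lists the `w_i`. -/
structure Shape where
  ups : List Forest
  mid : Forest
  core : List Forest

namespace Shape

/-- Put a down arrow in front. -/
def down : Shape → Shape
  | ⟨[], u, c⟩ => ⟨[], .nil, u :: c⟩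
  | ⟨[v], u, c⟩ => ⟨[], .node v u, c⟩
  | ⟨v :: v' :: U, u, c⟩ => ⟨.node v v' :: U, u, c⟩

/-- Put an up arrow in front. -/
def up (s : Shape) : Shape := ⟨.nil :: s.ups, s.mid, s.core⟩

/-- Put a system of arcs in front. -/
def prepend (x : Forest) : Shape → Shape
  | ⟨[], u, c⟩ => ⟨[], x.append u, c⟩
  | ⟨v :: U, u, c⟩ => ⟨x.append v :: U, u, c⟩

end Shape

/-- The word of a list of systems of arcs, each with a down arrow in front. -/
def coreList : List Forest → List Arrow
  | [] => []
  | u :: c => Arrow.down :: (u.toList ++ coreList c)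

/-- The word of a shape. -/
def wordOf : List Forest → Forest → List Forest → List Arrow
  | [], u, c => u.toList ++ coreList c
  | v :: U, u, c => v.toList ++ Arrow.up :: wordOf U u c

/-- The shape of a word. -/
def shape : List Arrow → Shape
  | [] => ⟨[], .nil, []⟩
  | Arrow.up :: w => (shape w).up
  | Arrow.down :: w => (shape w).down

theorem wordOf_shape (w : List Arrow) :
    wordOf (shape w).ups (shape w).mid (shape w).core = w := by
  induction w with
  | nil => rfl
  | cons s w ih =>
    cases s with
    | up => simp only [shape, Shape.up, wordOf, Forest.toList, List.nil_append]; rw [ih]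
    | down =>
      simp only [shape]
      generalize shape w = t at ih
      obtain ⟨U, u, c⟩ := t
      rcases U with _ | ⟨v, _ | ⟨v', U⟩⟩ <;>
        simp_all [Shape.down, wordOf, Forest.toList, coreList]

theorem Shape.prepend_nil (s : Shape) : s.prepend .nil = s := by
  obtain ⟨_ | _, _, _⟩ := s <;> rfl

theorem shape_append (x : Forest) (w : List Arrow) :
    shape (x.toList ++ w) = (shape w).prepend x := by
  induction x generalizing w with
  | nil => simp [Forest.toList, Shape.prepend_nil]
  | node a b iha ihb =>
    simp only [Forest.toList, List.cons_append, List.append_assoc, shape, iha, ihb]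
    obtain ⟨_ | ⟨v, U⟩, u, c⟩ := shape w <;>
      simp [Shape.prepend, Shape.up, Shape.down, Forest.append]

theorem shape_coreList (c : List Forest) : shape (coreList c) = ⟨[], .nil, c⟩ := by
  induction c with
  | nil => rfl
  | cons u c ih => simp [coreList, shape, shape_append, ih, Shape.prepend, Shape.down]

theorem shape_wordOf (U : List Forest) (u : Forest) (c : List Forest) :
    shape (wordOf U u c) = ⟨U, u, c⟩ := by
  induction U with
  | nil => simp [wordOf, shape_append, shape_coreList, Shape.prepend]
  | cons v U ih => simp [wordOf, shape_append, shape, ih, Shape.prepend, Shape.up]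

/-! ### Sums over the splittings of a word -/

/-- The sum of `g x y` over all splittings `x s y` of a word with `s` the given arrow, where `d` down
arrows are open at the start and none is open after `x`, i.e. all down arrows of `x` and the `d`
given ones are joined to up arrows of `x`. -/
def splitSum {M : Type*} [AddCommMonoid M] (s : Arrow) :
    ℕ → (List Arrow → List Arrow → M) → List Arrow → M
  | _, _, [] => 0
  | 0, g, Arrow.up :: w =>
      (if s = Arrow.up then g [] w else 0) + splitSum s 0 (fun x y => g (Arrow.up :: x) y) w
  | d + 1, g, Arrow.up :: w => splitSum s d (fun x y => g (Arrow.up :: x) y) w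
  | d, g, Arrow.down :: w =>
      (if s = Arrow.down ∧ d = 0 then g [] w else 0) +
        splitSum s (d + 1) (fun x y => g (Arrow.down :: x) y) w

/-- The sum of `f w` over all words `w` of length `N`. -/
def wordSum {M : Type*} [AddCommMonoid M] : ℕ → (List Arrow → M) → M
  | 0, f => f []
  | N + 1, f => wordSum N (fun w => f (Arrow.up :: w)) + wordSum N (fun w => f (Arrow.down :: w))

section

variable {M : Type*} [AddCommMonoid M]

theorem wordSum_congr {N : ℕ} {f g : List Arrow → M} (h : ∀ w, w.length = N → f w = g w) :
    wordSum N f = wordSum N g := by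
  induction N generalizing f g with
  | zero => exact h _ rfl
  | succ N ih =>
    simp only [wordSum]
    rw [ih (fun w hw => h (_ :: w) (by simp [hw])), ih (fun w hw => h (_ :: w) (by simp [hw]))]

theorem wordSum_add (N : ℕ) (f g : List Arrow → M) :
    wordSum N (fun w => f w + g w) = wordSum N f + wordSum N g := by
  induction N generalizing f g with
  | zero => rfl
  | succ N ih => simp only [wordSum, ih]; exact add_add_add_comm _ _ _ _

theorem wordSum_zero (N : ℕ) : wordSum N (fun _ => (0 : M)) = 0 := by
  induction N with
  | zero => rfl
  | succ N ih => simp [wordSum, ih]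

theorem map_wordSum {M' F : Type*} [AddCommMonoid M'] [FunLike F M M'] [AddMonoidHomClass F M M']
    (φ : F) (N : ℕ) (f : List Arrow → M) : φ (wordSum N f) = wordSum N fun w => φ (f w) := by
  induction N generalizing f with
  | zero => rfl
  | succ N ih => simp [wordSum, ih]

theorem map_splitSum {M' F : Type*} [AddCommMonoid M'] [FunLike F M M'] [AddMonoidHomClass F M M']
    (φ : F) (s : Arrow) (d : ℕ) (g : List Arrow → List Arrow → M) (w : List Arrow) :
    φ (splitSum s d g w) = splitSum s d (fun x y => φ (g x y)) w := by
  induction w generalizing d g with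
  | nil => cases d <;> simp [splitSum]
  | cons t w ih =>
    cases t <;> cases d <;> simp [splitSum, ih] <;> split_ifs <;> simp

theorem splitSum_congr (s : Arrow) (d : ℕ) {g g' : List Arrow → List Arrow → M} {w : List Arrow}
    (h : ∀ x y, x ++ s :: y = w → g x y = g' x y) :
    splitSum s d g w = splitSum s d g' w := by
  induction w generalizing d g g' with
  | nil => cases d <;> simp [splitSum]
  | cons t w ih =>
    have h1 : ∀ d, splitSum s d (fun x y => g (t :: x) y) w =
        splitSum s d (fun x y => g' (t :: x) y) w :=
      fun d => ih d fun x y hxy => h _ _ (by simp [hxy])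
    have h2 : s = t → g [] w = g' [] w := fun hst => h [] w (by simp [hst])
    cases t <;> cases d <;> simp only [splitSum, h1] <;> congr 1
    · exact ite_congr rfl h2 fun _ => rfl
    · exact ite_congr rfl (fun h3 => h2 h3.1) fun _ => rfl
    · exact ite_congr rfl (fun h3 => h2 h3.1) fun _ => rfl

/-- Turning round the arrow at which the words are split is a bijection. -/
theorem wordSum_splitSum (N d : ℕ) (g : List Arrow → List Arrow → M) :
    wordSum N (splitSum Arrow.up d g) = wordSum N (splitSum Arrow.down d g) := by
  induction N generalizing d g with
  | zero => cases d <;> rfl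
  | succ N ih =>
    cases d with
    | zero =>
      have e1 : ∀ s w, splitSum s 0 g (Arrow.up :: w) = (if s = Arrow.up then g [] w else 0) +
        splitSum s 0 (fun x y => g (Arrow.up :: x) y) w := fun _ _ => rfl
      have e2 : ∀ s w, splitSum s 0 g (Arrow.down :: w) = (if s = Arrow.down then g [] w else 0) +
        splitSum s 1 (fun x y => g (Arrow.down :: x) y) w := by simp [splitSum]
      simp only [wordSum, e1, e2, wordSum_add, ih, if_true, reduceCtorEq, if_false, zero_add]
      rw [add_right_comm, add_comm (wordSum N _) (wordSum N _), add_right_comm, add_comm,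
        add_comm (wordSum N (g []))]
      simp only [add_assoc, add_comm]
    | succ d =>
      simp only [wordSum, splitSum, ih, reduceCtorEq, if_false, zero_add, Nat.succ_ne_zero,
        and_false]

theorem splitSum_succ_forest (s : Arrow) (d : ℕ) (g : List Arrow → List Arrow → M) (u : Forest)
    (w : List Arrow) : splitSum s (d + 1) g (u.toList ++ w) =
      splitSum s (d + 1) (fun x y => g (u.toList ++ x) y) w := by
  induction u generalizing d g w with
  | nil => rfl
  | node a b iha ihb =>
    simp [Forest.toList, splitSum, iha, ihb]

theorem splitSum_down_node (g : List Arrow → List Arrow → M) (a : Forest) (w : List Arrow) :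
    splitSum Arrow.down 0 g (Arrow.down :: (a.toList ++ Arrow.up :: w)) =
      g [] (a.toList ++ Arrow.up :: w) +
      splitSum Arrow.down 0 (fun x y => g (Arrow.down :: (a.toList ++ Arrow.up :: x)) y) w := by
  simp [splitSum, splitSum_succ_forest]

theorem splitSum_up_forest (g : List Arrow → List Arrow → M) (u : Forest) (w : List Arrow) :
    splitSum Arrow.up 0 g (u.toList ++ w) =
      splitSum Arrow.up 0 (fun x y => g (u.toList ++ x) y) w := by
  induction u generalizing g w with
  | nil => rfl
  | node a b _ ihb => simp [Forest.toList, splitSum, splitSum_succ_forest, ihb]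

theorem splitSum_coreList (s : Arrow) (d : ℕ) (g : List Arrow → List Arrow → M) (c : List Forest) :
    splitSum s (d + 1) g (coreList c) = 0 := by
  induction c generalizing d g with
  | nil => rfl
  | cons u c ih => simp [coreList, splitSum, splitSum_succ_forest, ih]

end

/-! ### The product formula in terms of shapes -/

/-- The product of `1 / [m_A]` over all arcs. -/
noncomputable def Forest.hook : Forest → Kq
  | nil => 1
  | node a b => a.hook * b.hook / qint (a.size + 1)

/-- The product of `[1 + m_A + d_A] / [1 + 2 m_A + d_A]` over all outer arcs, where `d_A` is the number
of arrows to the right of the arc if `y` arrows follow the system of arcs. -/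
noncomputable def Forest.outerRatio : Forest → ℕ → Kq
  | nil, _ => 1
  | node a b, y => qint (2 * b.size + y + 1 + (a.size + 1)) /
      qint (2 * b.size + y + 1 + 2 * (a.size + 1)) * b.outerRatio y

/-- The number of arrows of a core. -/
def coreLength : List Forest → ℕ
  | [] => 0
  | u :: c => 2 * u.size + 1 + coreLength c

/-- The number of arcs of a core. -/
def coreArcs : List Forest → ℕ
  | [] => 0
  | u :: c => u.size + coreArcs c

/-- The product of `1 / [m_A]` over all arcs of a core. -/
noncomputable def coreHook : List Forest → Kq
  | [] => 1
  | u :: c => u.hook * coreHook c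

/-- The contribution of a core to the product formula, apart from `coreHook` and the enumeration of
the arcs and arrows.  If `c.length` is even, the first arrow of `u :: c` is the star or the left end
of a dashed arc and contributes `1 / [2 d_{4,A}]`.  Otherwise it is the right end of a dashed arc or
the unpaired down arrow, and the outer arcs of `u` are not inside a dashed arc. -/
noncomputable def coreWeight : List Forest → Kq
  | [] => 1
  | u :: c => if Odd c.length then coreWeight c * u.outerRatio (coreLength c)
      else coreWeight c / qint (coreLength c + 2 * u.size + 2)

/-- The product formula without the factors that depend on the total number of arcs and arrows, for a
word which is preceded by an up arrow and a total of `p` up arrows and arcs. -/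
noncomputable def shapeWeight (u : Forest) (c : List Forest) : ℕ → List Forest → Kq
  | p, [] => u.hook * coreHook c * coreWeight c *
      if Odd c.length then qint (coreLength c + 2 * u.size + 1 + p) * u.outerRatio (coreLength c)
      else 1
  | p, v :: U => v.hook / qint (p + v.size + 1) * shapeWeight u c (p + v.size + 1) U

/-- The number of up arrows, arcs, dashed arcs and unpaired down arrows. -/
def objects (u : Forest) (c : List Forest) : List Forest → ℕ
  | [] => u.size + coreArcs c + c.length / 2
  | v :: U => v.size + 1 + objects u c U

/-- The product `[2][4] ⋯ [2 n]`. -/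
noncomputable def evenFact (n : ℕ) : Kq := ∏ i ∈ Finset.range n, qint (2 * (i + 1))

theorem evenFact_succ (n : ℕ) : evenFact (n + 1) = evenFact n * qint (2 * (n + 1)) := by
  simp [evenFact, Finset.prod_range_succ]

/-- The product formula for a word which is preceded by `p` up arrows and arcs, up to a factor that
depends on the latter. -/
noncomputable def weight (p : ℕ) (w : List Arrow) : Kq :=
  evenFact (objects (shape w).mid (shape w).core (shape w).ups + p) *
    shapeWeight (shape w).mid (shape w).core p (shape w).ups

/-- The number of up arrows that are not part of an arc. -/
def upCount (w : List Arrow) : ℕ := (shape w).ups.length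

/-- The word has an odd number of down arrows and no up arrows that are not part of an arc. -/
def OddCore (w : List Arrow) : Prop := upCount w = 0 ∧ Odd (shape w).core.length

instance (w : List Arrow) : Decidable (OddCore w) := inferInstanceAs (Decidable (_ ∧ _))

theorem upCount_forest_up (u : Forest) (w : List Arrow) :
    upCount (u.toList ++ Arrow.up :: w) = upCount w + 1 := by
  simp [upCount, shape_append, shape, Shape.up, Shape.prepend]

theorem upCount_forest (u : Forest) : upCount u.toList = 0 := by
  have := shape_append u []
  rw [List.append_nil] at this
  simp [upCount, this, shape, Shape.prepend]

theorem weight_forest_up (p : ℕ) (u : Forest) (w : List Arrow) :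
    weight p (u.toList ++ Arrow.up :: w) =
      u.hook / qint (p + u.size + 1) * weight (p + u.size + 1) w := by
  simp only [weight, shape_append, shape, Shape.up, Shape.prepend, objects, shapeWeight,
    Forest.append_nil]
  rw [show ∀ n, u.size + 1 + n + p = n + (p + u.size + 1) by intro n; ring]
  ring

theorem weight_wordOf_nil (p : ℕ) (u : Forest) (c : List Forest) :
    weight p (u.toList ++ coreList c) =
      evenFact (u.size + coreArcs c + c.length / 2 + p) * (u.hook * coreHook c * coreWeight c *
      if Odd c.length then qint (coreLength c + 2 * u.size + 1 + p) * u.outerRatio (coreLength c)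
      else 1) := by
  simp [weight, shape_append, shape_coreList, Shape.prepend, objects, shapeWeight]

theorem length_coreList (c : List Forest) : (coreList c).length = coreLength c := by
  induction c with
  | nil => rfl
  | cons u c ih => simp [coreList, coreLength, ih]; ring

theorem coreLength_eq (c : List Forest) : coreLength c = 2 * coreArcs c + c.length := by
  induction c with
  | nil => rfl
  | cons u c ih => simp [coreLength, coreArcs, ih]; ring

theorem Forest.hook_append (u v : Forest) : (u.append v).hook = u.hook * v.hook := by
  induction u with
  | nil => simp [append, hook]
  | node a b _ ihb => simp [append, hook, ihb]; ring

/-! ### Down arrows in front do not change the product formula -/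

/-- The recursion for the coefficients of words with a down arrow in front. -/
theorem weight_down (w : List Arrow) : weight 0 (Arrow.down :: w) = weight 0 w := by
  simp only [weight, shape]
  obtain ⟨U, u, c⟩ := shape w
  have hpos : ∀ n : ℕ, qint ((n : ℤ) + 1) ≠ 0 := fun n => qint_pos_ne_zero (by positivity)
  rcases U with _ | ⟨v, _ | ⟨v', U⟩⟩
  -- without up arrows, the new arrow is another arrow of the core
  · simp only [Shape.down, objects, shapeWeight, List.length_cons, coreArcs, coreHook, coreWeight,
      Forest.size, Forest.hook, Forest.outerRatio, coreLength, Nat.odd_add_one]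
    by_cases h : Odd c.length
    · obtain ⟨k, hk⟩ := h
      have h1 : 0 + (u.size + coreArcs c) + (c.length + 1) / 2 + 0 =
        u.size + coreArcs c + c.length / 2 + 0 + 1 := by omega
      have h2 : 2 * ((u.size + coreArcs c + c.length / 2 : ℕ) + 1 : ℤ) =
        coreLength c + 2 * u.size + 1 + (0 : ℕ) := by
        have := coreLength_eq c
        push_cast; omega
      have h0 : Odd c.length := ⟨k, hk⟩
      rw [h1, evenFact_succ, add_zero, h2]
      simp only [h0, not_true_eq_false, if_true, if_false]
      ring
    · have h1 : 0 + (u.size + coreArcs c) + (c.length + 1) / 2 + 0 =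
        u.size + coreArcs c + c.length / 2 + 0 := by
        have := Nat.not_odd_iff_even.1 h
        obtain ⟨k, hk⟩ := this
        omega
      have h2 : ((2 * u.size + 1 + coreLength c : ℕ) : ℤ) + 2 * (0 : ℕ) + 1 + (0 : ℕ) =
        coreLength c + 2 * u.size + 2 := by push_cast; ring
      rw [h1]
      simp only [h, not_false_eq_true, if_true, if_false]
      rw [h2]
      have h3 : qint (coreLength c + 2 * u.size + 2) ≠ 0 := qint_pos_ne_zero (by positivity)
      field_simp
  -- the new arrow is joined to the only up arrow, and no up arrow remains to the left of the new arc
  · simp only [Shape.down, objects, shapeWeight, Forest.size, Forest.hook, Forest.outerRatio]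
    have h1 : v.size + u.size + 1 + coreArcs c + c.length / 2 + 0 =
      v.size + 1 + (u.size + coreArcs c + c.length / 2) + 0 := by ring
    have h2 : (coreLength c : ℤ) + 2 * (v.size + u.size + 1 : ℕ) + 1 + (0 : ℕ) =
      2 * u.size + coreLength c + 1 + 2 * (v.size + 1) := by push_cast; ring
    have h3 : (coreLength c : ℤ) + 2 * u.size + 1 + (0 + v.size + 1 : ℕ) =
      2 * u.size + coreLength c + 1 + (v.size + 1) := by push_cast; ring
    rw [h1, h2, h3]
    have h4 : qint (2 * u.size + coreLength c + 1 + 2 * (v.size + 1)) ≠ 0 :=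
      qint_pos_ne_zero (by positivity)
    have h5 := hpos v.size
    simp only [Nat.cast_zero, zero_add]
    split_ifs
    · field_simp
    · field_simp
  -- the new arrow is joined to the first up arrow, but another up arrow follows
  · simp only [Shape.down, objects, shapeWeight, Forest.size, Forest.hook]
    have h1 : v.size + v'.size + 1 + 1 + objects u c U + 0 =
      v.size + 1 + (v'.size + 1 + objects u c U) + 0 := by ring
    have h2 : 0 + (v.size + v'.size + 1) + 1 = 0 + v.size + 1 + v'.size + 1 := by ring
    have h3 : ((0 : ℕ) : ℤ) + (v.size + v'.size + 1 : ℕ) + 1 =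
      (0 + v.size + 1 : ℕ) + v'.size + 1 := by push_cast; ring
    rw [h1, h2, h3]
    have h5 := hpos v.size
    have h6 : qint ((0 + v.size + 1 : ℕ) + v'.size + 1) ≠ 0 := qint_pos_ne_zero (by positivity)
    simp only [Nat.cast_zero, zero_add] at *
    field_simp

/-! ### The recursion for an up arrow in front -/

/-- The part of `downTerm` that belongs to the outer arcs of `u`, if the weight depends on `u` only
through `hook` and `size`.  The system of arcs `x` in front of `u` makes the induction possible. -/
theorem splitSum_forest_of_hook (p : ℕ) (w : List Arrow) (Z : ℕ → Kq)
    (hZ : ∀ p' u, weight p' (Forest.toList u ++ w) = u.hook * Z (p' + u.size)) (x u : Forest) :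
    splitSum Arrow.down 0 (fun y z => q ^ (-(upCount (x.toList ++ y) : ℤ)) *
        weight p (x.toList ++ y ++ Arrow.up :: z)) (u.toList ++ w) =
      x.hook * u.hook * qint u.size / (qint (p + x.size + 1) * qint (p + x.size + 1 + u.size)) *
        Z (p + x.size + u.size + 1) +
      splitSum Arrow.down 0 (fun y z => q ^ (-(upCount (x.toList ++ u.toList ++ y) : ℤ)) *
        weight p (x.toList ++ u.toList ++ y ++ Arrow.up :: z)) w := by
  induction u generalizing x with
  | nil => simp [Forest.toList, Forest.size]
  | node a b _ ihb =>
    -- the first arc passes from `u` to `x`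
    have h1 := ihb (x.append (.node a .nil))
    simp only [Forest.toList, List.cons_append, List.append_assoc, List.nil_append,
      Forest.toList_append] at h1
    simp only [Forest.toList, List.cons_append, List.append_assoc]
    rw [splitSum_down_node]
    simp only [List.cons_append, List.append_assoc, List.nil_append]
    rw [h1]
    rw [List.append_nil, upCount_forest, weight_forest_up, weight_forest_up, hZ,
      ← add_assoc]
    congr 1
    simp only [Forest.hook_append, Forest.size_append, Forest.hook, Forest.size]
    have e : p + x.size + 1 + a.size + 1 + b.size = p + x.size + (a.size + b.size + 1) + 1 := by
      ring
    have e' : p + (x.size + (a.size + 0 + 1)) + b.size + 1 =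
      p + x.size + (a.size + b.size + 1) + 1 := by ring
    rw [e, e']
    generalize Z (p + x.size + (a.size + b.size + 1) + 1) = z
    set P : ℤ := p + x.size + 1 with hP
    have n1 : qint P ≠ 0 := qint_pos_ne_zero (by positivity)
    have n2 : qint (P + (a.size + 1)) ≠ 0 := qint_pos_ne_zero (by positivity)
    have n3 : qint (P + (a.size + 1) + b.size) ≠ 0 := qint_pos_ne_zero (by positivity)
    have n4 : qint ((a.size : ℤ) + 1) ≠ 0 := qint_pos_ne_zero (by positivity)
    have k1 := qint_mul_sub_mul b.size P (a.size + 1)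
    have i1 : ((p + x.size + 1 : ℕ) : ℤ) + a.size + 1 = P + (a.size + 1) := by
      rw [hP]; push_cast; ring
    have i2 : (p : ℤ) + ↑(x.size + (a.size + 0 + 1)) + 1 = P + (a.size + 1) := by
      rw [hP]; push_cast; ring
    have i3 : P + ((a.size + b.size + 1 : ℕ) : ℤ) = P + (a.size + 1) + b.size := by
      push_cast; ring
    have i4 : ((a.size + b.size + 1 : ℕ) : ℤ) = b.size + (a.size + 1) := by push_cast; ring
    have i5 : (b.size : ℤ) + P + (a.size + 1) = P + (a.size + 1) + b.size := by ring
    rw [i1, i2, i3, i4]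
    rw [i5] at k1
    simp only [Nat.cast_zero, neg_zero, zpow_zero, one_mul, mul_one]
    field_simp
    linear_combination (-x.hook * a.hook * b.hook * z) * k1

/-- The part of `downTerm` that belongs to the outer arcs of `u` in front of a core with a star and
without unpaired down arrow. -/
theorem splitSum_forest_of_odd (p : ℕ) (c : List Forest) (hc : Odd c.length) (x u : Forest) :
    splitSum Arrow.down 0 (fun y z => q ^ (-(upCount (x.toList ++ y) : ℤ)) *
        weight p (x.toList ++ y ++ Arrow.up :: z)) (u.toList ++ coreList c) =
      evenFact (x.size + u.size + coreArcs c + c.length / 2 + p + 1) *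
        (x.hook * u.hook * coreHook c * coreWeight c) *
        (qint (coreLength c + 2 * u.size + 1) / qint (p + x.size + 1) *
          u.outerRatio (coreLength c) - qint (coreLength c + 1) / qint (p + x.size + 1 + u.size)) +
      splitSum Arrow.down 0 (fun y z => q ^ (-(upCount (x.toList ++ u.toList ++ y) : ℤ)) *
        weight p (x.toList ++ u.toList ++ y ++ Arrow.up :: z)) (coreList c) := by
  induction u generalizing x with
  | nil => simp [Forest.toList, Forest.size, Forest.outerRatio]
  | node a b _ ihb =>
    -- the first arc passes from `u` to `x`
    have h1 := ihb (x.append (.node a .nil))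
    simp only [Forest.toList, List.cons_append, List.append_assoc, List.nil_append,
      Forest.toList_append] at h1
    simp only [Forest.toList, List.cons_append, List.append_assoc]
    rw [splitSum_down_node]
    simp only [List.cons_append, List.append_assoc, List.nil_append]
    rw [h1]
    rw [List.append_nil, upCount_forest, weight_forest_up, weight_forest_up,
      weight_wordOf_nil, ← add_assoc]
    congr 1
    simp only [Forest.hook_append, Forest.size_append, Forest.hook, Forest.size,
      Forest.outerRatio, hc, if_true]
    have e : b.size + coreArcs c + c.length / 2 + (p + x.size + 1 + a.size + 1) =
      x.size + (a.size + b.size + 1) + coreArcs c + c.length / 2 + p + 1 := by ring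
    have e' : x.size + (a.size + 0 + 1) + b.size + coreArcs c + c.length / 2 + p + 1 =
      x.size + (a.size + b.size + 1) + coreArcs c + c.length / 2 + p + 1 := by ring
    rw [e, e']
    generalize evenFact (x.size + (a.size + b.size + 1) + coreArcs c + c.length / 2 + p + 1) = z
    set P : ℤ := p + x.size + 1 with hP
    set Y : ℤ := coreLength c + 2 * b.size + 1 with hY
    have n1 : qint P ≠ 0 := qint_pos_ne_zero (by positivity)
    have n2 : qint (P + (a.size + 1)) ≠ 0 := qint_pos_ne_zero (by positivity)
    have n3 : qint (P + (a.size + 1) + b.size) ≠ 0 := qint_pos_ne_zero (by positivity)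
    have n4 : qint ((a.size : ℤ) + 1) ≠ 0 := qint_pos_ne_zero (by positivity)
    have n5 : qint (Y + 2 * (a.size + 1)) ≠ 0 := qint_pos_ne_zero (by positivity)
    have k1 := qint_mul_sub_mul Y P (a.size + 1)
    have i1 : ((p + x.size + 1 : ℕ) : ℤ) + a.size + 1 = P + (a.size + 1) := by
      rw [hP]; push_cast; ring
    have i2 : (p : ℤ) + ↑(x.size + (a.size + 0 + 1)) + 1 = P + (a.size + 1) := by
      rw [hP]; push_cast; ring
    have i3 : P + ((a.size + b.size + 1 : ℕ) : ℤ) = P + (a.size + 1) + b.size := by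
      push_cast; ring
    have i4 : (coreLength c : ℤ) + 2 * ↑(a.size + b.size + 1) + 1 = Y + 2 * (a.size + 1) := by
      rw [hY]; push_cast; ring
    have i5 : Y + ((p + x.size + 1 + a.size + 1 : ℕ) : ℤ) = Y + P + (a.size + 1) := by
      rw [hP]; push_cast; ring
    have i6 : 2 * (b.size : ℤ) + coreLength c + 1 = Y := by rw [hY]; ring
    rw [i1, i2, i3, i4, i5, i6]
    simp only [Nat.cast_zero, neg_zero, zpow_zero, one_mul, mul_one]
    field_simp
    linear_combination (-x.hook * a.hook * z * b.hook * coreHook c * coreWeight c *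
      b.outerRatio (coreLength c) * qint (P + (a.size + 1) + b.size)) * k1

/-- The sum over the words that arise by turning round a down arrow such that all down arrows on its
left are joined to up arrows on its left, for the recursion of `weight`. -/
noncomputable def downTerm (p : ℕ) (w : List Arrow) : Kq :=
  splitSum Arrow.down 0 (fun x y => q ^ (-(upCount x : ℤ)) * weight p (x ++ Arrow.up :: y)) w

/-- The contribution to the recursion of `weight` of the word where the last up arrow is turned
round, which is present if an odd number of down arrows follows. -/
noncomputable def upTerm (p : ℕ) (w : List Arrow) : Kq :=
  splitSum Arrow.up 0 (fun x y => if OddCore y then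
    q ^ (-(upCount x : ℤ)) * weight p (x ++ Arrow.down :: y) else 0) w

/-- The contribution to the recursion of `weight` of the word itself if it has no down arrows
outside of arcs. -/
noncomputable def selfTerm (p : ℕ) (w : List Arrow) : Kq :=
  if (shape w).core = [] then q ^ (-(upCount w : ℤ)) * weight p w else 0

/-- The contribution to the recursion of `weight` of the word where the up arrow in front is turned
round.  It vanishes for `p = 0`. -/
noncomputable def barrierTerm (p : ℕ) (w : List Arrow) : Kq :=
  if OddCore w then q * qint p * weight p w / qint (w.length + p + 1) else 0

theorem downTerm_forest_up (p : ℕ) (u : Forest) (w : List Arrow) :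
    downTerm p (u.toList ++ Arrow.up :: w) =
      u.hook * qint u.size / (qint (p + 1) * qint (p + 1 + u.size) * qint (p + u.size + 2)) *
        weight (p + u.size + 2) w +
      u.hook / qint (p + u.size + 1) * q⁻¹ * downTerm (p + u.size + 1) w := by
  have h := splitSum_forest_of_hook p (Arrow.up :: w)
    (fun n => weight (n + 1) w / qint (n + 1))
    (fun p' u' => by rw [weight_forest_up]; push_cast; ring) .nil u
  simp only [Forest.toList, List.nil_append] at h
  rw [downTerm, h]
  congr 1
  · simp only [Forest.size, Forest.hook]
    push_cast
    simp only [add_zero, one_mul]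
    rw [show (p : ℤ) + u.size + 1 + 1 = p + u.size + 2 by ring]
    field_simp
  · have e : ∀ (g : List Arrow → List Arrow → Kq), splitSum Arrow.down 0 g (Arrow.up :: w) =
      splitSum Arrow.down 0 (fun x y => g (Arrow.up :: x) y) w := by
      intro g; simp [splitSum]
    rw [e, downTerm, ← AddMonoidHom.coe_mulLeft, map_splitSum]
    refine splitSum_congr _ _ fun x y _ => ?_
    rw [AddMonoidHom.coe_mulLeft, upCount_forest_up, List.append_assoc, List.cons_append,
      weight_forest_up]
    push_cast
    rw [neg_add, zpow_add₀ q_ne_zero, zpow_neg_one]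
    ring

theorem upTerm_forest_up (p : ℕ) (u : Forest) (w : List Arrow) :
    upTerm p (u.toList ++ Arrow.up :: w) =
      (if OddCore w then weight p (u.toList ++ Arrow.down :: w) else 0) +
      u.hook / qint (p + u.size + 1) * q⁻¹ * upTerm (p + u.size + 1) w := by
  rw [upTerm, splitSum_up_forest]
  have e : ∀ (g : List Arrow → List Arrow → Kq), splitSum Arrow.up 0 g (Arrow.up :: w) =
      g [] w + splitSum Arrow.up 0 (fun x y => g (Arrow.up :: x) y) w := by
    intro g; simp [splitSum]
  rw [e]
  congr 1
  · rw [List.append_nil, upCount_forest]; simp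
  · rw [upTerm, ← AddMonoidHom.coe_mulLeft, map_splitSum]
    refine splitSum_congr _ _ fun x y _ => ?_
    rw [AddMonoidHom.coe_mulLeft, mul_ite, mul_zero]
    refine ite_congr rfl (fun _ => ?_) fun _ => rfl
    rw [upCount_forest_up, List.append_assoc, List.cons_append, weight_forest_up]
    push_cast
    rw [neg_add, zpow_add₀ q_ne_zero, zpow_neg_one]
    ring

theorem selfTerm_forest_up (p : ℕ) (u : Forest) (w : List Arrow) :
    selfTerm p (u.toList ++ Arrow.up :: w) =
      u.hook / qint (p + u.size + 1) * q⁻¹ * selfTerm (p + u.size + 1) w := by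
  have h : (shape (u.toList ++ Arrow.up :: w)).core = (shape w).core := by
    simp [shape_append, shape, Shape.up, Shape.prepend]
  rw [selfTerm, selfTerm, h, mul_ite, mul_zero, upCount_forest_up, weight_forest_up]
  push_cast
  rw [neg_add, zpow_add₀ q_ne_zero, zpow_neg_one]
  refine ite_congr rfl (fun _ => by ring) fun _ => rfl

theorem oddCore_forest_coreList (u : Forest) (c : List Forest) :
    OddCore (u.toList ++ coreList c) ↔ Odd c.length := by
  simp [OddCore, upCount, shape_append, shape_coreList, Shape.prepend]

/-- The first summand of `upTerm_forest_up` is a correction term for the word behind the up arrow.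
-/
theorem weight_down_of_oddCore (p : ℕ) (u : Forest) (w : List Arrow) (h : OddCore w) :
    weight p (u.toList ++ Arrow.down :: w) = u.hook / qint (p + u.size + 1) * q⁻¹ *
      barrierTerm (p + u.size + 1) w := by
  have hw := wordOf_shape w
  obtain ⟨h1, h2⟩ := id h
  rw [upCount, List.length_eq_zero_iff] at h1
  rw [h1] at hw
  generalize (shape w).mid = v at hw
  generalize (shape w).core = c at hw h2
  rw [wordOf] at hw
  subst hw
  rw [barrierTerm, if_pos h, weight_wordOf_nil]
  have e := weight_wordOf_nil p u (v :: c)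
  rw [coreList] at e
  have h3 : ¬ Odd (v :: c).length := by simp [Nat.odd_add_one, h2]
  rw [e, if_neg h3, if_pos h2]
  simp only [coreArcs, coreHook, coreWeight, h2, if_true, List.length_append, List.length_cons,
    Forest.length_toList, length_coreList]
  have e1 : u.size + (v.size + coreArcs c) + (c.length + 1) / 2 + p =
      v.size + coreArcs c + c.length / 2 + (p + u.size + 1) := by
    obtain ⟨k, hk⟩ := h2
    omega
  have n1 : qint ((p : ℤ) + u.size + 1) ≠ 0 := qint_pos_ne_zero (by positivity)
  have n2 : qint ((coreLength c : ℤ) + 2 * v.size + 1 + (p + u.size + 1)) ≠ 0 :=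
    qint_pos_ne_zero (by positivity)
  rw [e1]
  push_cast
  rw [show 2 * (v.size : ℤ) + coreLength c + (p + u.size + 1) + 1 =
    coreLength c + 2 * v.size + 1 + (p + u.size + 1) by ring]
  have := q_ne_zero
  field_simp

theorem q_pow_mul_qint_add (a b : ℕ) :
    q ^ a * qint (a + b) = q ^ (a + b) * qint a + qint b := by
  have n0 := pow_ne_zero a q_ne_zero
  rw [qint_add' a b, zpow_neg, zpow_natCast, zpow_natCast, pow_add]
  field_simp
  ring

/-- What the recursion of `weight` amounts to in front of a core of odd length. -/
theorem qint_odd_identity (p m : ℕ) :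
    qint (2 * p + m) * (q ^ (p + 1) * qint (p + 1 + m) - qint m) =
      qint (p + 1) * (q ^ (2 * p + 1 + m) * qint (m + p) + q * qint p) := by
  have h1 := q_pow_mul_qint_add (p + 1) m
  have h2 := qint_add p (m + p)
  have n0 := pow_ne_zero (m + p) q_ne_zero
  rw [zpow_natCast, zpow_neg] at h2
  rw [show q ^ ((m : ℤ) + p) = q ^ (m + p) by norm_cast] at h2
  push_cast at h1
  rw [show 2 * (p : ℤ) + m = p + (m + p) by ring, h2, h1]
  rw [show p + 1 + m = m + p + 1 by ring, show 2 * p + 1 + m = m + p + 1 + p by ring,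
    pow_add _ (m + p + 1) p, pow_succ q (m + p)]
  simp only [pow_add, pow_one] at *
  have n1 := pow_ne_zero p q_ne_zero
  have n2 := pow_ne_zero m q_ne_zero
  generalize q ^ p = a at *
  generalize q ^ m = b at *
  field_simp
  ring

/-- What the recursion of `weight` amounts to in front of a core of even length. -/
theorem qint_even_identity (P s L : ℕ) (h : 0 < P) :
    q ^ P / qint P * qint (2 * P + 2 * s + L) = q ^ (2 * P + 2 * s + L) +
      qint (2 * P + 2 * s + L) * qint s / (qint P * qint (P + s)) +
      qint (L + P + s) / qint (P + s) := by
  have n1 : qint P ≠ 0 := qint_pos_ne_zero (by positivity)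
  have n2 : qint (P + s) ≠ 0 := qint_pos_ne_zero (by positivity)
  have h1 := q_pow_mul_qint_add P s
  have h2 := q_pow_mul_qint_add (P + s) (L + P + s)
  push_cast at h2
  rw [show (P : ℤ) + s + (L + P + s) = 2 * P + 2 * s + L by ring,
    show P + s + (L + P + s) = 2 * P + 2 * s + L by ring] at h2
  field_simp
  linear_combination qint (2 * P + 2 * s + L) * h1 + qint P * h2

theorem splitSum_down_coreList {M : Type*} [AddCommMonoid M] (g : List Arrow → List Arrow → M)
    (v : Forest) (c : List Forest) :
    splitSum Arrow.down 0 g (coreList (v :: c)) = g [] (v.toList ++ coreList c) := by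
  simp [coreList, splitSum, splitSum_succ_forest, splitSum_coreList]

theorem splitSum_up_coreList {M : Type*} [AddCommMonoid M] (g : List Arrow → List Arrow → M)
    (c : List Forest) : splitSum Arrow.up 0 g (coreList c) = 0 := by
  cases c with
  | nil => rfl
  | cons v c => simp [coreList, splitSum, splitSum_succ_forest, splitSum_coreList]

/-- The recursion for the coefficients of words with an up arrow in front, which is the case `p =
0`. For `p > 0` the word `w` is the part of a longer word behind an up arrow, and `barrierTerm`
accounts for that arrow. -/
theorem weight_recursion (U : List Forest) (u : Forest) (c : List Forest) (p : ℕ) :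
    q ^ (p + 1) / qint (p + 1) * weight (p + 1) (wordOf U u c) =
      q ^ (2 * p + 2 + (wordOf U u c).length) * weight p (wordOf U u c) +
      downTerm p (wordOf U u c) + upTerm p (wordOf U u c) + selfTerm p (wordOf U u c) +
      barrierTerm p (wordOf U u c) := by
  induction U generalizing p with
  | cons v U ih =>
    have h := ih (p + v.size + 1)
    simp only [wordOf]
    rw [downTerm_forest_up, upTerm_forest_up, selfTerm_forest_up, weight_forest_up,
      weight_forest_up]
    have hb : barrierTerm p (v.toList ++ Arrow.up :: wordOf U u c) = 0 := by
      rw [barrierTerm, if_neg]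
      simp [OddCore, upCount_forest_up]
    -- turning round the up arrow behind `v` is the correction term of the shorter word
    have hd : (if OddCore (wordOf U u c) then weight p (v.toList ++ Arrow.down :: wordOf U u c)
        else 0) = v.hook / qint (p + v.size + 1) * q⁻¹ *
          barrierTerm (p + v.size + 1) (wordOf U u c) := by
      split_ifs with h1
      · exact weight_down_of_oddCore _ _ _ h1
      · rw [barrierTerm, if_neg h1, mul_zero]
    rw [hb, hd]
    generalize barrierTerm (p + v.size + 1) (wordOf U u c) = b at *
    generalize selfTerm (p + v.size + 1) (wordOf U u c) = s at *
    generalize upTerm (p + v.size + 1) (wordOf U u c) = t at *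
    generalize downTerm (p + v.size + 1) (wordOf U u c) = d at *
    have n0 := q_ne_zero
    have n1 : qint ((p : ℤ) + 1) ≠ 0 := qint_pos_ne_zero (by positivity)
    have n2 : qint ((p : ℤ) + v.size + 1) ≠ 0 := qint_pos_ne_zero (by positivity)
    have n3 : qint ((p : ℤ) + v.size + 2) ≠ 0 := qint_pos_ne_zero (by positivity)
    rw [show p + 1 + v.size + 1 = p + v.size + 1 + 1 by ring,
      show p + v.size + 2 = p + v.size + 1 + 1 by ring]
    rw [show 2 * (p + v.size + 1) + 2 + (wordOf U u c).length =
      2 * p + 2 + (v.toList ++ Arrow.up :: wordOf U u c).length + 1 by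
        simp; ring, pow_succ q (2 * p + 2 + (v.toList ++ Arrow.up :: wordOf U u c).length)] at h
    generalize weight (p + v.size + 1 + 1) (wordOf U u c) = w1 at *
    generalize weight (p + v.size + 1) (wordOf U u c) = w0 at *
    generalize q ^ (2 * p + 2 + (v.toList ++ Arrow.up :: wordOf U u c).length) = Q at *
    push_cast at h ⊢
    rw [show (p : ℤ) + 1 + v.size = p + v.size + 1 by ring]
    rw [show (p : ℤ) + v.size + 1 + 1 = p + v.size + 2 by ring] at *
    have key : q ^ (p + 1) * qint (p + v.size + 1) - q ^ (p + v.size + 1) * qint (p + 1) =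
        qint v.size := by
      have h1 := qint_add' (p + 1) v.size
      have h2 := qint_add (p + 1) v.size
      have e : ((p : ℤ) + v.size + 1) = p + 1 + v.size := by ring
      rw [e, h1, show p + v.size + 1 = p + 1 + v.size by ring, pow_add q (p + 1) v.size]
      have e2 : q ^ (-((p : ℤ) + 1)) = (q ^ (p + 1))⁻¹ := by
        rw [zpow_neg]; norm_cast
      rw [e2, zpow_natCast]
      have := pow_ne_zero (p + 1) n0
      field_simp
      ring
    have h' : q⁻¹ * (q ^ (p + v.size + 1 + 1) / qint (p + v.size + 2) * w1) =
      q⁻¹ * (Q * q * w0 + d + t + s + b) := by rw [h]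
    rw [show q ^ (p + v.size + 1 + 1) = q ^ (p + v.size + 1) * q from pow_succ _ _] at h'
    have h'' : Q * w0 = q ^ (p + v.size + 1) / qint (p + v.size + 2) * w1 -
        q⁻¹ * (d + t + s + b) := by
      field_simp at h' ⊢
      linear_combination -h'
    have e3 : Q * (v.hook / qint (p + v.size + 1) * w0) = v.hook / qint (p + v.size + 1) *
      (Q * w0) := by ring
    rw [e3, h'']
    field_simp
    linear_combination v.hook * w1 * q * key
  | nil =>
    have n0 := q_ne_zero
    have n1 : qint ((p : ℤ) + 1) ≠ 0 := qint_pos_ne_zero (by positivity)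
    have n2 : qint ((p : ℤ) + 1 + u.size) ≠ 0 := qint_pos_ne_zero (by positivity)
    simp only [wordOf]
    have hup : upTerm p (u.toList ++ coreList c) = 0 := by
      rw [upTerm, splitSum_up_forest, splitSum_up_coreList]
    have hself : c ≠ [] → selfTerm p (u.toList ++ coreList c) = 0 := by
      intro hc
      rw [selfTerm, if_neg]
      simp [shape_append, shape_coreList, Shape.prepend, hc]
    have hself' : c = [] → selfTerm p (u.toList ++ coreList c) = weight p (u.toList) := by
      rintro rfl
      simp [selfTerm, coreList, upCount_forest]
      intro h
      exact absurd (by simpa [wordOf, coreList] using congrArg Shape.core (shape_wordOf [] u [])) h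
    by_cases hc : Odd c.length
    -- there is a star and no unpaired down arrow
    · obtain _ | ⟨v, c⟩ := c
      · simp at hc
      obtain ⟨k, hk⟩ : Even c.length := by simpa [Nat.odd_add_one] using hc
      have hk' : ¬ Odd c.length := Nat.not_odd_iff_even.2 ⟨k, hk⟩
      have hd := splitSum_forest_of_odd p (v :: c) hc .nil u
      rw [splitSum_down_coreList] at hd
      simp only [Forest.toList, List.nil_append, Forest.size, Forest.hook, List.append_nil,
        upCount_forest, weight_forest_up, weight_wordOf_nil] at hd
      simp only [hup, hself, ne_eq, reduceCtorEq, not_false_eq_true, barrierTerm,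
        oddCore_forest_coreList, weight_wordOf_nil, hc, if_true, downTerm, hd,
        List.length_append, length_coreList, Forest.length_toList]
      set L := coreLength (v :: c) with hL
      have hL' : L = 2 * v.size + 2 * coreArcs c + 2 * k + 1 := by
        rw [hL, coreLength_eq, coreArcs, List.length_cons, hk]; ring
      set N := u.size + v.size + coreArcs c + k + p with hN
      have hv : (coreLength c : ℤ) + 2 * v.size + 2 = L + 1 := by
        rw [hL, coreLength]; push_cast; ring
      simp only [coreArcs, coreHook, coreWeight, hk', if_false, List.length_cons, hv]
      rw [hk]
      rw [show u.size + (v.size + coreArcs c) + (k + k + 1) / 2 + (p + 1) = N + 1 by omega,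
        show u.size + (v.size + coreArcs c) + (k + k + 1) / 2 + p = N by omega,
        show 0 + u.size + (v.size + coreArcs c) + (k + k + 1) / 2 + p + 1 = N + 1 by omega,
        show v.size + coreArcs c + (k + k) / 2 + (p + u.size + 1) = N + 1 by omega,
        evenFact_succ]
      have key := qint_odd_identity p (L + 2 * u.size + 1)
      rw [show 2 * (p : ℤ) + (L + 2 * u.size + 1 : ℕ) = 2 * (N + 1) by rw [hN, hL']; push_cast; ring]
        at key
      rw [show 2 * p + 1 + (L + 2 * u.size + 1) = 2 * p + 2 + (2 * u.size + L) by ring] at key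
      generalize q ^ (2 * p + 2 + (2 * u.size + L)) = Q at *
      generalize q ^ (p + 1) = Q' at *
      push_cast at key ⊢
      rw [show (p : ℤ) + 1 + (L + 2 * u.size + 1) = L + 2 * u.size + 1 + (p + 1) by ring] at key
      rw [show 2 * (u.size : ℤ) + L + p + 1 = L + 2 * u.size + 1 + p by ring,
        show (p : ℤ) + u.size + 1 = p + 1 + u.size by ring]
      have n3 : qint (L + 2 * u.size + 1 + p) ≠ 0 := qint_pos_ne_zero (by positivity)
      have n4 : qint (L + 1) ≠ 0 := qint_pos_ne_zero (by positivity)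
      simp only [add_zero, neg_zero, zpow_zero, one_mul, mul_one]
      generalize evenFact N = z
      generalize u.outerRatio L = r
      field_simp
      linear_combination (u.hook * v.hook * coreHook c * coreWeight c * r * z *
        qint (p + 1 + u.size)) * key
    · have hd := splitSum_forest_of_hook p (coreList c)
        (fun n => evenFact (n + coreArcs c + c.length / 2) * (coreHook c * coreWeight c))
        (fun p' u' => by
          rw [weight_wordOf_nil, if_neg hc, show u'.size + coreArcs c + c.length / 2 + p' =
            p' + u'.size + coreArcs c + c.length / 2 by ring]; ring) .nil u
      obtain _ | ⟨v, c⟩ := c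
      -- all down arrows belong to arcs
      · have e0 : ∀ g, splitSum Arrow.down 0 g (coreList []) = (0 : Kq) := fun _ => rfl
        simp only [Forest.toList, List.nil_append, Forest.size, Forest.hook, e0,
          coreArcs, coreHook, coreWeight] at hd
        simp only [hup, hself', barrierTerm, oddCore_forest_coreList, downTerm, hc, if_false,
          List.length_append, length_coreList, coreLength, Forest.length_toList,
          weight_wordOf_nil, hd]
        have hw := weight_wordOf_nil p u []
        simp only [coreList, List.append_nil, hc, if_false] at hw
        have key := qint_even_identity (p + 1) u.size 0 (by omega)
        simp only [hw, coreArcs, coreHook, coreWeight, List.length_nil]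
        rw [show u.size + 0 + 0 / 2 + (p + 1) = u.size + p + 1 by omega,
          show p + 0 + u.size + 1 + 0 + 0 / 2 = u.size + p + 1 by omega,
          show u.size + 0 + 0 / 2 + p = u.size + p by omega, evenFact_succ]
        rw [show 2 * (p + 1) + 2 * u.size + 0 = 2 * p + 2 + (2 * u.size + 0) by ring] at key
        push_cast at key ⊢
        rw [show 2 * ((p : ℤ) + 1) + 2 * u.size + 0 = 2 * (u.size + p + 1) by ring,
          show 0 + ((p : ℤ) + 1) + u.size = p + 1 + u.size by ring, div_self n2] at key
        simp only [add_zero, one_mul, mul_one] at key ⊢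
        linear_combination (evenFact (u.size + p) * u.hook) * key
      -- there are a star and an unpaired down arrow
      · obtain ⟨k, hk⟩ : Odd c.length := by simpa [Nat.odd_add_one] using hc
        have hk' : Odd c.length := ⟨k, hk⟩
        rw [splitSum_down_coreList] at hd
        simp only [Forest.toList, List.nil_append, Forest.size, Forest.hook, List.append_nil,
          upCount_forest, weight_forest_up, weight_wordOf_nil] at hd
        simp only [hup, hself, ne_eq, reduceCtorEq, not_false_eq_true, barrierTerm,
          oddCore_forest_coreList, weight_wordOf_nil, hc, if_false, downTerm, hd,
          List.length_append, length_coreList, Forest.length_toList]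
        set L := coreLength (v :: c) with hL
        have hL' : L = 2 * v.size + 2 * coreArcs c + 2 * k + 2 := by
          rw [hL, coreLength_eq, coreArcs, List.length_cons, hk]; ring
        set N := u.size + v.size + coreArcs c + k + 1 + p with hN
        have hv : (coreLength c : ℤ) + 2 * v.size + 1 = L := by
          rw [hL, coreLength]; push_cast; ring
        simp only [coreArcs, coreHook, coreWeight, hk', if_true, List.length_cons, hv]
        rw [hk]
        rw [show u.size + (v.size + coreArcs c) + (2 * k + 1 + 1) / 2 + (p + 1) = N + 1 by omega,
          show u.size + (v.size + coreArcs c) + (2 * k + 1 + 1) / 2 + p = N by omega,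
          show p + 0 + u.size + 1 + (v.size + coreArcs c) + (2 * k + 1 + 1) / 2 = N + 1 by omega,
          show v.size + coreArcs c + (2 * k + 1) / 2 + (p + u.size + 1) = N by omega,
          evenFact_succ]
        have key := qint_even_identity (p + 1) u.size L (by omega)
        rw [show 2 * ((p + 1 : ℕ) : ℤ) + 2 * u.size + L = 2 * (N + 1) by
            rw [hN, hL']; push_cast; ring,
          show 2 * (p + 1) + 2 * u.size + L = 2 * p + 2 + (2 * u.size + L) by ring] at key
        generalize q ^ (2 * p + 2 + (2 * u.size + L)) = Q at *
        generalize q ^ (p + 1) = Q' at *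
        push_cast at key ⊢
        rw [show (L : ℤ) + (p + 1) + u.size = L + (p + u.size + 1) by ring] at key
        rw [show (p : ℤ) + u.size + 1 = p + 1 + u.size by ring] at *
        simp only [add_zero, neg_zero, zpow_zero, one_mul, mul_one] at *
        linear_combination (evenFact N * u.hook * v.hook * coreHook c * coreWeight c *
          v.outerRatio (coreLength c)) * key

/-! ### The space of words -/

/-- The space with basis all words of arrows: the direct sum of all tensor powers of `V_1`, where an
up arrow stands for `v^1` and a down arrow for `v^{-1}`. -/
abbrev WordSpace : Type := List Arrow →₀ Kq

/-- The basis vector of a word. -/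
noncomputable def vec (w : List Arrow) : WordSpace := Finsupp.single w 1

/-- Put an arrow in front. -/
noncomputable def X (s : Arrow) : Module.End Kq WordSpace := Finsupp.lmapDomain Kq Kq (List.cons s)

@[simp] theorem X_vec (s : Arrow) (w : List Arrow) : X s (vec w) = vec (s :: w) := by
  simp [X, vec, Finsupp.mapDomain_single]

theorem X_apply_nil (s : Arrow) (x : WordSpace) : X s x [] = 0 :=
  Finsupp.mapDomain_of_notMem_range x _ (by simp)

/-! ### The dual canonical basis in tensor powers of `V_1` -/

/-- Put the vector of a system of arcs in front: each arc contributes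
`v^{-1} ⊗ v^1 - q⁻¹ v^1 ⊗ v^{-1}`. -/
noncomputable def forestOp : Forest → Module.End Kq WordSpace
  | .nil => 1
  | .node a b => (X .down * forestOp a * X .up - q⁻¹ • (X .up * forestOp a * X .down)) * forestOp b

/-- The vector of a core: the star contributes `v^{-1} - q⁻¹ v^1`, a dashed arc `v^{-1} ⊗ v^{-1} -
q⁻¹ v^1 ⊗ v^1` and an unpaired down arrow `v^{-1}`.  The first arrow of `u :: v :: c` is the left
end of a dashed arc if and only if `c.length` is odd. -/
noncomputable def coreVec : List Forest → WordSpace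
  | [] => vec []
  | [u] => X .down (forestOp u (vec [])) - q⁻¹ • X .up (forestOp u (vec []))
  | u :: v :: c =>
      if Odd c.length then
        X .down (forestOp u (X .down (forestOp v (coreVec c)))) -
          q⁻¹ • X .up (forestOp u (X .up (forestOp v (coreVec c))))
      else X .down (forestOp u (coreVec (v :: c)))

/-- The dual canonical basis element of the word `wordOf U u c`. -/
noncomputable def shapeVec (u : Forest) (c : List Forest) : List Forest → WordSpace
  | [] => forestOp u (coreVec c)
  | v :: U => forestOp v (X .up (shapeVec u c U))

/-- The dual canonical basis element of a word. -/
noncomputable def dualVec (w : List Arrow) : WordSpace :=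
  shapeVec (shape w).mid (shape w).core (shape w).ups

theorem forestOp_append (u v : Forest) : forestOp (u.append v) = forestOp u * forestOp v := by
  induction u with
  | nil => simp [Forest.append, forestOp]
  | node a b _ ihb => simp [Forest.append, forestOp, ihb, mul_assoc]

theorem dualVec_nil : dualVec [] = vec [] := rfl

theorem dualVec_up (w : List Arrow) : dualVec (.up :: w) = X .up (dualVec w) := by
  simp [dualVec, shape, Shape.up, shapeVec, forestOp]

theorem dualVec_forest (u : Forest) (w : List Arrow) :
    dualVec (u.toList ++ w) = forestOp u (dualVec w) := by
  rw [dualVec, dualVec, shape_append]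
  obtain ⟨_ | ⟨v, U⟩, m, c⟩ := shape w <;> simp [Shape.prepend, shapeVec, forestOp_append]

theorem dualVec_coreList (c : List Forest) : dualVec (coreList c) = coreVec c := by
  simp [dualVec, shape_coreList, shapeVec, forestOp]

theorem coreVec_of_even (u : Forest) (c : List Forest) (h : Odd c.length) :
    coreVec (u :: c) = X .down (forestOp u (coreVec c)) := by
  obtain _ | ⟨v, c⟩ := c
  · simp at h
  · rw [coreVec, if_neg]
    simpa [Nat.odd_add_one] using h

theorem coreVec_of_odd (u v : Forest) (c : List Forest) (h : Odd c.length) :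
    coreVec (u :: v :: c) = X .down (forestOp u (X .down (forestOp v (coreVec c)))) -
      q⁻¹ • X .up (forestOp u (X .up (forestOp v (coreVec c)))) := by
  rw [coreVec, if_pos h]

/-- What remains, behind an up arrow, of the difference between putting a down arrow in front of a
dual canonical basis element and the dual canonical basis element of the extended word; see
`X_down_dualVec`. -/
noncomputable def downRest (w : List Arrow) : WordSpace :=
  splitSum .up 0 (fun x y => q ^ (-1 - upCount x : ℤ) • dualVec (x ++ .down :: y)) w +
  splitSum .down 0 (fun x y =>
    if OddCore y then q ^ (-1 - upCount x : ℤ) • dualVec (x ++ .up :: y) else 0) w +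
  if (shape w).core = [] then q ^ (-1 - upCount w : ℤ) • dualVec w else 0

theorem splitSum_down_forest_of_eq_zero {M : Type*} [AddCommMonoid M]
    (g : List Arrow → List Arrow → M) (hg : ∀ x a w, g x (Forest.toList a ++ .up :: w) = 0)
    (u : Forest) (w : List Arrow) : splitSum .down 0 g (u.toList ++ w) =
      splitSum .down 0 (fun x y => g (u.toList ++ x) y) w := by
  induction u generalizing g with
  | nil => rfl
  | node a b _ ihb =>
    have h := ihb (fun x y => g (.down :: (a.toList ++ .up :: x)) y) fun _ _ _ => hg _ _ _
    simp only [Forest.toList, List.cons_append, List.append_assoc]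
    rw [splitSum_down_node, hg, zero_add, h]

theorem not_oddCore_forest_up (a : Forest) (w : List Arrow) :
    ¬ OddCore (a.toList ++ .up :: w) := by
  simp [OddCore, upCount_forest_up]

theorem smul_forest_up (u : Forest) (x w : List Arrow) :
    q ^ (-1 - upCount (u.toList ++ .up :: x) : ℤ) • dualVec (u.toList ++ .up :: w) =
      q⁻¹ • forestOp u (X .up (q ^ (-1 - upCount x : ℤ) • dualVec w)) := by
  rw [dualVec_forest, dualVec_up, upCount_forest_up, map_smul, map_smul, smul_smul]
  push_cast
  rw [show (-1 - (upCount x + 1) : ℤ) = -1 + (-1 - upCount x) by ring, zpow_add₀ q_ne_zero,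
    zpow_neg_one]

/-- The recursion that characterizes `downRest`: the vector `v^{-1} ⊗ x ⊗ v^1 - q⁻¹ v^1 ⊗ x ⊗
v^{-1}` of the arc between the new arrow and the first up arrow is responsible for the factor `q⁻¹`.
-/
theorem downRest_forest_up (u : Forest) (w : List Arrow) :
    downRest (u.toList ++ .up :: w) =
      q⁻¹ • (dualVec (u.toList ++ .down :: w) + forestOp u (X .up (downRest w))) := by
  have e1 : ∀ (g : List Arrow → List Arrow → WordSpace), splitSum .up 0 g (.up :: w) =
      g [] w + splitSum .up 0 (fun x y => g (.up :: x) y) w := by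
    intro g; simp [splitSum]
  have e2 : ∀ (g : List Arrow → List Arrow → WordSpace), splitSum .down 0 g (.up :: w) =
      splitSum .down 0 (fun x y => g (.up :: x) y) w := by
    intro g; simp [splitSum]
  have h : (shape (u.toList ++ Arrow.up :: w)).core = (shape w).core := by
    simp [shape_append, shape, Shape.up, Shape.prepend]
  rw [downRest, splitSum_up_forest, e1, splitSum_down_forest_of_eq_zero, e2, h]
  · have f : ∀ (s : Arrow) (g : List Arrow → List Arrow → WordSpace),
        q⁻¹ • forestOp u (X .up (splitSum s 0 g w)) =
          splitSum s 0 (fun x y => q⁻¹ • forestOp u (X .up (g x y))) w := by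
      intro s g
      exact map_splitSum (q⁻¹ • forestOp u * X .up) s 0 g w
    simp only [List.append_nil, upCount_forest, Nat.cast_zero, sub_zero, zpow_neg_one,
      List.append_assoc, List.cons_append, smul_forest_up]
    rw [downRest, map_add, map_add, map_add, map_add, smul_add, smul_add, smul_add, f, f]
    have e3 : (if (shape w).core = [] then
        q⁻¹ • forestOp u (X .up (q ^ (-1 - upCount w : ℤ) • dualVec w)) else 0) =
        q⁻¹ • forestOp u (X .up (if (shape w).core = [] then
          q ^ (-1 - upCount w : ℤ) • dualVec w else 0)) := by
      split_ifs <;> simp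
    rw [e3]
    have e4 : ∀ x y : List Arrow,
        q⁻¹ • forestOp u (X .up (if OddCore y then
          q ^ (-1 - upCount x : ℤ) • dualVec (x ++ .up :: y) else 0)) =
        if OddCore y then q⁻¹ • forestOp u (X .up
          (q ^ (-1 - upCount x : ℤ) • dualVec (x ++ .up :: y))) else 0 := by
      intro x y; split_ifs <;> simp
    simp only [e4]
    abel
  · intro x a w
    rw [if_neg (not_oddCore_forest_up a w)]

/-- Putting a down arrow in front of a dual canonical basis element, in terms of the dual canonical
basis. -/
theorem X_down_dualVec (w : List Arrow) :
    X .down (dualVec w) = dualVec (.down :: w) + X .up (downRest w) := by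
  have key : ∀ U u c, X .down (dualVec (wordOf U u c)) = dualVec (.down :: wordOf U u c) +
      X .up (downRest (wordOf U u c)) := by
    intro U u c
    induction U with
    | cons v U ih =>
      have e : Arrow.down :: (v.toList ++ .up :: wordOf U u c) =
        (Forest.node v .nil).toList ++ wordOf U u c := by simp [Forest.toList]
      rw [wordOf, e, dualVec_forest, dualVec_up, downRest_forest_up, dualVec_forest,
        dualVec_forest, ← map_add, ← ih, forestOp, forestOp]
      simp
    | nil =>
      have e : Arrow.down :: (u.toList ++ coreList c) = coreList (u :: c) := rfl
      rw [wordOf, downRest, splitSum_up_forest, splitSum_up_coreList,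
        splitSum_down_forest_of_eq_zero, e, dualVec_coreList, dualVec_forest, dualVec_coreList,
        shape_append, shape_coreList]
      · obtain _ | ⟨v, _ | ⟨v', c⟩⟩ := c
        · simp [coreVec, coreList, splitSum, Shape.prepend, upCount_forest]
        · simp [coreVec, splitSum_down_coreList, oddCore_forest_coreList, Shape.prepend]
        · simp only [splitSum_down_coreList, oddCore_forest_coreList]
          by_cases h : Odd c.length
          · have h' : ¬ Odd (v' :: c).length := by simp [Nat.odd_add_one, -Nat.not_odd_iff_even, h]
            have h'' : Odd (v :: v' :: c).length := by simpa [Nat.odd_add_one] using h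
            rw [coreVec_of_even _ _ h'', if_neg h']
            simp [Shape.prepend]
          · have h' : Odd (v' :: c).length := by simpa [Nat.odd_add_one] using h
            rw [if_pos h', coreVec_of_odd _ _ _ h', coreVec_of_even _ _ h', List.append_nil,
              upCount_forest, dualVec_forest, dualVec_up, dualVec_forest, dualVec_coreList]
            simp [Shape.prepend]
      · intro x a w
        rw [if_neg (not_oddCore_forest_up a w)]
  have h := key (shape w).ups (shape w).mid (shape w).core
  rwa [wordOf_shape] at h

/-! ### The expansion of the eigenvector -/

/-- The eigenvector `(v^{-1} + q^N v^1) ⊗ ⋯ ⊗ (v^{-1} + q v^1)`. -/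
noncomputable def eigenVec : ℕ → WordSpace
  | 0 => vec []
  | N + 1 => X .down (eigenVec N) + q ^ (N + 1) • X .up (eigenVec N)

theorem weight_up (w : List Arrow) : weight 0 (.up :: w) = weight 1 w := by
  have := weight_forest_up 0 .nil w
  simpa [Forest.toList, Forest.hook, Forest.size] using this

/-- The recursion of `weight` for an up arrow in front, with the same coefficients as in `downRest`.
-/
theorem weight_up_eq (w : List Arrow) :
    weight 0 (.up :: w) = q ^ (w.length + 1) * weight 0 w +
      splitSum .down 0 (fun x y => q ^ (-1 - upCount x : ℤ) * weight 0 (x ++ .up :: y)) w +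
      splitSum .up 0 (fun x y => if OddCore y then
        q ^ (-1 - upCount x : ℤ) * weight 0 (x ++ .down :: y) else 0) w +
      if (shape w).core = [] then q ^ (-1 - upCount w : ℤ) * weight 0 w else 0 := by
  have h := weight_recursion (shape w).ups (shape w).mid (shape w).core 0
  rw [wordOf_shape] at h
  have h0 := q_ne_zero
  have e : ∀ n : ℕ, q ^ (-1 - n : ℤ) = q⁻¹ * q ^ (-n : ℤ) := by
    intro n
    rw [sub_eq_add_neg, zpow_add₀ h0, zpow_neg_one]
  have f : ∀ (s : Arrow) (g : List Arrow → List Arrow → Kq),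
      splitSum s 0 (fun x y => q⁻¹ * g x y) w = q⁻¹ * splitSum s 0 g w := by
    intro s g
    exact (map_splitSum (AddMonoidHom.mulLeft q⁻¹) s 0 g w).symm
  have e4 : ∀ x y : List Arrow, (if OddCore y then
      q⁻¹ * (q ^ (-upCount x : ℤ) * weight 0 (x ++ .down :: y)) else 0) = q⁻¹ *
      if OddCore y then q ^ (-upCount x : ℤ) * weight 0 (x ++ .down :: y) else 0 := by
    intro x y; split_ifs <;> ring
  have e5 : (if (shape w).core = [] then q⁻¹ * (q ^ (-upCount w : ℤ) * weight 0 w) else 0) =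
      q⁻¹ * selfTerm 0 w := by
    rw [selfTerm]; split_ifs <;> ring
  simp only [e, mul_assoc, e4, e5, f]
  have hb : barrierTerm 0 w = 0 := by simp [barrierTerm]
  rw [hb] at h
  simp only [Nat.cast_zero, zero_add, qint_one, pow_one, div_one, mul_zero, add_zero] at h
  rw [weight_up]
  have h1 : weight 1 w = q⁻¹ * (q ^ (2 + w.length) * weight 0 w + downTerm 0 w + upTerm 0 w +
    selfTerm 0 w) := by rw [← h]; field_simp
  rw [h1, downTerm, upTerm, show 2 + w.length = w.length + 1 + 1 by ring, pow_succ _ (w.length + 1)]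
  field_simp

/-- The expansion of the eigenvector in the dual canonical basis of the tensor powers of `V_1`. -/
theorem wordSum_weight_smul_dualVec (N : ℕ) :
    wordSum N (fun w => weight 0 w • dualVec w) = eigenVec N := by
  induction N with
  | zero => simp [wordSum, eigenVec, weight, shape, objects, shapeWeight, coreArcs, Forest.size,
      evenFact, Forest.hook, coreHook, coreWeight, dualVec_nil]
  | succ N ih =>
    rw [eigenVec, ← ih, wordSum]
    have hX : ∀ (s : Arrow) (f : List Arrow → WordSpace), X s (wordSum N f) =
      wordSum N fun w => X s (f w) := fun s f => map_wordSum _ _ _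
    have hs : ∀ (a : Kq) (f : List Arrow → WordSpace), a • (wordSum N f) =
      wordSum N fun w => a • (f w) := fun a f =>
        map_wordSum (DistribSMul.toAddMonoidHom WordSpace a) _ _
    -- the recursion of `weight` collects, at each word, the contributions to `downRest` of the words
    -- with one arrow turned round
    have h1 : wordSum N (fun w => weight 0 (.up :: w) • dualVec w) =
        wordSum N (fun w => weight 0 w • downRest w) +
          wordSum N (fun w => q ^ (N + 1) • weight 0 w • dualVec w) := by
      have hg : ∀ s (g : List Arrow → List Arrow → Kq) w, splitSum s 0 g w • dualVec w =
          splitSum s 0 (fun x y => g x y • dualVec (x ++ s :: y)) w := by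
        intro s g w
        have := map_splitSum ((LinearMap.toSpanSingleton Kq WordSpace (dualVec w))) s 0 g w
        simp only [LinearMap.toSpanSingleton_apply] at this
        rw [this]
        exact splitSum_congr _ _ fun x y hxy => by rw [hxy]
      have hg' : ∀ s (g : List Arrow → List Arrow → WordSpace) w, weight 0 w • splitSum s 0 g w =
          splitSum s 0 (fun x y => weight 0 (x ++ s :: y) • g x y) w := by
        intro s g w
        have := map_splitSum (DistribSMul.toAddMonoidHom WordSpace (weight 0 w)) s 0 g w
        simp only [DistribSMul.toAddMonoidHom_apply] at this
        rw [this]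
        exact splitSum_congr _ _ fun x y hxy => by rw [hxy]
      have e1 : ∀ w, w.length = N → weight 0 (.up :: w) • dualVec w =
          (splitSum .down 0 (fun x y => weight 0 (x ++ .up :: y) • q ^ (-1 - upCount x : ℤ) •
            dualVec (x ++ .down :: y)) w +
          splitSum .up 0 (fun x y => weight 0 (x ++ .down :: y) •
            if OddCore y then q ^ (-1 - upCount x : ℤ) • dualVec (x ++ .up :: y) else 0) w) +
          (weight 0 w • (if (shape w).core = [] then q ^ (-1 - upCount w : ℤ) • dualVec w else 0) +
          q ^ (N + 1) • weight 0 w • dualVec w) := by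
        intro w hw
        rw [weight_up_eq, hw, add_smul, add_smul, add_smul, hg, hg]
        have e2 : ∀ x y : List Arrow, (if OddCore y then
            q ^ (-1 - upCount x : ℤ) * weight 0 (x ++ .down :: y) else 0) •
              dualVec (x ++ .up :: y) = weight 0 (x ++ .down :: y) •
            if OddCore y then q ^ (-1 - upCount x : ℤ) • dualVec (x ++ .up :: y) else 0 := by
          intro x y; split_ifs
          · rw [smul_smul, mul_comm]
          · simp
        have e3 : (if (shape w).core = [] then q ^ (-1 - upCount w : ℤ) * weight 0 w else 0) •
            dualVec w = weight 0 w •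
            (if (shape w).core = [] then q ^ (-1 - upCount w : ℤ) • dualVec w else 0) := by
          split_ifs
          · rw [smul_smul, mul_comm]
          · simp
        have e4 : ∀ x y : List Arrow, (q ^ (-1 - upCount x : ℤ) * weight 0 (x ++ .up :: y)) •
            dualVec (x ++ .down :: y) = weight 0 (x ++ .up :: y) • q ^ (-1 - upCount x : ℤ) •
            dualVec (x ++ .down :: y) := by
          intro x y; rw [smul_smul, mul_comm]
        simp only [e2, e3, e4, mul_smul]
        abel
      rw [wordSum_congr e1]
      simp only [downRest, smul_add, wordSum_add, hg']
      rw [← wordSum_splitSum, ← wordSum_splitSum]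
      abel
    have h2 : ∀ w, weight 0 (.down :: w) • dualVec (.down :: w) =
        X .down (weight 0 w • dualVec w) + (-1 : Kq) • X .up (weight 0 w • downRest w) := by
      intro w
      rw [weight_down, map_smul, map_smul, X_down_dualVec, smul_add, neg_one_smul,
        add_neg_cancel_right]
    simp only [h2, wordSum_add, ← hs, ← hX, dualVec_up, ← map_smul (X .up)] at h1 ⊢
    rw [h1]
    simp only [map_add, map_smul, neg_one_smul, map_neg]
    abel

/-! ### The action on the space of words -/

theorem bar_zpow (z : ℤ) : bar (q ^ z) = q ^ (-z) := by
  rw [map_zpow₀, bar_q, inv_zpow, zpow_neg]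

theorem bar_inv_q : bar q⁻¹ = q := by rw [map_inv₀, bar_q, inv_inv]

theorem bar_qint (z : ℤ) : bar (qint z) = qint z := by
  rw [qint, map_div₀, map_sub, map_sub, bar_zpow, bar_zpow, bar_q, bar_inv_q, neg_neg,
    ← neg_sub, ← neg_sub q q⁻¹]
  exact neg_div_neg_eq _ _

/-- The weight of a word. -/
def wordWeight : List Arrow → ℤ
  | [] => 0
  | .up :: w => wordWeight w + 1
  | .down :: w => wordWeight w - 1

/-- The linear map with given values on words. -/
noncomputable def ofWords (f : List Arrow → WordSpace) : Module.End Kq WordSpace :=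
  Finsupp.linearCombination Kq f

@[simp] theorem ofWords_vec (f : List Arrow → WordSpace) (w : List Arrow) :
    ofWords f (vec w) = f w := by simp [ofWords, vec]

theorem end_ext {M : Type*} [AddCommMonoid M] [Module Kq M] {f g : WordSpace →ₗ[Kq] M}
    (h : ∀ w, f (vec w) = g (vec w)) : f = g :=
  Finsupp.lhom_ext' fun w => LinearMap.ext_ring (h w)

/-- The action of `K ^ e`. -/
noncomputable def wordK (e : ℤ) : Module.End Kq WordSpace :=
  ofWords fun w => q ^ (e * wordWeight w) • vec w

/-- The action of `E` on words. -/
noncomputable def wordEAux : List Arrow → WordSpace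
  | [] => 0
  | .up :: w => X .up (wordEAux w)
  | .down :: w => X .up (wordK (-1) (vec w)) + X .down (wordEAux w)

/-- The action of `E`. -/
noncomputable def wordE : Module.End Kq WordSpace := ofWords wordEAux

/-- The action of `F` on words. -/
noncomputable def wordFAux : List Arrow → WordSpace
  | [] => 0
  | .up :: w => X .down (vec w) + q • X .up (wordFAux w)
  | .down :: w => q⁻¹ • X .down (wordFAux w)

/-- The action of `F`. -/
noncomputable def wordF : Module.End Kq WordSpace := ofWords wordFAux

/-- The action of `Y = F + q⁻¹ K E + K`. -/
noncomputable def wordY : Module.End Kq WordSpace := wordF + q⁻¹ • (wordK 1 * wordE) + wordK 1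

theorem wordK_vec (e : ℤ) (w : List Arrow) : wordK e (vec w) = q ^ (e * wordWeight w) • vec w := by
  simp [wordK]

theorem wordE_nil : wordE (vec []) = 0 := by simp [wordE, wordEAux]

theorem wordF_nil : wordF (vec []) = 0 := by simp [wordF, wordFAux]

theorem wordK_nil (e : ℤ) : wordK e (vec []) = vec [] := by simp [wordK_vec, wordWeight]

theorem wordY_nil : wordY (vec []) = vec [] := by
  simp [wordY, wordE_nil, wordF_nil, wordK_nil]

theorem wordK_X_up (e : ℤ) (x : WordSpace) : wordK e (X .up x) = q ^ e • X .up (wordK e x) := by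
  suffices h : wordK e * X .up = q ^ e • (X .up * wordK e) from LinearMap.congr_fun h x
  refine end_ext fun w => ?_
  simp [wordK_vec, wordWeight, smul_smul, ← zpow_add₀ q_ne_zero]
  ring_nf

theorem wordK_X_down (e : ℤ) (x : WordSpace) :
    wordK e (X .down x) = q ^ (-e) • X .down (wordK e x) := by
  suffices h : wordK e * X .down = q ^ (-e) • (X .down * wordK e) from LinearMap.congr_fun h x
  refine end_ext fun w => ?_
  rw [LinearMap.smul_apply, Module.End.mul_apply, Module.End.mul_apply, X_vec, wordK_vec,
    wordK_vec, map_smul, X_vec, smul_smul, ← zpow_add₀ q_ne_zero, wordWeight]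
  ring_nf

theorem wordE_X_up (x : WordSpace) : wordE (X .up x) = X .up (wordE x) := by
  suffices h : wordE * X .up = X .up * wordE from LinearMap.congr_fun h x
  refine end_ext fun w => ?_
  simp [wordE, wordEAux]

theorem wordE_X_down (x : WordSpace) :
    wordE (X .down x) = X .up (wordK (-1) x) + X .down (wordE x) := by
  suffices h : wordE * X .down = X .up * wordK (-1) + X .down * wordE from LinearMap.congr_fun h x
  refine end_ext fun w => ?_
  simp [wordE, wordEAux]

theorem wordF_X_up (x : WordSpace) : wordF (X .up x) = X .down x + q • X .up (wordF x) := by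
  suffices h : wordF * X .up = X .down + q • (X .up * wordF) from LinearMap.congr_fun h x
  refine end_ext fun w => ?_
  simp [wordF, wordFAux]

theorem wordF_X_down (x : WordSpace) : wordF (X .down x) = q⁻¹ • X .down (wordF x) := by
  suffices h : wordF * X .down = q⁻¹ • (X .down * wordF) from LinearMap.congr_fun h x
  refine end_ext fun w => ?_
  simp [wordF, wordFAux]

/-- Prove a linear or semilinear identity on the space of words by induction on words. -/
theorem word_induction {P : WordSpace → Prop} (hadd : ∀ x y, P x → P y → P (x + y))
    (hsmul : ∀ (a : Kq) x, P x → P (a • x)) (hnil : P (vec []))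
    (hcons : ∀ s x, P x → P (X s x)) (x : WordSpace) : P x := by
  have hvec : ∀ w, P (vec w) := by
    intro w
    induction w with
    | nil => exact hnil
    | cons s w ih => simpa using hcons s _ ih
  induction x using Finsupp.induction_linear with
  | zero => simpa using hsmul 0 _ hnil
  | add x y hx hy => exact hadd _ _ hx hy
  | single w a => simpa [vec] using hsmul a _ (hvec w)

theorem wordK_wordK (e f : ℤ) (x : WordSpace) : wordK e (wordK f x) = wordK (e + f) x := by
  suffices h : wordK e * wordK f = wordK (e + f) from LinearMap.congr_fun h x
  refine end_ext fun w => ?_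
  rw [Module.End.mul_apply, wordK_vec, map_smul, wordK_vec, wordK_vec, smul_smul,
    ← zpow_add₀ q_ne_zero]
  ring_nf

theorem wordK_zero (x : WordSpace) : wordK 0 x = x := by
  suffices h : wordK 0 = 1 from LinearMap.congr_fun h x
  refine end_ext fun w => ?_
  simp [wordK_vec]

theorem wordK_wordE (e : ℤ) (x : WordSpace) :
    wordK e (wordE x) = q ^ (2 * e) • wordE (wordK e x) := by
  induction x using word_induction with
  | hadd x y hx hy => simp only [map_add, hx, hy, smul_add]
  | hsmul a x hx => simp only [map_smul, hx]; rw [smul_comm]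
  | hnil => simp [wordE_nil, wordK_nil]
  | hcons s x hx =>
    cases s
    · rw [wordE_X_up, wordK_X_up, wordK_X_up, hx, map_smul, map_smul, wordE_X_up, smul_comm]
    · rw [wordE_X_down, map_add, wordK_X_up, wordK_X_down, wordK_X_down, hx, map_smul, map_smul,
        wordE_X_down, wordK_wordK, wordK_wordK, add_comm e, smul_smul, smul_smul, smul_add,
        mul_comm (q ^ (2 * e)), ← zpow_add₀ q_ne_zero]
      congr 3
      ring

theorem wordK_wordF (e : ℤ) (x : WordSpace) :
    wordK e (wordF x) = q ^ (-2 * e) • wordF (wordK e x) := by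
  induction x using word_induction with
  | hadd x y hx hy => simp only [map_add, hx, hy, smul_add]
  | hsmul a x hx => simp only [map_smul, hx]; rw [smul_comm]
  | hnil => simp [wordF_nil, wordK_nil]
  | hcons s x hx =>
    cases s
    · rw [wordF_X_up, map_add, map_smul, wordK_X_up, wordK_X_up, wordK_X_down, hx, map_smul,
        map_smul, wordF_X_up]
      simp only [smul_smul, smul_add]
      congr 2
      · rw [← zpow_add₀ q_ne_zero]; ring_nf
      · ring
    · rw [wordF_X_down, map_smul, wordK_X_down, wordK_X_down, hx, map_smul, map_smul,
        wordF_X_down]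
      simp only [smul_smul]
      ring_nf

theorem wordE_wordF (x : WordSpace) :
    (q - q⁻¹) • (wordE (wordF x) - wordF (wordE x)) = wordK 1 x - wordK (-1) x := by
  induction x using word_induction with
  | hadd x y hx hy =>
    simp only [map_add] at *
    rw [add_sub_add_comm, smul_add, hx, hy]; abel
  | hsmul a x hx =>
    simp only [map_smul, ← smul_sub] at *
    rw [smul_comm, hx]
  | hnil => simp [wordE_nil, wordF_nil, wordK_nil]
  | hcons s x hx =>
    have h0 := q_ne_zero
    cases s
    · rw [wordF_X_up, wordE_X_up, wordF_X_up, map_add, map_smul, wordE_X_up, wordE_X_down,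
        wordK_X_up, wordK_X_up]
      have h1 : X .up ((q - q⁻¹) • (wordE (wordF x) - wordF (wordE x))) =
        X .up (wordK 1 x - wordK (-1) x) := by rw [hx]
      simp only [map_smul, map_sub] at h1
      rw [zpow_one, zpow_neg_one]
      have h2 : (q - q⁻¹) • (X .up (wordK (-1) x) + X .down (wordE x) +
          q • X .up (wordE (wordF x)) - (X .down (wordE x) + q • X .up (wordF (wordE x)))) =
        (q - q⁻¹) • X .up (wordK (-1) x) +
        q • ((q - q⁻¹) • (X .up (wordE (wordF x)) - X .up (wordF (wordE x)))) := by
        rw [smul_comm q]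
        simp only [smul_sub, smul_add]
        abel
      rw [h2, h1, sub_smul, smul_sub]
      abel
    · rw [wordF_X_down, wordE_X_down, map_smul, wordE_X_down, map_add, wordF_X_up, wordF_X_down,
        wordK_X_down, wordK_X_down, wordK_wordF]
      have h1 : X .down ((q - q⁻¹) • (wordE (wordF x) - wordF (wordE x))) =
        X .down (wordK 1 x - wordK (-1) x) := by rw [hx]
      simp only [map_smul, map_sub] at h1
      rw [neg_neg, zpow_one, zpow_neg_one, map_smul, smul_add, smul_smul q⁻¹ (q ^ _)]
      have e : q⁻¹ * q ^ (-2 * (-1) : ℤ) = q := by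
        rw [← zpow_neg_one, ← zpow_add₀ h0]; norm_num
      rw [e]
      have h2 : (q - q⁻¹) • (q • X .up (wordF (wordK (-1) x)) +
          q⁻¹ • X .down (wordE (wordF x)) - (X .down (wordK (-1) x) +
            q • X .up (wordF (wordK (-1) x)) + q⁻¹ • X .down (wordF (wordE x)))) =
        q⁻¹ • ((q - q⁻¹) • (X .down (wordE (wordF x)) - X .down (wordF (wordE x)))) -
        (q - q⁻¹) • X .down (wordK (-1) x) := by
        rw [smul_comm q⁻¹]
        simp only [smul_sub, smul_add]
        abel
      rw [h2, h1, sub_smul, smul_sub]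
      abel

theorem wordY_X_up (x : WordSpace) : wordY (X .up x) = X .down x + q • X .up (wordY x) := by
  simp only [wordY, LinearMap.add_apply, LinearMap.smul_apply, Module.End.mul_apply, wordF_X_up,
    wordE_X_up, wordK_X_up, map_add, map_smul, zpow_one, smul_add]
  rw [smul_comm q q⁻¹]
  abel

theorem wordY_X_down (x : WordSpace) : wordY (X .down x) = X .up x + q⁻¹ • X .down (wordY x) := by
  simp only [wordY, LinearMap.add_apply, LinearMap.smul_apply, Module.End.mul_apply, wordF_X_down,
    wordE_X_down, wordK_X_up, wordK_X_down, map_add, map_smul, zpow_one, smul_add, wordK_wordK,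
    zpow_neg_one]
  rw [show (1 : ℤ) + -1 = 0 by norm_num, wordK_zero, smul_smul, inv_mul_cancel₀ q_ne_zero, one_smul]
  abel

/-! ### The bar involutions on the space of words -/

/-- The bar involution of `ℂ(q)` as a ring homomorphism. -/
noncomputable def barHom : Kq →+* Kq := bar

@[simp] theorem barHom_apply (a : Kq) : barHom a = bar a := rfl

/-- The semilinear map with given values on words. -/
noncomputable def ofWordsBar (f : List Arrow → WordSpace) : WordSpace →ₛₗ[barHom] WordSpace where
  toFun x := Finsupp.linearCombination Kq f (x.mapRange bar (map_zero bar))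
  map_add' x y := by rw [Finsupp.mapRange_add (map_add bar), map_add]
  map_smul' a x := by
    have : (a • x).mapRange bar (map_zero bar) = bar a • x.mapRange bar (map_zero bar) := by
      ext w; simp
    rw [this, map_smul]; rfl

@[simp] theorem ofWordsBar_vec (f : List Arrow → WordSpace) (w : List Arrow) :
    ofWordsBar f (vec w) = f w := by
  change Finsupp.linearCombination Kq f ((vec w).mapRange bar (map_zero bar)) = _
  simp [vec]

/-- The bar involution `Θ ∘ (ψ ⊗ ⋯ ⊗ ψ)` of the quantum group on words.  Splitting off the first
factor `V_1` from `Θ` leaves `1 + (q - q⁻¹) E ⊗ F`. -/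
noncomputable def wordPsiAux : List Arrow → WordSpace
  | [] => vec []
  | .up :: w => X .up (wordPsiAux w)
  | .down :: w => X .down (wordPsiAux w) + (q - q⁻¹) • X .up (wordF (wordPsiAux w))

/-- The bar involution `Θ ∘ (ψ ⊗ ⋯ ⊗ ψ)` of the quantum group. -/
noncomputable def wordPsi : WordSpace →ₛₗ[barHom] WordSpace := ofWordsBar wordPsiAux

/-- The bar involution `Υ ∘ Θ ∘ (ψ ⊗ ⋯ ⊗ ψ)` of the coideal subalgebra on words, defined by the
recursion that `wordUpsilon_wordPsi` justifies. -/
noncomputable def wordIotaAux : List Arrow → WordSpace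
  | [] => vec []
  | .up :: w => X .up (wordIotaAux w)
  | .down :: w => X .down (wordIotaAux w) + (q - q⁻¹) • X .up (wordY (wordIotaAux w))

/-- The bar involution `Υ ∘ Θ ∘ (ψ ⊗ ⋯ ⊗ ψ)` of the coideal subalgebra; see `wordUpsilon_wordPsi`.
-/
noncomputable def wordIota : WordSpace →ₛₗ[barHom] WordSpace := ofWordsBar wordIotaAux

theorem wordPsi_nil : wordPsi (vec []) = vec [] := by simp [wordPsi, wordPsiAux]

theorem wordIota_nil : wordIota (vec []) = vec [] := by simp [wordIota, wordIotaAux]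

/-- Semilinear maps agree if they do so on words. -/
theorem semilinear_ext {f g : WordSpace →ₛₗ[barHom] WordSpace} (h : ∀ w, f (vec w) = g (vec w)) :
    f = g := by
  refine LinearMap.ext fun x => ?_
  induction x using Finsupp.induction_linear with
  | zero => simp
  | add x y hx hy => simp [hx, hy]
  | single w a =>
    have : Finsupp.single w a = a • vec w := by simp [vec]
    rw [this, map_smulₛₗ, map_smulₛₗ, h]

theorem wordPsi_X_up (x : WordSpace) : wordPsi (X .up x) = X .up (wordPsi x) := by
  have h : wordPsi.comp (X .up) = (X .up).comp wordPsi :=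
    semilinear_ext fun w => by simp [wordPsi, wordPsiAux]
  exact LinearMap.congr_fun h x

theorem wordPsi_X_down (x : WordSpace) :
    wordPsi (X .down x) = X .down (wordPsi x) + (q - q⁻¹) • X .up (wordF (wordPsi x)) := by
  have h : wordPsi.comp (X .down) =
      (X .down + (q - q⁻¹) • (X .up * wordF)).comp wordPsi :=
    semilinear_ext fun w => by simp [wordPsi, wordPsiAux]
  exact LinearMap.congr_fun h x

theorem wordIota_X_up (x : WordSpace) : wordIota (X .up x) = X .up (wordIota x) := by
  have h : wordIota.comp (X .up) = (X .up).comp wordIota :=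
    semilinear_ext fun w => by simp [wordIota, wordIotaAux]
  exact LinearMap.congr_fun h x

theorem wordIota_X_down (x : WordSpace) :
    wordIota (X .down x) = X .down (wordIota x) + (q - q⁻¹) • X .up (wordY (wordIota x)) := by
  have h : wordIota.comp (X .down) =
      (X .down + (q - q⁻¹) • (X .up * wordY)).comp wordIota :=
    semilinear_ext fun w => by simp [wordIota, wordIotaAux]
  exact LinearMap.congr_fun h x

theorem wordIota_smul (a : Kq) (x : WordSpace) : wordIota (a • x) = bar a • wordIota x :=
  map_smulₛₗ wordIota a x

theorem wordPsi_smul (a : Kq) (x : WordSpace) : wordPsi (a • x) = bar a • wordPsi x :=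
  map_smulₛₗ wordPsi a x

theorem wordIota_wordY (x : WordSpace) : wordIota (wordY x) = wordY (wordIota x) := by
  have h0 := q_ne_zero
  induction x using word_induction with
  | hadd x y hx hy => simp only [map_add, hx, hy]
  | hsmul a x hx => rw [map_smul, wordIota_smul, wordIota_smul, map_smul, hx]
  | hnil => simp [wordY_nil, wordIota_nil]
  | hcons s x hx =>
    cases s
    · rw [wordY_X_up, map_add, wordIota_smul, wordIota_X_up, wordIota_X_up, wordIota_X_down,
        wordY_X_up, hx, bar_q, sub_smul]
      abel
    · rw [wordY_X_down, map_add, wordIota_smul, wordIota_X_up, wordIota_X_down, wordIota_X_down,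
        map_add, map_smul, wordY_X_up, wordY_X_down, hx, bar_inv_q, smul_add, smul_smul, smul_add,
        smul_smul, mul_comm, sub_smul]
      rw [mul_comm (q - q⁻¹) q]
      abel

theorem wordPsi_wordK (e : ℤ) (x : WordSpace) : wordPsi (wordK e x) = wordK (-e) (wordPsi x) := by
  induction x using word_induction with
  | hadd x y hx hy => simp only [map_add, hx, hy]
  | hsmul a x hx => rw [map_smul, wordPsi_smul, wordPsi_smul, map_smul, hx]
  | hnil => simp [wordK_nil, wordPsi_nil]
  | hcons s x hx =>
    cases s
    · rw [wordK_X_up, wordPsi_smul, bar_zpow, wordPsi_X_up, wordPsi_X_up, wordK_X_up, hx]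
    · rw [wordK_X_down, wordPsi_smul, bar_zpow, wordPsi_X_down, wordPsi_X_down, map_add, map_smul,
        wordK_X_up, wordK_X_down, wordK_wordF, hx, map_smul, smul_add, smul_smul, smul_smul,
        smul_smul]
      congr 2
      rw [mul_assoc, ← zpow_add₀ q_ne_zero]
      ring_nf

theorem wordPsi_wordF (x : WordSpace) : wordPsi (wordF x) = wordF (wordPsi x) := by
  have h0 := q_ne_zero
  induction x using word_induction with
  | hadd x y hx hy => simp only [map_add, hx, hy]
  | hsmul a x hx => rw [map_smul, wordPsi_smul, wordPsi_smul, map_smul, hx]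
  | hnil => simp [wordF_nil, wordPsi_nil]
  | hcons s x hx =>
    cases s
    · rw [wordF_X_up, map_add, wordPsi_smul, wordPsi_X_up, wordPsi_X_up, wordPsi_X_down,
        wordF_X_up, hx, bar_q, sub_smul]
      abel
    · rw [wordF_X_down, wordPsi_smul, wordPsi_X_down, wordPsi_X_down, map_add, map_smul,
        wordF_X_up, wordF_X_down, hx, bar_inv_q, smul_add, smul_smul, smul_add,
        smul_smul, mul_comm, sub_smul]
      rw [mul_comm (q - q⁻¹) q]
      abel

theorem wordPsi_wordE (x : WordSpace) : wordPsi (wordE x) = wordE (wordPsi x) := by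
  induction x using word_induction with
  | hadd x y hx hy => simp only [map_add, hx, hy]
  | hsmul a x hx => rw [map_smul, wordPsi_smul, wordPsi_smul, map_smul, hx]
  | hnil => simp [wordE_nil, wordPsi_nil]
  | hcons s x hx =>
    cases s
    · rw [wordE_X_up, wordPsi_X_up, wordPsi_X_up, wordE_X_up, hx]
    · have h := congrArg (X .up) (wordE_wordF (wordPsi x))
      rw [map_smul, map_sub, map_sub, smul_sub, sub_eq_sub_iff_add_eq_add] at h
      rw [wordE_X_down, map_add, wordPsi_X_up, wordPsi_X_down, wordPsi_X_down, map_add, map_smul,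
        wordE_X_up, wordE_X_down, hx, wordPsi_wordK, neg_neg]
      have h' := congrArg (X .down (wordE (wordPsi x)) + ·) h
      rw [add_left_comm, ← h']
      abel

/-! ### The intertwiner -/

/-- The intertwiner `Υ`, truncated after `R` terms. -/
noncomputable def wordUpsilon (R : ℕ) : Module.End Kq WordSpace :=
  ∑ r ∈ Finset.range R, (bar (upsilonCoeff r) / qfact r) • wordE ^ r

/-- The span of the words of length `N`. -/
noncomputable def degree (N : ℕ) : Submodule Kq WordSpace :=
  Submodule.span Kq (vec '' {w | w.length = N})

theorem vec_mem_degree (w : List Arrow) : vec w ∈ degree w.length :=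
  Submodule.subset_span ⟨w, rfl, rfl⟩

theorem X_mem_degree {N : ℕ} {x : WordSpace} (s : Arrow) (h : x ∈ degree N) :
    X s x ∈ degree (N + 1) := by
  have : degree N ≤ (degree (N + 1)).comap (X s) := by
    refine Submodule.span_le.2 ?_
    rintro _ ⟨w, rfl, rfl⟩
    have := vec_mem_degree (s :: w)
    simpa using this
  exact this h

theorem degree_induction {N : ℕ} {P : WordSpace → Prop} (hadd : ∀ x y, P x → P y → P (x + y))
    (hsmul : ∀ (a : Kq) x, P x → P (a • x)) (h0 : P 0)
    (hvec : ∀ w, w.length = N → P (vec w)) {x : WordSpace} (hx : x ∈ degree N) : P x := by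
  refine Submodule.span_induction (p := fun x _ => P x) ?_ h0 (fun x y _ _ => hadd x y)
    (fun a x _ => hsmul a x) hx
  rintro _ ⟨w, hw, rfl⟩
  exact hvec w hw

theorem mem_degree_of_vec (f : Module.End Kq WordSpace)
    (h : ∀ w, f (vec w) ∈ degree w.length) {N : ℕ} {x : WordSpace} (hx : x ∈ degree N) :
    f x ∈ degree N := by
  refine degree_induction (P := fun x => f x ∈ degree N) ?_ ?_ ?_ ?_ hx
  · intro x y hx hy; rw [map_add]; exact add_mem hx hy
  · intro a x hx; rw [map_smul]; exact Submodule.smul_mem _ _ hx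
  · simp
  · rintro w rfl; exact h w

theorem wordK_mem_degree {N : ℕ} {x : WordSpace} (e : ℤ) (h : x ∈ degree N) :
    wordK e x ∈ degree N :=
  mem_degree_of_vec _ (fun w => by
    rw [wordK_vec]; exact Submodule.smul_mem _ _ (vec_mem_degree w)) h

theorem wordE_mem_degree {N : ℕ} {x : WordSpace} (h : x ∈ degree N) : wordE x ∈ degree N := by
  refine mem_degree_of_vec _ (fun w => ?_) h
  induction w with
  | nil => simp [wordE_nil]
  | cons s w ih =>
    rw [← X_vec]
    cases s
    · rw [wordE_X_up]; exact X_mem_degree _ ih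
    · rw [wordE_X_down]
      exact add_mem (X_mem_degree _ (wordK_mem_degree _ (vec_mem_degree w))) (X_mem_degree _ ih)

theorem wordF_mem_degree {N : ℕ} {x : WordSpace} (h : x ∈ degree N) : wordF x ∈ degree N := by
  refine mem_degree_of_vec _ (fun w => ?_) h
  induction w with
  | nil => simp [wordF_nil]
  | cons s w ih =>
    rw [← X_vec]
    cases s
    · rw [wordF_X_up]
      exact add_mem (X_mem_degree _ (vec_mem_degree w)) (Submodule.smul_mem _ _ (X_mem_degree _ ih))
    · rw [wordF_X_down]; exact Submodule.smul_mem _ _ (X_mem_degree _ ih)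

theorem wordY_mem_degree {N : ℕ} {x : WordSpace} (h : x ∈ degree N) : wordY x ∈ degree N :=
  add_mem (add_mem (wordF_mem_degree h) (Submodule.smul_mem _ _
    (wordK_mem_degree _ (wordE_mem_degree h)))) (wordK_mem_degree _ h)

theorem wordPsi_mem_degree {N : ℕ} {x : WordSpace} (h : x ∈ degree N) : wordPsi x ∈ degree N := by
  refine degree_induction (P := fun x => wordPsi x ∈ degree N) ?_ ?_ ?_ ?_ h
  · intro x y hx hy; rw [map_add]; exact add_mem hx hy
  · intro a x hx; rw [wordPsi_smul]; exact Submodule.smul_mem _ _ hx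
  · simp
  · rintro w rfl
    clear h
    induction w with
    | nil => rw [wordPsi_nil]; exact vec_mem_degree []
    | cons s w ih =>
      have := ih
      rw [← X_vec]
      cases s
      · rw [wordPsi_X_up]; exact X_mem_degree _ this
      · rw [wordPsi_X_down]
        exact add_mem (X_mem_degree _ this)
          (Submodule.smul_mem _ _ (X_mem_degree _ (wordF_mem_degree this)))

theorem wordK_pow_wordE (r : ℕ) (x : WordSpace) :
    wordK (-1) ((wordE ^ r) x) = q ^ (-2 * r : ℤ) • (wordE ^ r) (wordK (-1) x) := by
  induction r generalizing x with
  | zero => simp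
  | succ r ih =>
    rw [pow_succ, Module.End.mul_apply, ih, wordK_wordE, map_smul, smul_smul,
      ← zpow_add₀ q_ne_zero, Module.End.mul_apply]
    congr 2
    push_cast
    ring

theorem pow_wordE_X_up (r : ℕ) (x : WordSpace) :
    (wordE ^ r) (X .up x) = X .up ((wordE ^ r) x) := by
  induction r generalizing x with
  | zero => simp
  | succ r ih => rw [pow_succ, Module.End.mul_apply, wordE_X_up, ih, Module.End.mul_apply]

theorem pow_wordE_X_down (r : ℕ) (x : WordSpace) :
    (wordE ^ (r + 1)) (X .down x) = X .down ((wordE ^ (r + 1)) x) +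
      (q ^ (-r : ℤ) * qint (r + 1)) • X .up ((wordE ^ r) (wordK (-1) x)) := by
  induction r with
  | zero => simp [wordE_X_down, add_comm]
  | succ r ih =>
    rw [pow_succ' _ (r + 1), Module.End.mul_apply, ih, map_add, map_smul, wordE_X_down, wordE_X_up,
      wordK_pow_wordE, map_smul, ← Module.End.mul_apply wordE (wordE ^ (r + 1)), ← pow_succ',
      ← Module.End.mul_apply wordE (wordE ^ r), ← pow_succ', add_right_comm, ← add_smul, add_comm]
    congr 2
    have := qint_add' (r + 1) 1
    push_cast
    rw [show (r : ℤ) + 1 + 1 = r + 1 + 1 from rfl, this, qint_one, zpow_one,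
      show (-2 * ((r : ℤ) + 1)) = -(r + 1) + -(r + 1) by ring, zpow_add₀ q_ne_zero,
      show (-(r : ℤ)) = -(r + 1) + 1 by ring, zpow_add₀ q_ne_zero, zpow_one]
    ring

theorem pow_wordE_eq_zero {N r : ℕ} (h : N < r) {x : WordSpace} (hx : x ∈ degree N) :
    (wordE ^ r) x = 0 := by
  refine degree_induction (P := fun x => (wordE ^ r) x = 0) ?_ ?_ ?_ ?_ hx
  · intro x y hx hy; rw [map_add, hx, hy, add_zero]
  · intro a x hx; rw [map_smul, hx, smul_zero]
  · simp
  · intro w hw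
    clear hx
    induction w generalizing N r with
    | nil =>
      obtain ⟨r, rfl⟩ : ∃ k, r = k + 1 := ⟨r - 1, by omega⟩
      rw [pow_succ, Module.End.mul_apply, wordE_nil, map_zero]
    | cons s w ih =>
      rw [List.length_cons] at hw
      obtain ⟨r, rfl⟩ : ∃ k, r = k + 1 := ⟨r - 1, by omega⟩
      rw [← X_vec]
      cases s
      · rw [pow_wordE_X_up, ih (N := w.length) (by omega) rfl, map_zero]
      · rw [pow_wordE_X_down, ih (N := w.length) (by omega) rfl, wordK_vec, map_smul,
          ih (N := w.length) (by omega) rfl]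
        simp

theorem qfact_succ (r : ℕ) : qfact (r + 1) = qfact r * qint (r + 1) := by
  rw [qfact, qfact, Finset.prod_Icc_succ_top (by omega)]
  push_cast
  rfl

theorem qfact_ne_zero (r : ℕ) : qfact r ≠ 0 :=
  Finset.prod_ne_zero_iff.2 fun i hi => qint_pos_ne_zero (by
    have := (Finset.mem_Icc.1 hi).1; positivity)

theorem bar_upsilonCoeff_one : bar (upsilonCoeff 1) = q - q⁻¹ := by
  rw [upsilonCoeff, map_neg, map_sub, bar_q, bar_inv_q, neg_sub]

theorem bar_upsilonCoeff_succ_succ (r : ℕ) : bar (upsilonCoeff (r + 2)) =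
    q ^ (r + 1) * (q - q⁻¹) * (q⁻¹ * qint (r + 1) * bar (upsilonCoeff r) +
      bar (upsilonCoeff (r + 1))) := by
  rw [upsilonCoeff, map_mul, map_mul, map_neg, map_pow, map_sub, map_add, map_mul, map_mul, bar_q,
    bar_inv_q, bar_qint]
  ring

theorem wordUpsilon_succ_apply {N R : ℕ} (h : N < R) {x : WordSpace} (hx : x ∈ degree N) :
    wordUpsilon (R + 1) x = wordUpsilon R x := by
  rw [wordUpsilon, Finset.sum_range_succ, LinearMap.add_apply, LinearMap.smul_apply,
    pow_wordE_eq_zero h hx, smul_zero, add_zero, wordUpsilon]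

theorem wordUpsilon_X_up (R : ℕ) (x : WordSpace) :
    wordUpsilon R (X .up x) = X .up (wordUpsilon R x) := by
  simp [wordUpsilon, LinearMap.sum_apply, pow_wordE_X_up]

/-- The recursion for the coefficients of `Υ`, in the form in which it is used.  The truncation is
harmless because high powers of `E` vanish. -/
theorem wordUpsilon_X_down {N R : ℕ} (h : N < R) {x : WordSpace} (hx : x ∈ degree N) :
    wordUpsilon (R + 1) (X .down x) = X .down (wordUpsilon R x) +
      (q - q⁻¹) • X .up (wordUpsilon R (q⁻¹ • wordE (wordK (-1) x) + wordK (-1) x)) := by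
  have h0 := q_ne_zero
  set y := wordK (-1) x with hy
  have hyd : y ∈ degree N := wordK_mem_degree _ hx
  clear_value y
  -- the terms in which a factor `E` hits the new arrow
  have key : ∀ R, ∑ r ∈ Finset.range R, (bar (upsilonCoeff (r + 1)) / qfact (r + 1) *
      (q ^ (-r : ℤ) * qint (r + 1))) • (wordE ^ r) y =
      (q - q⁻¹) • (∑ r ∈ Finset.range R, (bar (upsilonCoeff r) / qfact r) • (wordE ^ r) y +
        ∑ r ∈ Finset.range (R - 1), (q⁻¹ * (bar (upsilonCoeff r) / qfact r)) •
          (wordE ^ (r + 1)) y) := by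
    intro R
    induction R with
    | zero => simp
    | succ R ih =>
      have hR : ((R : ℤ) + 1) ≠ 0 := by positivity
      have h1 := qint_ne_zero hR
      have h2 := qfact_ne_zero R
      rw [Finset.sum_range_succ, ih, Finset.sum_range_succ _ R]
      obtain _ | R := R
      · rw [bar_upsilonCoeff_one]; simp [qfact, upsilonCoeff]
      · rw [Nat.add_sub_cancel, Nat.add_sub_cancel, Finset.sum_range_succ
          (fun r => (q⁻¹ * (bar (upsilonCoeff r) / qfact r)) • (wordE ^ (r + 1)) y) R]
        have h3 := qfact_ne_zero R
        have h4 : qint ((R : ℤ) + 1) ≠ 0 := qint_ne_zero (by positivity)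
        rw [bar_upsilonCoeff_succ_succ, qfact_succ (R + 1), qfact_succ R]
        push_cast at h1 ⊢
        have e : q ^ (-((R : ℤ) + 1)) * q ^ (R + 1) = 1 := by
          rw [← zpow_natCast, ← zpow_add₀ h0]; push_cast; rw [neg_add_cancel, zpow_zero]
        have e2 : q ^ (R + 1) * (q - q⁻¹) * (q⁻¹ * qint (↑R + 1) * bar (upsilonCoeff R) +
            bar (upsilonCoeff (R + 1))) / (qfact R * qint (↑R + 1) * qint (↑R + 1 + 1)) *
              (q ^ (-((R : ℤ) + 1)) * qint (↑R + 1 + 1)) =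
            (q - q⁻¹) * (bar (upsilonCoeff (R + 1)) / (qfact R * qint (↑R + 1)) +
              q⁻¹ * (bar (upsilonCoeff R) / qfact R)) * (q ^ (-((R : ℤ) + 1)) * q ^ (R + 1)) := by
          field_simp
          ring
        rw [e2, e, mul_one, mul_smul, ← smul_add, add_smul]
        congr 1
        abel
  rw [wordUpsilon, LinearMap.sum_apply, Finset.sum_range_succ']
  simp only [LinearMap.smul_apply, pow_wordE_X_down, smul_add, Finset.sum_add_distrib, smul_smul,
    ← hy]
  clear hy
  rw [add_right_comm]
  congr 1
  · have := wordUpsilon_succ_apply h hx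
    rw [← this, wordUpsilon, LinearMap.sum_apply, map_sum, Finset.sum_range_succ']
    simp
  · have e1 := congrArg (X .up) (key R)
    rw [map_sum] at e1
    simp only [map_smul] at e1
    rw [e1, map_add (wordUpsilon R), map_smul (wordUpsilon R)]
    congr 2
    rw [add_comm]
    obtain ⟨R, rfl⟩ : ∃ k, R = k + 1 := ⟨R - 1, by omega⟩
    congr 2
    · rw [wordUpsilon, LinearMap.sum_apply, Finset.sum_range_succ, Nat.add_sub_cancel,
        LinearMap.smul_apply, ← Module.End.mul_apply (wordE ^ R), ← pow_succ, pow_wordE_eq_zero h hyd,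
        smul_zero, add_zero, Finset.smul_sum]
      refine Finset.sum_congr rfl fun r _ => ?_
      rw [LinearMap.smul_apply, ← Module.End.mul_apply (wordE ^ r), ← pow_succ, smul_smul]
    · rw [wordUpsilon, LinearMap.sum_apply]; rfl

/-- The recursive definition of `wordIota` gives `Υ ∘ Θ ∘ (ψ ⊗ ⋯ ⊗ ψ)`. -/
theorem wordUpsilon_wordPsi {N R : ℕ} (h : N < R) {x : WordSpace} (hx : x ∈ degree N) :
    wordUpsilon R (wordPsi x) = wordIota x := by
  induction N generalizing R x with
  | zero =>
    refine degree_induction (P := fun x => wordUpsilon R (wordPsi x) = wordIota x) ?_ ?_ ?_ ?_ hx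
    · intro x y hx hy; simp only [map_add, hx, hy]
    · intro a x hx; rw [wordPsi_smul, wordIota_smul, map_smul, hx]
    · simp
    · intro w hw
      obtain rfl := List.length_eq_zero_iff.1 hw
      obtain ⟨R, rfl⟩ : ∃ k, R = k + 1 := ⟨R - 1, by omega⟩
      rw [wordPsi_nil, wordIota_nil, wordUpsilon, LinearMap.sum_apply, Finset.sum_range_succ',
        Finset.sum_eq_zero fun r _ => by
          rw [LinearMap.smul_apply, pow_wordE_eq_zero (N := 0) (by omega) (vec_mem_degree []),
            smul_zero]]
      simp [upsilonCoeff, qfact]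
  | succ N ih =>
    refine degree_induction (P := fun x => wordUpsilon R (wordPsi x) = wordIota x) ?_ ?_ ?_ ?_ hx
    · intro x y hx hy; simp only [map_add, hx, hy]
    · intro a x hx; rw [wordPsi_smul, wordIota_smul, map_smul, hx]
    · simp
    · intro w hw
      obtain _ | ⟨s, w⟩ := w
      · simp at hw
      have hN : vec w ∈ degree N := by
        have := vec_mem_degree w
        rwa [show w.length = N by simpa using hw] at this
      obtain ⟨R, rfl⟩ : ∃ k, R = k + 1 := ⟨R - 1, by omega⟩
      rw [← X_vec]
      cases s
      · rw [wordPsi_X_up, wordUpsilon_X_up, ih (by omega) hN, wordIota_X_up]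
      · have hP := wordPsi_mem_degree hN
        have e : q⁻¹ * q ^ (2 * (1 : ℤ)) = q := by
          rw [← zpow_neg_one, ← zpow_add₀ q_ne_zero]; norm_num
        -- the terms `q⁻¹ E K⁻¹` and `K⁻¹` from `Υ` and `F` from `Θ` add up to the conjugate of `Y`
        have hY : q⁻¹ • wordE (wordK (-1) (wordPsi (vec w))) + wordK (-1) (wordPsi (vec w)) +
            wordF (wordPsi (vec w)) = wordPsi (wordY (vec w)) := by
          rw [wordY]
          simp only [LinearMap.add_apply, LinearMap.smul_apply, Module.End.mul_apply, map_add,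
            wordPsi_smul, wordPsi_wordF, wordPsi_wordK, wordPsi_wordE, wordK_wordE,
            smul_smul, e, bar_q]
          abel
        rw [wordPsi_X_down, map_add, map_smul, wordUpsilon_X_down (by omega) hP, wordUpsilon_X_up,
          wordUpsilon_succ_apply (by omega) (wordF_mem_degree hP), add_assoc, ← smul_add, ← map_add,
          ← map_add, hY, ih (by omega) hN, ih (by omega) (wordY_mem_degree hN), wordIota_wordY,
          wordIota_X_down]

/-! ### Invariance of the dual canonical basis -/

theorem forestOp_node_apply (a b : Forest) (x : WordSpace) : forestOp (.node a b) x =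
    X .down (forestOp a (X .up (forestOp b x))) -
      q⁻¹ • X .up (forestOp a (X .down (forestOp b x))) := rfl

/-- The vector of an arc spans the trivial submodule of `V_1 ⊗ V_1`, so `Y` passes it by. -/
theorem wordY_forestOp (u : Forest) (x : WordSpace) :
    wordY (forestOp u x) = forestOp u (wordY x) := by
  induction u generalizing x with
  | nil => rfl
  | node a b iha ihb =>
    rw [forestOp_node_apply, forestOp_node_apply, map_sub, map_smul, wordY_X_up, wordY_X_down, iha,
      iha, wordY_X_up, wordY_X_down, ihb]
    simp only [map_add, map_smul, smul_add, smul_smul, inv_mul_cancel₀ q_ne_zero, one_smul,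
      mul_inv_cancel₀ q_ne_zero]
    abel

theorem wordIota_forestOp (u : Forest) (x : WordSpace) :
    wordIota (forestOp u x) = forestOp u (wordIota x) := by
  induction u generalizing x with
  | nil => rfl
  | node a b iha ihb =>
    rw [forestOp_node_apply, forestOp_node_apply, map_sub, wordIota_smul, wordIota_X_up,
      wordIota_X_down, iha, iha, wordIota_X_up, wordIota_X_down, ihb, wordY_forestOp, wordY_X_up,
      bar_inv_q]
    simp only [map_add, map_smul, smul_add, smul_smul]
    rw [mul_comm (q - q⁻¹) q, sub_smul]
    abel

/-- The vectors of a star and of a dashed arc are such that `Y` kills every core without unpaired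
down arrow. -/
theorem wordY_coreVec (c : List Forest) (h : Odd c.length) : wordY (coreVec c) = 0 := by
  induction c using List.twoStepInduction with
  | nil => simp at h
  | singleton u =>
    rw [coreVec, map_sub, map_smul, wordY_X_up, wordY_X_down, wordY_forestOp, wordY_nil, smul_add,
      smul_smul, inv_mul_cancel₀ q_ne_zero, one_smul]
    abel
  | cons_cons u v c ih _ =>
    have h' : Odd c.length := by simpa [Nat.odd_add_one, Nat.not_odd_iff_even] using h
    rw [coreVec_of_odd _ _ _ h', map_sub, map_smul, wordY_X_up, wordY_X_down, wordY_forestOp,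
      wordY_forestOp, wordY_X_up, wordY_X_down, wordY_forestOp, ih h']
    simp only [map_zero, smul_zero, add_zero, smul_add, smul_smul, inv_mul_cancel₀ q_ne_zero,
      one_smul]
    abel

theorem wordIota_coreVec (c : List Forest) : wordIota (coreVec c) = coreVec c := by
  have hdown : ∀ x, wordIota x = x → wordY x = 0 → wordIota (X .down x) = X .down x := by
    intro x h1 h2
    rw [wordIota_X_down, h1, h2, map_zero, smul_zero, add_zero]
  -- the elements attached to cores of odd length are killed by `Y`, which makes the next step work
  induction c using List.twoStepInduction with
  | nil => exact wordIota_nil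
  | singleton u =>
    rw [coreVec, map_sub, wordIota_smul, wordIota_X_down, wordIota_X_up, wordIota_forestOp,
      wordIota_nil, wordY_forestOp, wordY_nil, bar_inv_q, sub_smul]
    abel
  | cons_cons u v c ih ih' =>
    by_cases h : Odd c.length
    · have hv1 : wordIota (forestOp v (coreVec c)) = forestOp v (coreVec c) := by
        rw [wordIota_forestOp, ih]
      have hv2 : wordY (forestOp v (coreVec c)) = 0 := by
        rw [wordY_forestOp, wordY_coreVec c h, map_zero]
      rw [coreVec_of_odd _ _ _ h, map_sub, wordIota_smul, wordIota_X_up, wordIota_X_down,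
        wordIota_forestOp, wordIota_forestOp, hdown _ hv1 hv2, wordIota_X_up, hv1, wordY_forestOp,
        wordY_X_down, hv2, bar_inv_q, map_zero, smul_zero, add_zero, sub_smul]
      abel
    · have h' : Odd (v :: c).length := by
        rw [List.length_cons, Nat.odd_add_one]; exact h
      rw [coreVec_of_even _ _ h']
      refine hdown _ ?_ ?_
      · rw [wordIota_forestOp, ih' v]
      · rw [wordY_forestOp, wordY_coreVec _ h', map_zero]

/-- The bar invariance of the dual canonical basis elements. -/
theorem wordIota_dualVec (w : List Arrow) : wordIota (dualVec w) = dualVec w := by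
  have h : ∀ u c U, wordIota (shapeVec u c U) = shapeVec u c U := by
    intro u c U
    induction U with
    | nil => rw [shapeVec, wordIota_forestOp, wordIota_coreVec]
    | cons v U ih => rw [shapeVec, wordIota_forestOp, wordIota_X_up, ih]
  exact h _ _ _

/-! ### Eigenvectors -/

theorem wordY_up_eigen {l : ℤ} {y : WordSpace} (h : wordY y = qint l • y) :
    wordY (X .down y + q ^ l • X .up y) = qint (l + 1) • (X .down y + q ^ l • X .up y) := by
  have h0 := q_ne_zero
  have h1 : qint (l + 1) = q ^ l + q⁻¹ * qint l := by
    rw [qint_add, qint_one, zpow_neg_one, mul_one]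
  have h2 : qint (l + 1) * q ^ l = 1 + q ^ l * (q * qint l) := by
    rw [qint_add', qint_one, zpow_one, mul_one, zpow_neg]
    field_simp
  rw [map_add, map_smul, wordY_X_up, wordY_X_down, h]
  simp only [map_smul, smul_add, smul_smul]
  rw [h2, h1, add_smul, add_smul, one_smul]
  abel

theorem wordY_down_eigen {l : ℤ} {y : WordSpace} (h : wordY y = qint l • y) :
    wordY (X .down y - q ^ (-l) • X .up y) =
      qint (l - 1) • (X .down y - q ^ (-l) • X .up y) := by
  have h0 := q_ne_zero
  have h1 : qint (l - 1) = q⁻¹ * qint l - q ^ (-l) := by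
    rw [sub_eq_add_neg, qint_add', qint_neg, qint_one, zpow_neg_one]
    ring
  have h2 : qint (l - 1) * q ^ (-l) = q ^ (-l) * (q * qint l) - 1 := by
    rw [sub_eq_add_neg, qint_add, qint_neg, qint_one, neg_neg, zpow_one, zpow_neg]
    field_simp
    ring
  rw [map_sub, map_smul, wordY_X_up, wordY_X_down, h]
  simp only [map_smul, smul_add, smul_sub, smul_smul]
  rw [h2, h1, sub_smul, sub_smul, one_smul]
  abel

theorem wordY_eigenVec (N : ℕ) : wordY (eigenVec N) = qint (N + 1) • eigenVec N := by
  induction N with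
  | zero => simp [eigenVec, wordY_nil]
  | succ N ih =>
    have := wordY_up_eigen ih
    rw [eigenVec]
    push_cast at *
    exact_mod_cast this

/-- The sum of the line through `eigenVec N` and of the eigenspaces of `Y` for `[l]`, `l ≤ N`. -/
noncomputable def eigenSum (N : ℕ) : Submodule Kq WordSpace :=
  Submodule.span Kq {eigenVec N} ⊔
    ⨆ l : ℤ, ⨆ _ : l < N + 1, Module.End.eigenspace wordY (qint l)

/-- The determinant of the two combinations is `q^l + q^{-l}`, up to sign, and does not vanish. -/
theorem X_mem_of_two {S : Submodule Kq WordSpace} {l : ℤ} {y : WordSpace}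
    (h1 : X .down y + q ^ l • X .up y ∈ S) (h2 : X .down y - q ^ (-l) • X .up y ∈ S) (s : Arrow) :
    X s y ∈ S := by
  have hc := q_zpow_add_zpow_neg_ne_zero l
  have hup : X .up y ∈ S := by
    have h3 := S.smul_mem (q ^ l + q ^ (-l))⁻¹ (S.sub_mem h1 h2)
    rwa [add_sub_sub_cancel, ← add_smul, smul_smul, inv_mul_cancel₀ hc, one_smul] at h3
  cases s
  · exact hup
  · simpa using S.sub_mem h1 (S.smul_mem (q ^ l) hup)

/-- The words of length `N` are spanned by eigenvectors of `Y`, of which only the multiples of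
`eigenVec N` belong to the eigenvalue `[N + 1]`. -/
theorem degree_le_eigenSum (N : ℕ) : degree N ≤ eigenSum N := by
  have hX : ∀ N s, eigenSum N ≤ (eigenSum (N + 1)).comap (X s) := by
    intro N s
    have hmem : ∀ {l : ℤ} {x : WordSpace}, l < (N + 1 : ℕ) + 1 → wordY x = qint l • x →
        x ∈ eigenSum (N + 1) := fun {l x} hl hx =>
      Submodule.mem_sup_right (Submodule.mem_iSup_of_mem l (Submodule.mem_iSup_of_mem hl
        (Module.End.mem_eigenspace_iff.2 hx)))
    refine sup_le (Submodule.span_le.2 ?_) (iSup₂_le fun l hl x hx => ?_)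
    · rintro _ rfl
      have h := wordY_eigenVec N
      refine X_mem_of_two (l := N + 1) ?_ (hmem ?_ (wordY_down_eigen h)) s
      · refine Submodule.mem_sup_left (Submodule.mem_span_singleton.2 ⟨1, ?_⟩)
        rw [one_smul, eigenVec]
        norm_cast
      · push_cast; omega
    · have h := Module.End.mem_eigenspace_iff.1 hx
      refine X_mem_of_two (l := l) (hmem ?_ (wordY_up_eigen h)) (hmem ?_ (wordY_down_eigen h)) s
      · push_cast; omega
      · push_cast; omega
  refine Submodule.span_le.2 ?_
  rintro _ ⟨w, rfl, rfl⟩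
  induction w with
  | nil => exact Submodule.mem_sup_left (Submodule.mem_span_singleton_self _)
  | cons s w ih =>
    rw [← X_vec]
    exact hX _ s ih

/-! ### Leading terms of the dual canonical basis -/

/-- The additive group `q⁻¹ ℤ[q⁻¹]`. -/
noncomputable def smallCoeff : AddSubgroup Kq :=
  ((AddMonoidHom.mulLeft q⁻¹).comp
    (Polynomial.aeval (R := ℤ) (q⁻¹ : Kq)).toRingHom.toAddMonoidHom).range

theorem mem_smallCoeff {a : Kq} :
    a ∈ smallCoeff ↔ ∃ f : Polynomial ℤ, a = q⁻¹ * Polynomial.aeval (q⁻¹ : Kq) f :=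
  ⟨fun ⟨f, hf⟩ => ⟨f, hf.symm⟩, fun ⟨f, hf⟩ => ⟨f, hf.symm⟩⟩

theorem inv_q_mem_smallCoeff : q⁻¹ ∈ smallCoeff := mem_smallCoeff.2 ⟨1, by simp⟩

theorem inv_q_mul_mem_smallCoeff {a : Kq} (h : a ∈ smallCoeff) : q⁻¹ * a ∈ smallCoeff := by
  obtain ⟨f, rfl⟩ := mem_smallCoeff.1 h
  exact mem_smallCoeff.2 ⟨Polynomial.X * f, by simp⟩

theorem inv_q_pow_mul_mem_smallCoeff {a : Kq} (h : a ∈ smallCoeff) (k : ℕ) :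
    (q⁻¹) ^ k * a ∈ smallCoeff := by
  induction k with
  | zero => simpa
  | succ k ih => rw [pow_succ', mul_assoc]; exact inv_q_mul_mem_smallCoeff ih

theorem inv_q_pow_mem_smallCoeff {k : ℕ} (h : k ≠ 0) : (q⁻¹) ^ k ∈ smallCoeff := by
  obtain ⟨k, rfl⟩ := Nat.exists_eq_succ_of_ne_zero h
  rw [Nat.succ_eq_add_one, pow_succ]
  exact inv_q_pow_mul_mem_smallCoeff inv_q_mem_smallCoeff k

/-- A bar invariant element of `q⁻¹ ℤ[q⁻¹]` vanishes. -/
theorem eq_zero_of_mem_smallCoeff {a : Kq} (h : a ∈ smallCoeff) (hb : bar a = a) : a = 0 := by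
  have h0 := q_ne_zero
  obtain ⟨f, rfl⟩ := mem_smallCoeff.1 h
  set g : Polynomial ℂ := f.map (Int.castRingHom ℂ) with hg
  have e : ∀ x : Kq, Polynomial.aeval x f = Polynomial.aeval x g := fun x => by
    rw [hg]
    exact (Polynomial.aeval_map_algebraMap (A := ℂ) x f).symm
  rw [e] at hb ⊢
  rw [map_mul, bar_inv_q, ← Polynomial.aeval_algHom_apply, bar_inv_q] at hb
  by_contra hne
  have hg0 : g ≠ 0 := by rintro h; simp [h] at hne
  -- `g` and its reverse would differ by a power of the indeterminate
  have h1 : Polynomial.aeval (q⁻¹ : Kq) g.reverse * q ^ g.natDegree = Polynomial.aeval q g := by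
    let _ := invertibleOfNonzero h0
    have := Polynomial.eval₂_reverse_mul_pow (algebraMap ℂ Kq) q g
    rwa [invOf_eq_inv] at this
  have h2 : g.reverse = Polynomial.X ^ (g.natDegree + 2) * g := by
    apply aeval_q_inv_injective
    rw [map_mul, map_pow, Polynomial.aeval_X, ← mul_left_inj' (pow_ne_zero (g.natDegree + 1) h0),
      pow_succ, ← mul_assoc, h1, mul_comm, hb, inv_pow, pow_add]
    field_simp
  have h3 := congrArg Polynomial.natDegree h2
  have h4 := Polynomial.reverse_natDegree_le g
  rw [Polynomial.natDegree_mul (pow_ne_zero _ Polynomial.X_ne_zero) hg0,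
    Polynomial.natDegree_X_pow] at h3
  omega

/-- The sum of the positions, counted from the right, of the down arrows of a word. -/
def depth : List Arrow → ℕ
  | [] => 0
  | .up :: w => depth w
  | .down :: w => depth w + (w.length + 1)

/-- The combinations with coefficients in `q⁻¹ ℤ[q⁻¹]` of words of the length of `w` and of smaller
depth. -/
noncomputable def lowerTerms (w : List Arrow) : AddSubgroup WordSpace :=
  AddSubgroup.closure {x | ∃ a ∈ smallCoeff, ∃ v : List Arrow, v.length = w.length ∧
    depth v < depth w ∧ x = a • vec v}

theorem smul_vec_mem_lowerTerms {a : Kq} {v w : List Arrow} (ha : a ∈ smallCoeff)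
    (hl : v.length = w.length) (hd : depth v < depth w) : a • vec v ∈ lowerTerms w :=
  AddSubgroup.subset_closure ⟨a, ha, v, hl, hd, rfl⟩

theorem X_mem_lowerTerms {w : List Arrow} {x : WordSpace} (s : Arrow) (h : x ∈ lowerTerms w) :
    X s x ∈ lowerTerms (s :: w) := by
  induction h using AddSubgroup.closure_induction with
  | mem x hx =>
    obtain ⟨a, ha, v, hl, hd, rfl⟩ := hx
    rw [map_smul, X_vec]
    refine smul_vec_mem_lowerTerms ha (by simp [hl]) ?_
    cases s <;> simp [depth, hl, hd]
  | zero => rw [map_zero]; exact zero_mem _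
  | add x y _ _ hx hy => rw [map_add]; exact add_mem hx hy
  | neg x _ hx => rw [map_neg]; exact neg_mem hx

theorem inv_q_smul_mem_lowerTerms {v w : List Arrow} {x : WordSpace} (h : x ∈ lowerTerms v)
    (hl : v.length = w.length) (hd : depth v < depth w) : q⁻¹ • x ∈ lowerTerms w := by
  induction h using AddSubgroup.closure_induction with
  | mem x hx =>
    obtain ⟨a, ha, v', hl', hd', rfl⟩ := hx
    rw [smul_smul]
    exact smul_vec_mem_lowerTerms (inv_q_mul_mem_smallCoeff ha) (hl'.trans hl) (hd'.trans hd)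
  | zero => rw [smul_zero]; exact zero_mem _
  | add x y _ _ hx hy => rw [smul_add]; exact add_mem hx hy
  | neg x _ hx => rw [smul_neg]; exact neg_mem hx

/-- `x` is the word `w` plus lower terms. -/
def HasLead (w : List Arrow) (x : WordSpace) : Prop := x - vec w ∈ lowerTerms w

theorem hasLead_nil : HasLead [] (vec []) := by rw [HasLead, sub_self]; exact zero_mem _

theorem HasLead.X {w : List Arrow} {x : WordSpace} (h : HasLead w x) (s : Arrow) :
    HasLead (s :: w) (X s x) := by
  rw [HasLead, ← X_vec, ← map_sub]
  exact X_mem_lowerTerms s h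

theorem HasLead.sub {v w : List Arrow} {x y : WordSpace} (h : HasLead w x) (h' : HasLead v y)
    (hl : v.length = w.length) (hd : depth v < depth w) : HasLead w (x - q⁻¹ • y) := by
  have e : x - q⁻¹ • y - vec w = (x - vec w) - (q⁻¹ • (y - vec v) + q⁻¹ • vec v) := by
    rw [smul_sub]; abel
  rw [HasLead, e]
  exact sub_mem h (add_mem (inv_q_smul_mem_lowerTerms h' hl hd)
    (smul_vec_mem_lowerTerms inv_q_mem_smallCoeff hl hd))

/-- Exchanging a down arrow with an up arrow on its right lowers the depth. -/
theorem depth_lt (x w : List Arrow) :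
    depth (.up :: (x ++ .down :: w)) < depth (.down :: (x ++ .up :: w)) := by
  have h : depth (x ++ .down :: w) = depth (x ++ .up :: w) + (w.length + 1) := by
    induction x with
    | nil => rfl
    | cons s x ih =>
      cases s
      · exact ih
      · simp only [List.cons_append, depth, ih, List.length_append, List.length_cons]; omega
  simp only [depth, h, List.length_append, List.length_cons]
  omega

/-- Turning round the two down arrows of a dashed arc lowers the depth. -/
theorem depth_lt' (x w : List Arrow) :
    depth (.up :: (x ++ .up :: w)) < depth (.down :: (x ++ .down :: w)) := by
  have h : depth (x ++ .up :: w) ≤ depth (x ++ .down :: w) := by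
    induction x with
    | nil => simp [depth]
    | cons s x ih =>
      cases s
      · exact ih
      · simpa [List.cons_append, depth] using ih
  simp only [depth, List.length_append, List.length_cons]
  omega

theorem HasLead.forestOp {w : List Arrow} {x : WordSpace} (h : HasLead w x) (u : Forest) :
    HasLead (u.toList ++ w) (forestOp u x) := by
  induction u generalizing w x with
  | nil => exact h
  | node a b iha ihb =>
    rw [forestOp_node_apply]
    have h1 := (iha ((ihb h).X .up)).X .down
    have h2 := (iha ((ihb h).X .down)).X .up
    have e : (Forest.node a b).toList ++ w =
        .down :: (a.toList ++ .up :: (b.toList ++ w)) := by simp [Forest.toList]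
    rw [e]
    exact h1.sub h2 (by simp) (depth_lt _ _)

theorem hasLead_coreVec (c : List Forest) : HasLead (coreList c) (coreVec c) := by
  induction c using List.twoStepInduction with
  | nil => exact hasLead_nil
  | singleton u =>
    have h := hasLead_nil.forestOp u
    exact (h.X .down).sub (h.X .up) (by simp) (by simp [depth])
  | cons_cons u v c ih ih' =>
    by_cases h : Odd c.length
    · rw [coreVec_of_odd _ _ _ h]
      have h1 := (((ih.forestOp v).X .down).forestOp u).X .down
      have h2 := (((ih.forestOp v).X .up).forestOp u).X .up
      exact h1.sub h2 (by simp) (depth_lt' _ _)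
    · have h' : Odd (v :: c).length := by
        rw [List.length_cons, Nat.odd_add_one]; exact h
      rw [coreVec_of_even _ _ h']
      exact ((ih' v).forestOp u).X .down

/-- The triangularity of the dual canonical basis elements. -/
theorem hasLead_dualVec (w : List Arrow) : HasLead w (dualVec w) := by
  have h : ∀ u c U, HasLead (wordOf U u c) (shapeVec u c U) := by
    intro u c U
    induction U with
    | nil => exact (hasLead_coreVec c).forestOp u
    | cons v U ih => exact (ih.X .up).forestOp v
  have h' := h (shape w).mid (shape w).core (shape w).ups
  rwa [wordOf_shape] at h'

/-! ### The irreducible representations as quotients of tensor powers -/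

/-- The vector of `V_j` with index `a`, which is zero for `a > j`. -/
noncomputable def unitVec (j a : ℕ) : V j := fun i => if (i : ℕ) = a then 1 else 0

theorem unitVec_fin (j : ℕ) (a : Fin (j + 1)) : unitVec j a = Pi.single a 1 := by
  funext i
  simp [unitVec, Pi.single_apply, Fin.ext_iff]

theorem unitVec_of_lt {j a : ℕ} (h : j < a) : unitVec j a = 0 := by
  funext i
  have := i.isLt
  rw [unitVec, if_neg (by omega), Pi.zero_apply]

theorem V_ext {j : ℕ} {M : Type*} [AddCommMonoid M] [Module Kq M] {f g : V j →ₗ[Kq] M}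
    (h : ∀ a ≤ j, f (unitVec j a) = g (unitVec j a)) : f = g :=
  (Pi.basisFun Kq (Fin (j + 1))).ext fun a => by
    rw [Pi.basisFun_apply, ← unitVec_fin]
    exact h a (by omega)

theorem opE_unitVec {j a : ℕ} (h : a ≤ j) : opE j (unitVec j a) = qint a • unitVec j (a - 1) := by
  funext i
  rw [opE, Matrix.toLin'_apply]
  simp only [Matrix.mulVec, dotProduct, Matrix.transpose_apply, canF, Matrix.of_apply, unitVec,
    Pi.smul_apply, smul_eq_mul, mul_ite, mul_one, mul_zero]
  rw [Finset.sum_eq_single ⟨a, by omega⟩]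
  · by_cases h1 : a = i + 1
    · subst h1; simp
    · by_cases h2 : a = 0
      · simp [h2]
      · have h3 : ¬ ((i : ℕ) = a - 1) := by omega
        simp [h1, h3]
  · intro b _ hb
    rw [if_neg]
    intro h'
    exact hb (Fin.ext h')
  · simp

theorem opF_unitVec {j a : ℕ} (h : a ≤ j) :
    opF j (unitVec j a) = qint (j - a) • unitVec j (a + 1) := by
  funext i
  rw [opF, Matrix.toLin'_apply]
  simp only [Matrix.mulVec, dotProduct, Matrix.transpose_apply, canE, Matrix.of_apply, unitVec,
    Pi.smul_apply, smul_eq_mul, mul_ite, mul_one, mul_zero]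
  rw [Finset.sum_eq_single ⟨a, by omega⟩]
  · by_cases h1 : (i : ℕ) = a + 1
    · simp only [h1, if_true]
      push_cast
      ring_nf
    · simp [h1]
  · intro b _ hb
    rw [if_neg]
    intro h'
    exact hb (Fin.ext h')
  · simp

theorem opK_unitVec (j a : ℕ) (e : ℤ) :
    opK j e (unitVec j a) = q ^ (e * (j - 2 * a)) • unitVec j a := by
  funext i
  rw [opK, Matrix.toLin'_apply, canK, Matrix.diagonal_transpose, Matrix.mulVec_diagonal]
  by_cases h : (i : ℕ) = a
  · simp [unitVec, h]
  · simp [unitVec, h]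

/-- Put an up arrow in front: the map `V_j → V_{j+1}` induced by `v^1 ⊗ -`. -/
noncomputable def blockUp (j : ℕ) : V j →ₗ[Kq] V (j + 1) :=
  (Pi.basisFun Kq (Fin (j + 1))).constr Kq fun a => unitVec (j + 1) a

/-- Put a down arrow in front: for `e = -1` the map `V_j → V_{j+1}` induced by `v^{-1} ⊗ -`,
for `e = 1` its conjugate under the bar involution. -/
noncomputable def blockDown (e : ℤ) (j : ℕ) : V j →ₗ[Kq] V (j + 1) :=
  (Pi.basisFun Kq (Fin (j + 1))).constr Kq fun a => q ^ (e * (j - (a : ℕ))) • unitVec (j + 1) (a + 1)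

theorem blockUp_unitVec {j a : ℕ} (h : a ≤ j) : blockUp j (unitVec j a) = unitVec (j + 1) a := by
  have := unitVec_fin j ⟨a, by omega⟩
  rw [show unitVec j a = _ from this, blockUp, ← Pi.basisFun_apply, Module.Basis.constr_basis]

theorem blockDown_unitVec {j a : ℕ} (e : ℤ) (h : a ≤ j) :
    blockDown e j (unitVec j a) = q ^ (e * (j - a)) • unitVec (j + 1) (a + 1) := by
  have := unitVec_fin j ⟨a, by omega⟩
  rw [show unitVec j a = _ from this, blockDown, ← Pi.basisFun_apply, Module.Basis.constr_basis]

theorem opE_comp_blockUp (j : ℕ) : opE (j + 1) ∘ₗ blockUp j = blockUp j ∘ₗ opE j :=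
  V_ext fun a h => by
    rw [LinearMap.comp_apply, LinearMap.comp_apply, blockUp_unitVec h, opE_unitVec h,
      opE_unitVec (by omega), map_smul, blockUp_unitVec (by omega)]

theorem opE_comp_blockDown (j : ℕ) : opE (j + 1) ∘ₗ blockDown (-1) j =
    blockUp j ∘ₗ opK j (-1) + blockDown (-1) j ∘ₗ opE j :=
  V_ext fun a h => by
    rw [LinearMap.add_apply, LinearMap.comp_apply, LinearMap.comp_apply, LinearMap.comp_apply,
      blockDown_unitVec _ h, opE_unitVec h, map_smul, opE_unitVec (by omega), map_smul, opK_unitVec,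
      map_smul, blockUp_unitVec h, smul_smul, Nat.add_sub_cancel]
    obtain _ | a := a
    · simp
    · rw [blockDown_unitVec _ (by omega), Nat.add_sub_cancel, smul_smul, ← add_smul]
      congr 1
      push_cast
      rw [qint_add ((a : ℤ) + 1) 1, qint_one, mul_one, mul_add, ← zpow_add₀ q_ne_zero, ← mul_assoc,
        ← zpow_add₀ q_ne_zero, mul_comm (qint _)]
      ring_nf

theorem opE_comp_blockDown_bar (j : ℕ) : opE (j + 1) ∘ₗ blockDown 1 j =
    blockUp j ∘ₗ opK j 1 + blockDown 1 j ∘ₗ opE j :=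
  V_ext fun a h => by
    rw [LinearMap.add_apply, LinearMap.comp_apply, LinearMap.comp_apply, LinearMap.comp_apply,
      blockDown_unitVec _ h, opE_unitVec h, map_smul, opE_unitVec (by omega), map_smul, opK_unitVec,
      map_smul, blockUp_unitVec h, smul_smul, Nat.add_sub_cancel]
    obtain _ | a := a
    · simp
    · rw [blockDown_unitVec _ (by omega), Nat.add_sub_cancel, smul_smul, ← add_smul]
      congr 1
      push_cast
      rw [qint_add' ((a : ℤ) + 1) 1, qint_one, mul_one, mul_add, ← zpow_add₀ q_ne_zero, ← mul_assoc,
        ← zpow_add₀ q_ne_zero, mul_comm (qint _)]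
      ring_nf

theorem opF_comp_blockUp (j : ℕ) : opF (j + 1) ∘ₗ blockUp j =
    blockDown (-1) j + q • blockUp j ∘ₗ opF j :=
  V_ext fun a h => by
    rw [LinearMap.add_apply, LinearMap.comp_apply, LinearMap.smul_apply, LinearMap.comp_apply,
      blockDown_unitVec _ h, blockUp_unitVec h, opF_unitVec h, opF_unitVec (by omega), map_smul]
    obtain rfl | h' := h.eq_or_lt
    · simp [unitVec_of_lt]
    · rw [blockUp_unitVec (by omega), smul_smul, ← add_smul]
      congr 1
      push_cast
      rw [show (j : ℤ) + 1 - a = (j - a) + 1 by ring, qint_add', qint_one, mul_one, zpow_one]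
      ring_nf

theorem opF_comp_blockDown (j : ℕ) : opF (j + 1) ∘ₗ blockDown (-1) j =
    q⁻¹ • blockDown (-1) j ∘ₗ opF j :=
  V_ext fun a h => by
    rw [LinearMap.comp_apply, LinearMap.smul_apply, LinearMap.comp_apply,
      blockDown_unitVec _ h, opF_unitVec h, map_smul, map_smul, opF_unitVec (by omega)]
    obtain rfl | h' := h.eq_or_lt
    · simp
    · rw [blockDown_unitVec _ (by omega), smul_smul, smul_smul, smul_smul]
      congr 1
      push_cast
      rw [show (j : ℤ) + 1 - (a + 1) = j - a by ring, ← zpow_neg_one, mul_right_comm,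
        ← zpow_add₀ q_ne_zero, mul_comm]
      ring_nf

theorem opK_comp_blockUp (j : ℕ) (e : ℤ) : opK (j + 1) e ∘ₗ blockUp j =
    q ^ e • blockUp j ∘ₗ opK j e :=
  V_ext fun a h => by
    rw [LinearMap.comp_apply, LinearMap.smul_apply, LinearMap.comp_apply, opK_unitVec, map_smul,
      blockUp_unitVec h, opK_unitVec, smul_smul, ← zpow_add₀ q_ne_zero]
    push_cast
    ring_nf

theorem opK_comp_blockDown (j : ℕ) (e : ℤ) : opK (j + 1) e ∘ₗ blockDown (-1) j =
    q ^ (-e) • blockDown (-1) j ∘ₗ opK j e :=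
  V_ext fun a h => by
    rw [LinearMap.comp_apply, LinearMap.smul_apply, LinearMap.comp_apply, opK_unitVec, map_smul,
      blockDown_unitVec _ h, map_smul, opK_unitVec, smul_smul, smul_smul, smul_smul,
      ← zpow_add₀ q_ne_zero, ← zpow_add₀ q_ne_zero, ← zpow_add₀ q_ne_zero]
    push_cast
    ring_nf

theorem blockDown_bar (j : ℕ) : blockDown 1 j =
    blockDown (-1) j + (q - q⁻¹) • blockUp j ∘ₗ opF j :=
  V_ext fun a h => by
    rw [LinearMap.add_apply, LinearMap.smul_apply, LinearMap.comp_apply, blockDown_unitVec _ h,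
      blockDown_unitVec _ h, opF_unitVec h, map_smul]
    obtain rfl | h' := h.eq_or_lt
    · simp
    · rw [blockUp_unitVec (by omega), smul_smul, ← add_smul, qint,
        mul_div_cancel₀ _ q_sub_inv_ne_zero]
      congr 1
      ring_nf

theorem opK_comp_opE (j : ℕ) : opK j 1 ∘ₗ opE j = q ^ 2 • opE j ∘ₗ opK j 1 :=
  V_ext fun a h => by
    rw [LinearMap.comp_apply, LinearMap.smul_apply, LinearMap.comp_apply, opE_unitVec h, map_smul,
      opK_unitVec, opK_unitVec, map_smul, opE_unitVec h, smul_smul, smul_smul, smul_smul]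
    obtain _ | a := a
    · simp
    · congr 1
      rw [mul_comm, ← zpow_natCast, ← zpow_add₀ q_ne_zero]
      push_cast
      ring_nf

theorem opK_comp_opE_pow (j r : ℕ) (v : V j) :
    opK j 1 ((opE j ^ r) v) = q ^ (2 * r) • (opE j ^ r) (opK j 1 v) := by
  induction r generalizing v with
  | zero => simp
  | succ r ih =>
    have := LinearMap.congr_fun (opK_comp_opE j) v
    simp only [LinearMap.comp_apply, LinearMap.smul_apply] at this
    rw [pow_succ, Module.End.mul_apply, ih, this, map_smul, smul_smul, Module.End.mul_apply,
      ← pow_add]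
    rfl

theorem opE_pow_unitVec {j r a : ℕ} (h : a < r) (ha : a ≤ j) : (opE j ^ r) (unitVec j a) = 0 := by
  induction r generalizing a with
  | zero => omega
  | succ r ih =>
    rw [pow_succ, Module.End.mul_apply, opE_unitVec ha, map_smul]
    obtain _ | a := a
    · simp
    · rw [Nat.add_sub_cancel, ih (by omega) (by omega), smul_zero]

theorem opE_pow_eq_zero (j : ℕ) : opE j ^ (j + 1) = 0 :=
  V_ext fun a h => by rw [opE_pow_unitVec (by omega) h, LinearMap.zero_apply]

theorem opE_pow_blockUp (j r : ℕ) (v : V j) :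
    (opE (j + 1) ^ r) (blockUp j v) = blockUp j ((opE j ^ r) v) := by
  induction r generalizing v with
  | zero => rfl
  | succ r ih =>
    have := LinearMap.congr_fun (opE_comp_blockUp j) v
    simp only [LinearMap.comp_apply] at this
    rw [pow_succ, Module.End.mul_apply, this, ih, pow_succ, Module.End.mul_apply]

theorem opE_pow_blockDown (j r : ℕ) (v : V j) :
    (opE (j + 1) ^ (r + 1)) (blockDown 1 j v) = blockDown 1 j ((opE j ^ (r + 1)) v) +
      (q ^ r * qint (r + 1)) • blockUp j ((opE j ^ r) (opK j 1 v)) := by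
  have h1 : ∀ v, opE (j + 1) (blockDown 1 j v) =
      blockUp j (opK j 1 v) + blockDown 1 j (opE j v) :=
    LinearMap.congr_fun (opE_comp_blockDown_bar j)
  induction r with
  | zero => simp [h1, add_comm]
  | succ r ih =>
    have h2 : opE (j + 1) (blockUp j ((opE j ^ r) (opK j 1 v))) =
        blockUp j (opE j ((opE j ^ r) (opK j 1 v))) :=
      LinearMap.congr_fun (opE_comp_blockUp j) _
    rw [pow_succ' _ (r + 1), Module.End.mul_apply, ih, map_add, map_smul, h1, h2,
      opK_comp_opE_pow, map_smul, ← Module.End.mul_apply (opE j), ← pow_succ',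
      ← Module.End.mul_apply (opE j), ← pow_succ', add_right_comm, ← add_smul, add_comm (_ • blockUp j _)]
    congr 2
    push_cast
    rw [qint_add ((r : ℤ) + 1) 1, qint_one, mul_one, zpow_neg_one, mul_add, ← zpow_natCast,
      ← zpow_natCast, ← zpow_natCast]
    push_cast
    rw [mul_add, ← zpow_add₀ q_ne_zero, ← mul_assoc, ← zpow_sub_one₀ q_ne_zero]
    ring_nf

/-- The map `V_j → V_{j+1}` putting an arrow in front. -/
noncomputable def blockStep (j : ℕ) : Arrow → V j →ₗ[Kq] V (j + 1)
  | .up => blockUp j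
  | .down => blockDown (-1) j

/-- The image in `V_j` of the first `j` arrows of a word; words with less than `j` arrows are sent
to zero. -/
noncomputable def blockVec : (j : ℕ) → List Arrow → V j
  | 0, _ => unitVec 0 0
  | _ + 1, [] => 0
  | j + 1, s :: w => blockStep j s (blockVec j w)

section BlockMap

open TensorProduct (map)

variable {A : Type*} [AddCommGroup A] [Module Kq A] (f : WordSpace →ₗ[Kq] A)

/-- The map into `V_j ⊗ A` which is given on the first `j` arrows by `blockVec` and on the other
arrows by a map into `A`. -/
noncomputable def blockMap (j : ℕ) : WordSpace →ₗ[Kq] V j ⊗[Kq] A :=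
  Finsupp.linearCombination Kq fun w => blockVec j w ⊗ₜ f (vec (w.drop j))

theorem blockMap_vec (j : ℕ) (w : List Arrow) :
    blockMap f j (vec w) = blockVec j w ⊗ₜ f (vec (w.drop j)) := by
  simp [blockMap, vec]

theorem blockMap_zero (x : WordSpace) : blockMap f 0 x = unitVec 0 0 ⊗ₜ f x := by
  have h : blockMap f 0 = (TensorProduct.mk Kq (V 0) A (unitVec 0 0)) ∘ₗ f :=
    end_ext fun w => by simp [blockMap_vec, blockVec]
  exact LinearMap.congr_fun h x

theorem blockMap_nil (j : ℕ) : blockMap f (j + 1) (vec []) = 0 := by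
  simp [blockMap_vec, blockVec]

theorem blockMap_X (j : ℕ) (s : Arrow) (x : WordSpace) :
    blockMap f (j + 1) (X s x) = map (blockStep j s) LinearMap.id (blockMap f j x) := by
  have h : blockMap f (j + 1) ∘ₗ X s = map (blockStep j s) LinearMap.id ∘ₗ blockMap f j :=
    end_ext fun w => by simp [blockMap_vec, blockVec]
  exact LinearMap.congr_fun h x

theorem map_map_id {U U' U'' : Type*} [AddCommGroup U] [Module Kq U] [AddCommGroup U']
    [Module Kq U'] [AddCommGroup U''] [Module Kq U''] (g : U' →ₗ[Kq] U'') (h : U →ₗ[Kq] U')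
    (k : Module.End Kq A) (x : U ⊗[Kq] A) :
    map g k (map h LinearMap.id x) = map (g ∘ₗ h) k x := by
  rw [← LinearMap.comp_apply, ← TensorProduct.map_comp, LinearMap.comp_id]

theorem map_id_map {U U' U'' : Type*} [AddCommGroup U] [Module Kq U] [AddCommGroup U']
    [Module Kq U'] [AddCommGroup U''] [Module Kq U''] (g : U' →ₗ[Kq] U'') (h : U →ₗ[Kq] U')
    (k : Module.End Kq A) (x : U ⊗[Kq] A) :
    map g LinearMap.id (map h k x) = map (g ∘ₗ h) k x := by
  rw [← LinearMap.comp_apply, ← TensorProduct.map_comp, LinearMap.id_comp]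

/-- An operator on words which respects the same recursion on the first letter as operators on the
spaces `V_j ⊗ A` is intertwined with the latter. -/
theorem blockMap_comm {g : Module.End Kq WordSpace} {G : ∀ j, Module.End Kq (V j ⊗[Kq] A)}
    (h0 : ∀ x, blockMap f 0 (g x) = G 0 (blockMap f 0 x))
    (hnil : ∀ j, blockMap f (j + 1) (g (vec [])) = 0)
    (hX : ∀ j s x, blockMap f j (g x) = G j (blockMap f j x) →
      blockMap f (j + 1) (g (X s x)) = G (j + 1) (blockMap f (j + 1) (X s x)))
    (j : ℕ) (x : WordSpace) : blockMap f j (g x) = G j (blockMap f j x) := by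
  induction j generalizing x with
  | zero => exact h0 x
  | succ j ih =>
    have h : blockMap f (j + 1) ∘ₗ g = G (j + 1) ∘ₗ blockMap f (j + 1) := by
      refine end_ext fun w => ?_
      rw [LinearMap.comp_apply, LinearMap.comp_apply]
      cases w with
      | nil => rw [hnil, blockMap_nil, map_zero]
      | cons s w => rw [← X_vec]; exact hX j s _ (ih _)
    exact LinearMap.congr_fun h x

theorem blockMap_wordK {e : ℤ} {kA : Module.End Kq A} (hK : ∀ x, f (wordK e x) = kA (f x)) (j : ℕ)
    (x : WordSpace) : blockMap f j (wordK e x) = map (opK j e) kA (blockMap f j x) := by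
  refine blockMap_comm f (G := fun j => map (opK j e) kA) ?_ ?_ ?_ j x
  · intro x
    simp [blockMap_zero, opK_unitVec, hK]
  · intro j
    rw [wordK_nil, blockMap_nil]
  · intro j s x h
    rw [blockMap_X, map_map_id]
    cases s
    · rw [wordK_X_up, map_smul, blockMap_X, h, map_id_map, blockStep, opK_comp_blockUp,
        TensorProduct.map_smul_left]
      rfl
    · rw [wordK_X_down, map_smul, blockMap_X, h, map_id_map, blockStep, opK_comp_blockDown,
        TensorProduct.map_smul_left]
      rfl

/-- The action of `Δ(E)` on `V_j ⊗ A`. -/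
noncomputable def pairE (j : ℕ) (eA kA : Module.End Kq A) : Module.End Kq (V j ⊗[Kq] A) :=
  map (opE j) kA + map LinearMap.id eA

/-- The action of `Δ(F)` on `V_j ⊗ A`. -/
noncomputable def pairF (j : ℕ) (fA : Module.End Kq A) : Module.End Kq (V j ⊗[Kq] A) :=
  map (opF j) LinearMap.id + map (opK j 1) fA

theorem blockMap_wordE {eA kA : Module.End Kq A} (hE : ∀ x, f (wordE x) = eA (f x))
    (hK : ∀ x, f (wordK (-1) x) = kA (f x)) (j : ℕ) (x : WordSpace) :
    blockMap f j (wordE x) = pairE j eA kA (blockMap f j x) := by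
  refine blockMap_comm f (G := fun j => pairE j eA kA) ?_ ?_ ?_ j x
  · intro x
    simp [blockMap_zero, pairE, opE_unitVec, hE]
  · intro j
    rw [wordE_nil, map_zero]
  · intro j s x h
    rw [blockMap_X, pairE, LinearMap.add_apply, map_map_id, map_map_id]
    cases s
    · rw [wordE_X_up, blockMap_X, h, pairE, LinearMap.add_apply, map_add, map_id_map, map_id_map,
        blockStep, opE_comp_blockUp]
      rfl
    · rw [wordE_X_down, map_add, blockMap_X, blockMap_X, h, blockMap_wordK f hK, pairE,
        LinearMap.add_apply, map_add, map_id_map, map_id_map, map_id_map, blockStep, blockStep,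
        opE_comp_blockDown, TensorProduct.map_add_left, LinearMap.add_apply]
      exact (add_assoc _ _ _).symm

theorem blockMap_wordF {fA : Module.End Kq A} (hF : ∀ x, f (wordF x) = fA (f x)) (j : ℕ)
    (x : WordSpace) : blockMap f j (wordF x) = pairF j fA (blockMap f j x) := by
  refine blockMap_comm f (G := fun j => pairF j fA) ?_ ?_ ?_ j x
  · intro x
    simp [blockMap_zero, pairF, opF_unitVec, opK_unitVec, hF]
  · intro j
    rw [wordF_nil, map_zero]
  · intro j s x h
    rw [blockMap_X, pairF, LinearMap.add_apply, map_map_id, map_map_id]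
    cases s
    · rw [wordF_X_up, map_add, map_smul, blockMap_X, blockMap_X, h, pairF, LinearMap.add_apply,
        map_add, map_id_map, map_id_map, blockStep, blockStep, opF_comp_blockUp, opK_comp_blockUp,
        TensorProduct.map_add_left, LinearMap.add_apply, TensorProduct.map_smul_left,
        TensorProduct.map_smul_left, zpow_one, smul_add]
      exact (add_assoc _ _ _).symm
    · rw [wordF_X_down, map_smul, blockMap_X, h, pairF, LinearMap.add_apply,
        map_add, map_id_map, map_id_map, blockStep, opF_comp_blockDown, opK_comp_blockDown,
        TensorProduct.map_smul_left, TensorProduct.map_smul_left, zpow_neg_one, smul_add]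
      rfl

/-- The coefficients of the quasi-`R`-matrix. -/
noncomputable def thetaCoeff (k : ℕ) : Kq := q ^ (k * (k - 1) / 2) * (q - q⁻¹) ^ k / qfact k

/-- The recursion that matches the coefficients of the quasi-`R`-matrix with the powers of `E` on
`V_j`. -/
theorem thetaCoeff_succ (k : ℕ) :
    thetaCoeff (k + 1) * (q ^ k * qint (k + 1)) = (q - q⁻¹) * (q ^ (2 * k) * thetaCoeff k) := by
  have h1 : qint ((k : ℤ) + 1) ≠ 0 := qint_ne_zero (by positivity)
  have h2 := qfact_ne_zero k
  have h3 : (k + 1) * (k + 1 - 1) / 2 = k * (k - 1) / 2 + k := by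
    rw [← Finset.sum_range_id_mul_two, ← Finset.sum_range_id_mul_two, Finset.sum_range_succ]
    omega
  rw [thetaCoeff, thetaCoeff, qfact_succ, h3, pow_add, pow_succ, two_mul, pow_add]
  field_simp

/-- The quasi-`R`-matrix on `V_j ⊗ A`; higher powers of `E` vanish on `V_j`. -/
noncomputable def pairTheta (j : ℕ) (fA : Module.End Kq A) : Module.End Kq (V j ⊗[Kq] A) :=
  ∑ k ∈ Finset.range (j + 1), thetaCoeff k • map (opE j ^ k) (fA ^ k)

theorem pairTheta_up (j : ℕ) (fA : Module.End Kq A) (v : V j) (t : A) :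
    pairTheta (j + 1) fA (blockUp j v ⊗ₜ t) =
      map (blockUp j) LinearMap.id (pairTheta j fA (v ⊗ₜ t)) := by
  simp only [pairTheta, LinearMap.sum_apply, LinearMap.smul_apply, TensorProduct.map_tmul,
    opE_pow_blockUp, map_sum, map_smul, LinearMap.id_apply]
  rw [Finset.sum_range_succ, opE_pow_eq_zero]
  simp

/-- The quasi-`R`-matrix on `V_{j+1} ⊗ A` satisfies the same recursion for a down arrow in front as
`wordPsi`. -/
theorem pairTheta_down (j : ℕ) (fA : Module.End Kq A) (v : V j) (t : A) :
    pairTheta (j + 1) fA (blockDown 1 j v ⊗ₜ t) =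
      map (blockDown (-1) j) LinearMap.id (pairTheta j fA (v ⊗ₜ t)) +
      (q - q⁻¹) • map (blockUp j) LinearMap.id (pairF j fA (pairTheta j fA (v ⊗ₜ t))) := by
  have hb : ∀ v, blockDown 1 j v = blockDown (-1) j v + (q - q⁻¹) • blockUp j (opF j v) :=
    LinearMap.congr_fun (blockDown_bar j)
  have h1 : ∑ k ∈ Finset.range (j + 1), thetaCoeff k • ((blockDown 1 j ((opE j ^ k) v)) ⊗ₜ[Kq]
      ((fA ^ k) t)) = map (blockDown (-1) j) LinearMap.id (pairTheta j fA (v ⊗ₜ t)) +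
      (q - q⁻¹) • map (blockUp j) LinearMap.id (map (opF j) LinearMap.id
        (pairTheta j fA (v ⊗ₜ t))) := by
    simp only [pairTheta, LinearMap.sum_apply, LinearMap.smul_apply, TensorProduct.map_tmul,
      map_sum, map_smul, LinearMap.id_apply, hb, TensorProduct.add_tmul, TensorProduct.smul_tmul',
      smul_add, Finset.sum_add_distrib, Finset.smul_sum]
    congr 1
    exact Finset.sum_congr rfl fun k _ => congrArg (· ⊗ₜ[Kq] _) (smul_comm _ _ _)
  have h2 : ∑ k ∈ Finset.range (j + 1), (thetaCoeff (k + 1) * (q ^ k * qint (k + 1))) •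
      (blockUp j ((opE j ^ k) (opK j 1 v)) ⊗ₜ[Kq] ((fA ^ (k + 1)) t)) =
      (q - q⁻¹) • map (blockUp j) LinearMap.id (map (opK j 1) fA
        (pairTheta j fA (v ⊗ₜ t))) := by
    simp only [pairTheta, LinearMap.sum_apply, LinearMap.smul_apply, TensorProduct.map_tmul,
      map_sum, map_smul, LinearMap.id_apply, Finset.smul_sum, opK_comp_opE_pow, thetaCoeff_succ]
    refine Finset.sum_congr rfl fun k _ => ?_
    rw [← TensorProduct.smul_tmul', smul_smul, smul_smul, pow_succ', Module.End.mul_apply]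
    congr 1
    ring
  rw [pairF, LinearMap.add_apply, map_add, smul_add, ← add_assoc, ← h1, ← h2]
  rw [pairTheta, LinearMap.sum_apply, Finset.sum_range_succ']
  simp only [LinearMap.smul_apply, TensorProduct.map_tmul, opE_pow_blockDown,
    TensorProduct.add_tmul, smul_add, Finset.sum_add_distrib]
  rw [Finset.sum_range_succ, opE_pow_eq_zero]
  refine (add_right_comm _ _ _).trans ?_
  congr 1
  · rw [Finset.sum_range_succ']
    simp
  · refine Finset.sum_congr rfl fun k _ => ?_
    rw [← TensorProduct.smul_tmul', smul_smul]

end BlockMap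

/-! ### The coefficient of the empty word -/

theorem wordE_apply_nil (x : WordSpace) : wordE x [] = 0 := by
  induction x using word_induction with
  | hadd x y hx hy => rw [map_add, Finsupp.add_apply, hx, hy, add_zero]
  | hsmul a x hx => rw [map_smul, Finsupp.smul_apply, hx, smul_zero]
  | hnil => rw [wordE_nil]; rfl
  | hcons s x hx =>
    cases s
    · rw [wordE_X_up, X_apply_nil]
    · rw [wordE_X_down, Finsupp.add_apply, X_apply_nil, X_apply_nil, add_zero]

theorem wordF_apply_nil (x : WordSpace) : wordF x [] = 0 := by
  induction x using word_induction with
  | hadd x y hx hy => rw [map_add, Finsupp.add_apply, hx, hy, add_zero]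
  | hsmul a x hx => rw [map_smul, Finsupp.smul_apply, hx, smul_zero]
  | hnil => rw [wordF_nil]; rfl
  | hcons s x hx =>
    cases s
    · rw [wordF_X_up, Finsupp.add_apply, Finsupp.smul_apply, X_apply_nil, X_apply_nil, smul_zero,
        add_zero]
    · rw [wordF_X_down, Finsupp.smul_apply, X_apply_nil, smul_zero]

theorem wordK_apply_nil (e : ℤ) (x : WordSpace) : wordK e x [] = x [] := by
  induction x using word_induction with
  | hadd x y hx hy => rw [map_add, Finsupp.add_apply, hx, hy, Finsupp.add_apply]
  | hsmul a x hx => rw [map_smul, Finsupp.smul_apply, hx, Finsupp.smul_apply]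
  | hnil => rw [wordK_nil]
  | hcons s x hx =>
    cases s
    · rw [wordK_X_up, Finsupp.smul_apply, X_apply_nil, X_apply_nil, smul_zero]
    · rw [wordK_X_down, Finsupp.smul_apply, X_apply_nil, X_apply_nil, smul_zero]

theorem wordPsi_apply_nil (x : WordSpace) : wordPsi x [] = bar (x []) := by
  induction x using word_induction with
  | hadd x y hx hy => rw [map_add, Finsupp.add_apply, hx, hy, Finsupp.add_apply, map_add]
  | hsmul a x hx => rw [wordPsi_smul, Finsupp.smul_apply, hx, Finsupp.smul_apply, smul_eq_mul,
      smul_eq_mul, map_mul]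
  | hnil => rw [wordPsi_nil]; simp [vec]
  | hcons s x hx =>
    cases s
    · rw [wordPsi_X_up, X_apply_nil, X_apply_nil, map_zero]
    · rw [wordPsi_X_down, Finsupp.add_apply, Finsupp.smul_apply, X_apply_nil, X_apply_nil,
        X_apply_nil, smul_zero, add_zero, map_zero]

/-! ### The bar involution on the product of `V_j` with a module -/

/-- Conjugation of the coordinates by the bar involution. -/
noncomputable def conj (j : ℕ) : V j →ₛₗ[barHom] V j where
  toFun v i := bar (v i)
  map_add' v w := by funext i; simp
  map_smul' a v := by funext i; simp

theorem conj_unitVec (j a : ℕ) : conj j (unitVec j a) = unitVec j a := by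
  funext i
  change bar (unitVec j a i) = _
  rw [unitVec]; split_ifs <;> simp

theorem conj_smul (j : ℕ) (a : Kq) (v : V j) : conj j (a • v) = bar a • conj j v :=
  map_smulₛₗ _ _ _

theorem V_ext_bar {j j' : ℕ} {f g : V j →ₛₗ[barHom] V j'}
    (h : ∀ a ≤ j, f (unitVec j a) = g (unitVec j a)) : f = g :=
  (Pi.basisFun Kq (Fin (j + 1))).ext fun a => by
    rw [Pi.basisFun_apply, ← unitVec_fin]
    exact h a (by omega)

theorem conj_blockUp (j : ℕ) (v : V j) : conj (j + 1) (blockUp j v) = blockUp j (conj j v) := by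
  have h : (conj (j + 1)).comp (blockUp j) = (blockUp j).comp (conj j) :=
    V_ext_bar fun a h => by simp [blockUp_unitVec h, conj_unitVec]
  exact LinearMap.congr_fun h v

theorem conj_blockDown (j : ℕ) (v : V j) :
    conj (j + 1) (blockDown (-1) j v) = blockDown 1 j (conj j v) := by
  have h : (conj (j + 1)).comp (blockDown (-1) j) = (blockDown 1 j).comp (conj j) :=
    V_ext_bar fun a h => by
      rw [LinearMap.comp_apply, LinearMap.comp_apply, conj_unitVec, blockDown_unitVec _ h,
        blockDown_unitVec _ h, conj_smul, bar_zpow, conj_unitVec]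
      ring_nf
  exact LinearMap.congr_fun h v

/-- The bar involution on words induces the quasi-`R`-matrix composed with the bar involutions of
the two factors. -/
theorem blockMap_wordPsi {A : Type*} [AddCommGroup A] [Module Kq A] (f : WordSpace →ₗ[Kq] A)
    {fA : Module.End Kq A} (hF : ∀ x, f (wordF x) = fA (f x)) (j : ℕ) (w : List Arrow) :
    blockMap f j (wordPsi (vec w)) =
      pairTheta j fA (conj j (blockVec j w) ⊗ₜ f (wordPsi (vec (w.drop j)))) := by
  induction j generalizing w with
  | zero =>
    rw [blockMap_zero, blockVec, conj_unitVec]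
    simp [pairTheta, thetaCoeff, qfact]
  | succ j ih =>
    cases w with
    | nil => rw [wordPsi_nil, blockMap_nil, blockVec, map_zero, TensorProduct.zero_tmul, map_zero]
    | cons s w =>
      rw [← X_vec, blockVec, List.drop_succ_cons]
      cases s
      · rw [wordPsi_X_up, blockMap_X, ih, blockStep, conj_blockUp, pairTheta_up]
      · rw [wordPsi_X_down, map_add, map_smul, blockMap_X, blockMap_X, blockMap_wordF f hF, ih,
          blockStep, blockStep, conj_blockDown, pairTheta_down]

/-! ### The tensor product as a quotient of a tensor power -/

/-- Split off the first tensor factor. -/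
noncomputable def consMap {n : ℕ} (m : Fin (n + 1) → ℕ) :
    V (m 0) ⊗[Kq] T (fun i => m i.succ) →ₗ[Kq] T m :=
  TensorProduct.lift (PiTensorProduct.lift.toLinearMap ∘ₗ
    (PiTensorProduct.tprod Kq (s := fun i => V (m i))).curryLeft)

theorem consMap_tprod {n : ℕ} (m : Fin (n + 1) → ℕ) (v : V (m 0)) (t : ∀ i : Fin n, V (m i.succ)) :
    consMap m (v ⊗ₜ PiTensorProduct.tprod Kq t) =
      PiTensorProduct.tprod Kq (Fin.cons (α := fun i => V (m i)) v t) := by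
  simp [consMap]

theorem map_consMap {n : ℕ} (m : Fin (n + 1) → ℕ) (f : ∀ i, Module.End Kq (V (m i)))
    (x : V (m 0) ⊗[Kq] T (fun i => m i.succ)) : PiTensorProduct.map f (consMap m x) =
      consMap m (TensorProduct.map (f 0) (PiTensorProduct.map fun i => f i.succ) x) := by
  suffices h : PiTensorProduct.map f ∘ₗ consMap m =
      consMap m ∘ₗ TensorProduct.map (f 0) (PiTensorProduct.map fun i => f i.succ) from
    LinearMap.congr_fun h x
  refine TensorProduct.ext (LinearMap.ext fun v => PiTensorProduct.ext (MultilinearMap.ext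
    fun t => ?_))
  simp only [LinearMap.compMultilinearMap_apply, LinearMap.compr₂ₛₗ_apply, TensorProduct.mk_apply,
    LinearMap.comp_apply, consMap_tprod, PiTensorProduct.map_tprod, TensorProduct.map_tmul]
  congr 1
  funext i
  refine Fin.cases ?_ (fun i => ?_) i <;> simp

theorem map_consMap_of_eq {n : ℕ} (m : Fin (n + 1) → ℕ) {f : ∀ i, Module.End Kq (V (m i))}
    {g : Module.End Kq (V (m 0))} {h : ∀ i : Fin n, Module.End Kq (V (m i.succ))}
    (hg : f 0 = g) (hh : ∀ i : Fin n, f i.succ = h i) (x : V (m 0) ⊗[Kq] T (fun i => m i.succ)) :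
    PiTensorProduct.map f (consMap m x) =
      consMap m (TensorProduct.map g (PiTensorProduct.map h) x) := by
  obtain rfl : (fun i : Fin n => f i.succ) = h := funext hh
  rw [map_consMap, hg]

theorem stdBasis_apply {n : ℕ} (m : Fin n → ℕ) (a : Idx m) :
    stdBasis m a = PiTensorProduct.tprod Kq fun i => unitVec (m i) (a i) := by
  simp [stdBasis, Basis.piTensorProduct_apply, unitVec_fin]

theorem consMap_stdBasis {n : ℕ} (m : Fin (n + 1) → ℕ) (a : Fin (m 0 + 1))
    (l : Idx fun i => m i.succ) : consMap m (unitVec (m 0) a ⊗ₜ stdBasis _ l) =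
      stdBasis m (Fin.cons (α := fun i => Fin (m i + 1)) a l) := by
  rw [stdBasis_apply, stdBasis_apply, consMap_tprod]
  congr 1
  funext i
  refine Fin.cases ?_ (fun i => ?_) i <;> simp

/-- `K ^ e` on the tensor product. -/
noncomputable def tensorKPow {n : ℕ} (m : Fin n → ℕ) (e : ℤ) : Module.End Kq (T m) :=
  PiTensorProduct.map fun j => opK (m j) e

theorem map_sum_right {ι U A : Type*} [AddCommGroup U] [Module Kq U] [AddCommGroup A] [Module Kq A]
    (f : Module.End Kq U) (s : Finset ι) (g : ι → Module.End Kq A) :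
    TensorProduct.map f (∑ i ∈ s, g i) = ∑ i ∈ s, TensorProduct.map f (g i) := by
  classical
  induction s using Finset.induction_on with
  | empty => rw [Finset.sum_empty, Finset.sum_empty, TensorProduct.map_zero_right]
  | insert i s hi ih =>
    rw [Finset.sum_insert hi, Finset.sum_insert hi, TensorProduct.map_add_right, ih]

section Cons

variable {n : ℕ} (m : Fin (n + 1) → ℕ) (x : V (m 0) ⊗[Kq] T (fun i => m i.succ))

theorem tensorKPow_consMap (e : ℤ) : tensorKPow m e (consMap m x) =
    consMap m (TensorProduct.map (opK (m 0) e) (tensorKPow _ e) x) := map_consMap _ _ _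

theorem tailE_consMap : tailE m 0 (consMap m x) =
    consMap m (pairE (m 0) (tailE _ 0) (tensorKPow _ (-1)) x) := by
  rw [tailE, Fin.sum_univ_succ, LinearMap.add_apply, LinearMap.sum_apply, pairE,
    LinearMap.add_apply, map_add, tailE, map_sum_right, LinearMap.sum_apply, map_sum]
  congr 1
  · rw [if_pos (Nat.zero_le _)]
    exact map_consMap_of_eq m (if_pos rfl)
      (fun i => by rw [if_neg (Fin.succ_ne_zero i), if_pos (Fin.succ_pos i)]) x
  · refine Finset.sum_congr rfl fun i _ => ?_
    rw [if_pos (Nat.zero_le _), if_pos (Nat.zero_le _)]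
    refine map_consMap_of_eq m ?_ (fun j => ?_) x
    · rw [if_neg (Fin.succ_ne_zero i).symm, if_neg (Fin.not_lt_zero _)]
    · simp only [Fin.succ_inj, Fin.succ_lt_succ_iff]

theorem tailF_consMap : tailF m 0 (consMap m x) = consMap m (pairF (m 0) (tailF _ 0) x) := by
  rw [tailF, Fin.sum_univ_succ, LinearMap.add_apply, LinearMap.sum_apply, pairF,
    LinearMap.add_apply, map_add, tailF, map_sum_right, LinearMap.sum_apply, map_sum]
  congr 1
  · rw [if_pos (Nat.zero_le _), ← PiTensorProduct.map_id]
    exact map_consMap_of_eq m (if_pos rfl)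
      (fun i => by rw [if_neg (Fin.succ_ne_zero i), if_neg fun h => Fin.not_lt_zero _ h.2]) x
  · refine Finset.sum_congr rfl fun i _ => ?_
    rw [if_pos (Nat.zero_le _), if_pos (Nat.zero_le _)]
    refine map_consMap_of_eq m ?_ (fun j => ?_) x
    · rw [if_neg (Fin.succ_ne_zero i).symm, if_pos ⟨Nat.zero_le _, Fin.succ_pos i⟩]
    · simp only [Fin.succ_inj, Fin.succ_lt_succ_iff, Nat.zero_le, true_and]

theorem tailF_succ_consMap (p : ℕ) : tailF m (p + 1) (consMap m x) =
    consMap m (TensorProduct.map LinearMap.id (tailF _ p) x) := by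
  rw [tailF, Fin.sum_univ_succ, LinearMap.add_apply, LinearMap.sum_apply, tailF, map_sum_right,
    LinearMap.sum_apply, map_sum, if_neg (by simp), LinearMap.zero_apply, zero_add]
  refine Finset.sum_congr rfl fun i _ => ?_
  by_cases h : p ≤ i
  · rw [if_pos h, if_pos (by simpa using h)]
    refine map_consMap_of_eq m ?_ (fun j => ?_) x
    · rw [if_neg (Fin.succ_ne_zero i).symm, if_neg (by simp)]
    · simp only [Fin.succ_inj, Fin.succ_lt_succ_iff, Fin.val_succ, Nat.add_le_add_iff_right]
  · rw [if_neg h, if_neg (by simpa using h), TensorProduct.map_zero_right, LinearMap.zero_apply,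
      LinearMap.zero_apply, map_zero]

theorem siteE_zero_consMap : siteE m 0 (consMap m x) =
    consMap m (TensorProduct.map (opE (m 0)) LinearMap.id x) := by
  rw [siteE, ← PiTensorProduct.map_id]
  exact map_consMap_of_eq m (if_pos rfl) (fun i => if_neg (Fin.succ_ne_zero i)) x

theorem siteE_succ_consMap (p : Fin n) : siteE m p.succ (consMap m x) =
    consMap m (TensorProduct.map LinearMap.id (siteE _ p) x) := by
  rw [siteE, siteE]
  exact map_consMap_of_eq m (if_neg (Fin.succ_ne_zero p).symm)
    (fun i => by simp only [Fin.succ_inj]) x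

theorem pow_consMap {f : Module.End Kq (T m)}
    {g : Module.End Kq (V (m 0) ⊗[Kq] T (fun i => m i.succ))}
    (h : ∀ x, f (consMap m x) = consMap m (g x)) (k : ℕ) :
    (f ^ k) (consMap m x) = consMap m ((g ^ k) x) := by
  induction k generalizing x with
  | zero => rfl
  | succ k ih => rw [pow_succ, Module.End.mul_apply, h, ih, pow_succ, Module.End.mul_apply]

theorem thetaAt_zero_consMap : thetaAt m 0 (consMap m x) =
    consMap m (pairTheta (m 0) (tailF _ 0) x) := by
  rw [thetaAt, pairTheta, LinearMap.sum_apply, LinearMap.sum_apply, map_sum]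
  refine Finset.sum_congr rfl fun k _ => ?_
  rw [LinearMap.smul_apply, LinearMap.smul_apply, map_smul, Module.End.mul_apply, Fin.val_zero,
    pow_consMap m x (tailF_succ_consMap m · 0), pow_consMap m _ (siteE_zero_consMap m),
    TensorProduct.map_pow, TensorProduct.map_pow, ← Module.End.mul_apply, ← TensorProduct.map_mul,
    ← Module.End.one_eq_id, ← Module.End.one_eq_id, one_pow, one_pow, one_mul, mul_one]
  rfl

theorem thetaAt_succ_consMap (p : Fin n) : thetaAt m p.succ (consMap m x) =
    consMap m (TensorProduct.map LinearMap.id (thetaAt _ p) x) := by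
  rw [thetaAt, thetaAt, LinearMap.sum_apply, map_sum_right, LinearMap.sum_apply, map_sum]
  refine Finset.sum_congr rfl fun k _ => ?_
  rw [LinearMap.smul_apply, TensorProduct.map_smul_right, LinearMap.smul_apply, map_smul,
    Module.End.mul_apply, Fin.val_succ,
    pow_consMap m x (tailF_succ_consMap m · (p + 1)), pow_consMap m _ (siteE_succ_consMap m · p),
    TensorProduct.map_pow, TensorProduct.map_pow, ← Module.End.mul_apply, ← TensorProduct.map_mul,
    ← Module.End.one_eq_id, one_pow, one_mul]

/-- The factorization `Θ^{(n)} = (1 ⊗ Δ^{n-2})Θ · Θ^{(n-1)}_{2,…,n}` with the first tensor factor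
split off. -/
theorem theta_consMap : theta m (consMap m x) = consMap m (pairTheta (m 0) (tailF _ 0)
    (TensorProduct.map LinearMap.id (theta _) x)) := by
  have h : ∀ l : List (Fin n), (l.map fun p => thetaAt m p.succ).prod (consMap m x) =
      consMap m (TensorProduct.map LinearMap.id (l.map (thetaAt fun i => m i.succ)).prod x) := by
    intro l
    induction l with
    | nil =>
      rw [List.map_nil, List.map_nil, List.prod_nil, List.prod_nil, Module.End.one_eq_id,
        Module.End.one_eq_id, TensorProduct.map_id]
      rfl
    | cons p l ih =>
      rw [List.map_cons, List.map_cons, List.prod_cons, List.prod_cons, Module.End.mul_apply, ih,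
        thetaAt_succ_consMap, ← LinearMap.comp_apply (TensorProduct.map _ _),
        ← TensorProduct.map_comp, LinearMap.id_comp, Module.End.mul_eq_comp]
  rw [theta, List.finRange_succ, List.map_cons, List.prod_cons, List.map_map, Module.End.mul_apply,
    ← thetaAt_zero_consMap]
  exact congrArg _ (h _)

end Cons

section Psi

variable {n : ℕ} (m : Fin n → ℕ)

theorem psi_add (x y : T m) : psi m (x + y) = psi m x + psi m y := by
  rw [psi, map_add, Finsupp.mapRange_add (map_add bar), map_add, psi, psi]

theorem psi_smul (a : Kq) (x : T m) : psi m (a • x) = bar a • psi m x := by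
  have : ((stdBasis m).repr (a • x)).mapRange bar (map_zero bar) =
      bar a • ((stdBasis m).repr x).mapRange bar (map_zero bar) := by
    ext w; simp
  rw [psi, this, map_smul, psi]

theorem psi_stdBasis (a : Idx m) : psi m (stdBasis m a) = stdBasis m a := by
  rw [psi, Module.Basis.repr_self, Finsupp.mapRange_single, map_one,
    Module.Basis.repr_symm_single_one]

end Psi

/-- The projection of the space of words onto the tensor product: the first `m_1` arrows are sent to
`V_{m_1}`, and so on.  Words which are not of length `m_1 + ⋯ + m_n` are sent to zero. -/
noncomputable def wordMap : ∀ {n : ℕ} (m : Fin n → ℕ), WordSpace →ₗ[Kq] T m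
  | 0, m => (Finsupp.lapply []).smulRight (stdBasis m fun i => i.elim0)
  | _ + 1, m => consMap m ∘ₗ blockMap (wordMap fun i => m i.succ) (m 0)

theorem wordMap_zero (m : Fin 0 → ℕ) (x : WordSpace) :
    wordMap m x = x [] • stdBasis m fun i => i.elim0 := rfl

theorem wordMap_succ {n : ℕ} (m : Fin (n + 1) → ℕ) (x : WordSpace) :
    wordMap m x = consMap m (blockMap (wordMap fun i => m i.succ) (m 0) x) := rfl

theorem wordMap_wordK {n : ℕ} (m : Fin n → ℕ) (e : ℤ) (x : WordSpace) :
    wordMap m (wordK e x) = tensorKPow m e (wordMap m x) := by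
  induction n generalizing x with
  | zero =>
    rw [wordMap_zero, wordMap_zero, wordK_apply_nil, map_smul, tensorKPow, stdBasis_apply,
      PiTensorProduct.map_tprod]
    congr 2
    funext i
    exact i.elim0
  | succ n ih =>
    rw [wordMap_succ, wordMap_succ, tensorKPow_consMap, blockMap_wordK _ (ih _)]

theorem wordMap_wordE {n : ℕ} (m : Fin n → ℕ) (x : WordSpace) :
    wordMap m (wordE x) = tailE m 0 (wordMap m x) := by
  induction n generalizing x with
  | zero => rw [wordMap_zero, wordE_apply_nil, zero_smul, tailE]; simp
  | succ n ih =>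
    rw [wordMap_succ, wordMap_succ, tailE_consMap, blockMap_wordE _ (ih _) (wordMap_wordK _ _)]

theorem wordMap_wordF {n : ℕ} (m : Fin n → ℕ) (x : WordSpace) :
    wordMap m (wordF x) = tailF m 0 (wordMap m x) := by
  induction n generalizing x with
  | zero => rw [wordMap_zero, wordF_apply_nil, zero_smul, tailF]; simp
  | succ n ih => rw [wordMap_succ, wordMap_succ, tailF_consMap, blockMap_wordF _ (ih _)]

theorem wordMap_wordY {n : ℕ} (m : Fin n → ℕ) (x : WordSpace) :
    wordMap m (wordY x) = opY m (wordMap m x) := by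
  simp only [wordY, opY, LinearMap.add_apply, LinearMap.smul_apply, Module.End.mul_apply, map_add,
    map_smul, wordMap_wordF, wordMap_wordK, wordMap_wordE]
  rfl

theorem blockVec_eq_smul (j : ℕ) (w : List Arrow) : ∃ k : Kq, ∃ a ≤ j,
    blockVec j w = k • unitVec j a := by
  induction j generalizing w with
  | zero => exact ⟨1, 0, le_rfl, (one_smul _ _).symm⟩
  | succ j ih =>
    obtain _ | ⟨s, w⟩ := w
    · exact ⟨0, 0, Nat.zero_le _, (zero_smul _ _).symm⟩
    · obtain ⟨k, a, ha, h⟩ := ih w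
      rw [blockVec, h, map_smul]
      cases s
      · exact ⟨k, a, by omega, by rw [blockStep, blockUp_unitVec ha]⟩
      · exact ⟨_, a + 1, by omega, by rw [blockStep, blockDown_unitVec _ ha, smul_smul]⟩

theorem wordMap_vec_eq_smul {n : ℕ} (m : Fin n → ℕ) (w : List Arrow) : ∃ k : Kq, ∃ l : Idx m,
    wordMap m (vec w) = k • stdBasis m l := by
  induction n generalizing w with
  | zero => exact ⟨_, _, wordMap_zero _ _⟩
  | succ n ih =>
    obtain ⟨k, a, ha, h⟩ := blockVec_eq_smul (m 0) w
    obtain ⟨k', l, h'⟩ := ih (fun i => m i.succ) (w.drop (m 0))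
    refine ⟨k * k', Fin.cons (α := fun i => Fin (m i + 1)) ⟨a, by omega⟩ l, ?_⟩
    rw [wordMap_succ, blockMap_vec, h, h', TensorProduct.smul_tmul_smul, map_smul,
      ← consMap_stdBasis]

theorem theta_psi_wordMap {n : ℕ} (m : Fin n → ℕ) (x : WordSpace) :
    theta m (psi m (wordMap m x)) = wordMap m (wordPsi x) := by
  induction x using Finsupp.induction_linear with
  | zero =>
    have : psi m 0 = 0 := by simpa using psi_smul m 0 0
    simp [this]
  | add x y hx hy => simp only [map_add, psi_add, hx, hy]
  | single w a =>
    have : Finsupp.single w a = a • vec w := by simp [vec]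
    rw [this, map_smul, psi_smul, map_smul, wordPsi_smul, map_smul]
    congr 1
    clear this
    induction n generalizing w with
    | zero =>
      rw [wordMap_zero, psi_smul, psi_stdBasis, wordMap_zero, wordPsi_apply_nil]
      simp [theta]
    | succ n ih =>
      obtain ⟨k, b, hb, h⟩ := blockVec_eq_smul (m 0) w
      obtain ⟨k', l, h'⟩ := wordMap_vec_eq_smul (fun i => m i.succ) (w.drop (m 0))
      have hpsi : psi m (wordMap m (vec w)) = consMap m (conj (m 0) (blockVec (m 0) w) ⊗ₜ
          psi _ (wordMap (fun i => m i.succ) (vec (w.drop (m 0))))) := by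
        have e := consMap_stdBasis m ⟨b, by omega⟩ l
        simp only at e
        rw [wordMap_succ, blockMap_vec, h, h', TensorProduct.smul_tmul_smul, map_smul, e, psi_smul,
          psi_stdBasis, conj_smul, conj_unitVec, psi_smul, psi_stdBasis,
          TensorProduct.smul_tmul_smul, map_smul, e, map_mul]
      rw [hpsi, theta_consMap, TensorProduct.map_tmul, ih, LinearMap.id_apply, wordMap_succ,
        blockMap_wordPsi _ (wordMap_wordF _)]

theorem upsilon_wordMap {n : ℕ} (m : Fin n → ℕ) (x : WordSpace) :
    upsilon m (wordMap m x) = wordMap m (wordUpsilon ((∑ i, m i) + 1) x) := by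
  have h : ∀ r, wordMap m ((wordE ^ r) x) = (tailE m 0 ^ r) (wordMap m x) := by
    intro r
    induction r with
    | zero => rfl
    | succ r ih =>
      rw [pow_succ', Module.End.mul_apply, wordMap_wordE, ih, pow_succ', Module.End.mul_apply]
  simp only [upsilon, wordUpsilon, LinearMap.sum_apply, map_sum, LinearMap.smul_apply, map_smul, h]

theorem psiIota_wordMap {n : ℕ} (m : Fin n → ℕ) {x : WordSpace} (hx : x ∈ degree (∑ i, m i)) :
    psiIota m (wordMap m x) = wordMap m (wordIota x) := by
  rw [psiIota, theta_psi_wordMap, upsilon_wordMap, wordUpsilon_wordPsi (Nat.lt_succ_self _) hx]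

/-! ### The dual canonical basis of the tensor product -/

/-- The word of the dual basis vector of `V_j` with index `a`. -/
def sortedBlock (j a : ℕ) : List Arrow := List.replicate (j - a) .up ++ List.replicate a .down

theorem length_sortedBlock {j a : ℕ} (h : a ≤ j) : (sortedBlock j a).length = j := by
  simp [sortedBlock, h]

theorem blockVec_replicate_down (a : ℕ) (w : List Arrow) :
    blockVec a (List.replicate a .down ++ w) = unitVec a a := by
  induction a with
  | zero => rfl
  | succ a ih =>
    rw [List.replicate_succ, List.cons_append, blockVec, ih, blockStep, blockDown_unitVec _ le_rfl]
    simp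

theorem blockVec_sortedBlock {j a : ℕ} (h : a ≤ j) (w : List Arrow) :
    blockVec j (sortedBlock j a ++ w) = unitVec j a := by
  obtain ⟨d, rfl⟩ := Nat.exists_eq_add_of_le h
  rw [sortedBlock, Nat.add_sub_cancel_left, List.append_assoc]
  clear h
  induction d with
  | zero => exact blockVec_replicate_down a w
  | succ d ih =>
    rw [List.replicate_succ, List.cons_append, ← Nat.add_assoc, blockVec, ih, blockStep,
      blockUp_unitVec (by omega)]

theorem depth_append (x y : List Arrow) :
    depth (x ++ y) = depth x + x.count .down * y.length + depth y := by
  induction x with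
  | nil => simp [depth]
  | cons s x ih =>
    cases s
    · simp [depth, ih]
    · simp [depth, ih]; ring

theorem depth_replicate_up (d : ℕ) (w : List Arrow) :
    depth (List.replicate d .up ++ w) = depth w := by
  induction d with
  | zero => rfl
  | succ d ih => simpa [List.replicate_succ, depth] using ih

/-- Up to a power of `q⁻¹`, which is nontrivial for words that are not sorted, `blockVec` is a vector
of the standard basis. -/
theorem exists_blockVec_eq (j : ℕ) (w : List Arrow) (h : j ≤ w.length) : ∃ a ≤ j, ∃ k : ℕ,
    blockVec j w = (q⁻¹) ^ k • unitVec j a ∧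
    depth w = depth (sortedBlock j a ++ w.drop j) + k ∧
    (k = 0 → w = sortedBlock j a ++ w.drop j) := by
  induction j generalizing w with
  | zero => exact ⟨0, le_rfl, 0, by simp [blockVec], by simp [sortedBlock], by simp [sortedBlock]⟩
  | succ j ih =>
    obtain _ | ⟨s, w⟩ := w
    · simp at h
    have hw : j ≤ w.length := by simpa using h
    obtain ⟨a, ha, k, h1, h2, h3⟩ := ih w hw
    cases s
    · refine ⟨a, by omega, k, ?_, ?_, fun hk => ?_⟩
      · rw [blockVec, h1, map_smul, blockStep, blockUp_unitVec ha]
      · rw [depth, h2, sortedBlock, sortedBlock, Nat.succ_sub ha, List.replicate_succ]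
        rfl
      · rw [sortedBlock, Nat.succ_sub ha, List.replicate_succ]
        exact congrArg _ (h3 hk)
    · refine ⟨a + 1, by omega, k + (j - a), ?_, ?_, fun hk => ?_⟩
      · rw [blockVec, h1, map_smul, blockStep, blockDown_unitVec _ ha, smul_smul, pow_add,
          neg_one_mul, zpow_neg, ← Nat.cast_sub ha, zpow_natCast, ← inv_pow]
      · rw [depth, h2, sortedBlock, sortedBlock, List.append_assoc, List.append_assoc,
          depth_replicate_up, depth_replicate_up, List.replicate_succ, List.cons_append, depth,
          List.length_append, List.length_replicate, List.drop_succ_cons, List.length_drop]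
        omega
      · obtain rfl : a = j := by omega
        have h4 := h3 (by omega)
        rw [List.drop_succ_cons, sortedBlock, Nat.sub_self, List.replicate_zero, List.nil_append,
          List.replicate_succ, List.cons_append]
        rw [sortedBlock, Nat.sub_self, List.replicate_zero, List.nil_append] at h4
        exact congrArg _ h4

section Words

theorem arrows_succ {n : ℕ} (m : Fin (n + 1) → ℕ) (a : Idx m) : arrows m a =
    sortedBlock (m 0) (a 0) ++ arrows (fun i => m i.succ) fun i => a i.succ := by
  simp [arrows, List.finRange_succ, List.flatMap_cons, List.flatMap_map, sortedBlock]

theorem length_arrows {n : ℕ} (m : Fin n → ℕ) (a : Idx m) : (arrows m a).length = ∑ i, m i := by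
  induction n with
  | zero => simp [arrows]
  | succ n ih =>
    rw [arrows_succ, List.length_append, length_sortedBlock (by omega), ih, Fin.sum_univ_succ]

theorem wordMap_arrows {n : ℕ} (m : Fin n → ℕ) (a : Idx m) :
    wordMap m (vec (arrows m a)) = stdBasis m a := by
  induction n with
  | zero =>
    rw [wordMap_zero]
    have : a = fun i => i.elim0 := funext fun i => i.elim0
    rw [← this]
    simp [arrows, vec]
  | succ n ih =>
    rw [wordMap_succ, blockMap_vec, arrows_succ, blockVec_sortedBlock (by omega),
      List.drop_left' (length_sortedBlock (by omega)), ih, consMap_stdBasis]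
    congr 1
    funext i
    refine Fin.cases ?_ (fun i => ?_) i <;> simp

theorem arrows_injective {n : ℕ} (m : Fin n → ℕ) : Function.Injective (arrows m) := by
  intro a b h
  apply (stdBasis m).injective
  rw [← wordMap_arrows, h, wordMap_arrows]

/-- Up to a power of `q⁻¹`, which is nontrivial for words that do not belong to an index, the image
of a word is a vector of the standard basis. -/
theorem exists_wordMap_eq {n : ℕ} (m : Fin n → ℕ) (w : List Arrow) (h : w.length = ∑ i, m i) :
    ∃ l : Idx m, ∃ k : ℕ, wordMap m (vec w) = (q⁻¹) ^ k • stdBasis m l ∧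
      depth w = depth (arrows m l) + k ∧ (k = 0 → w = arrows m l) := by
  induction n generalizing w with
  | zero =>
    obtain rfl : w = [] := by simpa using h
    exact ⟨fun i => i.elim0, 0, by simp [wordMap_zero, vec], by simp [arrows], by simp [arrows]⟩
  | succ n ih =>
    rw [Fin.sum_univ_succ] at h
    obtain ⟨a, ha, k, h1, h2, h3⟩ := exists_blockVec_eq (m 0) w (by omega)
    have hd : (w.drop (m 0)).length = ∑ i : Fin n, m i.succ := by rw [List.length_drop]; omega
    obtain ⟨l, k', h4, h5, h6⟩ := ih (fun i => m i.succ) (w.drop (m 0)) hd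
    refine ⟨Fin.cons (α := fun i => Fin (m i + 1)) ⟨a, by omega⟩ l, k + k', ?_, ?_, fun hk => ?_⟩
    · rw [wordMap_succ, blockMap_vec, h1, h4, TensorProduct.smul_tmul_smul, map_smul,
        ← consMap_stdBasis, pow_add]
    · have e1 := depth_append (sortedBlock (m 0) a) (w.drop (m 0))
      have e2 := depth_append (sortedBlock (m 0) a) (arrows (fun i => m i.succ) l)
      rw [hd] at e1
      rw [length_arrows] at e2
      rw [arrows_succ, h2]
      change _ = depth (sortedBlock (m 0) a ++ arrows (fun i => m i.succ) l) + (k + k')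
      omega
    · rw [arrows_succ]
      simp only [Fin.cons_zero, Fin.cons_succ]
      rw [← h6 (by omega), ← h3 (by omega)]

end Words

section Basis

variable {n : ℕ} (m : Fin n → ℕ)

/-- The images of lower terms have coordinates in `q⁻¹ ℤ[q⁻¹]`, and only at smaller depths. -/
theorem repr_wordMap_of_mem_lowerTerms {w : List Arrow} (hw : w.length = ∑ i, m i) {x : WordSpace}
    (hx : x ∈ lowerTerms w) (l : Idx m) : (stdBasis m).repr (wordMap m x) l ∈ smallCoeff ∧
      (depth w ≤ depth (arrows m l) → (stdBasis m).repr (wordMap m x) l = 0) := by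
  induction hx using AddSubgroup.closure_induction with
  | mem x hx =>
    obtain ⟨a, ha, v, hl, hd, rfl⟩ := hx
    obtain ⟨l', k, h1, h2, -⟩ := exists_wordMap_eq m v (hl.trans hw)
    rw [map_smul, h1, smul_smul, map_smul, Module.Basis.repr_self, Finsupp.smul_single, smul_eq_mul,
      mul_one, Finsupp.single_apply]
    by_cases h : l' = l
    · rw [if_pos h]
      subst h
      refine ⟨?_, fun h' => by omega⟩
      rw [mul_comm]
      exact inv_q_pow_mul_mem_smallCoeff ha k
    · rw [if_neg h]
      exact ⟨zero_mem _, fun _ => rfl⟩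
  | zero => simp [zero_mem]
  | add x y _ _ hx hy =>
    rw [map_add, map_add, Finsupp.add_apply]
    exact ⟨add_mem hx.1 hy.1, fun h => by rw [hx.2 h, hy.2 h, add_zero]⟩
  | neg x _ hx =>
    rw [map_neg, map_neg, Finsupp.neg_apply]
    exact ⟨neg_mem hx.1, fun h => by rw [hx.2 h, neg_zero]⟩

theorem lowerTerms_le_degree {w : List Arrow} {x : WordSpace} (hx : x ∈ lowerTerms w) :
    x ∈ degree w.length := by
  induction hx using AddSubgroup.closure_induction with
  | mem x hx =>
    obtain ⟨a, -, v, hl, -, rfl⟩ := hx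
    rw [← hl]
    exact Submodule.smul_mem _ _ (vec_mem_degree v)
  | zero => exact zero_mem _
  | add x y _ _ hx hy => exact add_mem hx hy
  | neg x _ hx => exact neg_mem hx

theorem dualVec_mem_degree (w : List Arrow) : dualVec w ∈ degree w.length := by
  have := add_mem (lowerTerms_le_degree (hasLead_dualVec w)) (vec_mem_degree w)
  rwa [sub_add_cancel] at this

theorem psiIota_dualVec {w : List Arrow} (hw : w.length = ∑ i, m i) :
    psiIota m (wordMap m (dualVec w)) = wordMap m (dualVec w) := by
  rw [psiIota_wordMap m (hw ▸ dualVec_mem_degree w), wordIota_dualVec]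

/-- The dual canonical basis elements. -/
noncomputable def dualElt (a : Idx m) : T m := wordMap m (dualVec (arrows m a))

/-- The dual canonical basis is unitriangular over `q⁻¹ ℤ[q⁻¹]` with respect to `depth`. -/
theorem repr_dualElt_sub (a l : Idx m) :
    (stdBasis m).repr (dualElt m a - stdBasis m a) l ∈ smallCoeff ∧
      (depth (arrows m a) ≤ depth (arrows m l) →
        (stdBasis m).repr (dualElt m a - stdBasis m a) l = 0) := by
  rw [dualElt, ← wordMap_arrows m a, ← map_sub]
  exact repr_wordMap_of_mem_lowerTerms m (length_arrows m a) (hasLead_dualVec _) l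

theorem repr_dualElt_of_ne {a l : Idx m} (h : depth (arrows m a) ≤ depth (arrows m l))
    (hne : a ≠ l) : (stdBasis m).repr (dualElt m a) l = 0 := by
  have := (repr_dualElt_sub m a l).2 h
  rwa [map_sub, Finsupp.sub_apply, Module.Basis.repr_self, Finsupp.single_apply, if_neg hne,
    sub_zero] at this

theorem repr_dualElt_self (a : Idx m) : (stdBasis m).repr (dualElt m a) a = 1 := by
  have := (repr_dualElt_sub m a a).2 le_rfl
  rwa [map_sub, Finsupp.sub_apply, Module.Basis.repr_self, Finsupp.single_eq_same,
    sub_eq_zero] at this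

/-- A nonzero combination of the dual canonical basis elements shares a nonzero coefficient with its
expansion in the standard basis. -/
theorem exists_repr_sum_dualElt {c : Idx m → Kq} (hc : c ≠ 0) :
    ∃ a, c a ≠ 0 ∧ (stdBasis m).repr (∑ a, c a • dualElt m a) a = c a := by
  classical
  obtain ⟨a₀, ha₀⟩ := Function.ne_iff.1 hc
  obtain ⟨a, ha, hmax⟩ := (Finset.univ.filter fun a => c a ≠ 0).exists_max_image
    (fun a => depth (arrows m a)) ⟨a₀, by simpa using ha₀⟩
  refine ⟨a, (Finset.mem_filter.1 ha).2, ?_⟩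
  rw [map_sum, Finsupp.finsetSum_apply, Finset.sum_eq_single a]
  · rw [map_smul, Finsupp.smul_apply, repr_dualElt_self, smul_eq_mul, mul_one]
  · intro b _ hb
    rw [map_smul, Finsupp.smul_apply]
    by_cases h : c b = 0
    · rw [h, zero_smul]
    · rw [repr_dualElt_of_ne m (hmax b (by simpa using h)) hb, smul_zero]
  · simp

theorem linearIndependent_dualElt : LinearIndependent Kq (dualElt m) := by
  rw [Fintype.linearIndependent_iff]
  intro c hc
  by_contra! h
  obtain ⟨a, ha, h'⟩ := exists_repr_sum_dualElt m (c := c) (fun h0 => by simp [h0] at h)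
  rw [hc, map_zero, Finsupp.zero_apply] at h'
  exact ha h'.symm

/-- The dual canonical basis. -/
noncomputable def dualBasis : Module.Basis (Idx m) Kq (T m) :=
  basisOfLinearIndependentOfCardEqFinrank (linearIndependent_dualElt m)
    (Module.finrank_eq_card_basis (stdBasis m)).symm

theorem dualBasis_apply (a : Idx m) : dualBasis m a = dualElt m a := by
  simp [dualBasis]

theorem psiIota_add (x y : T m) : psiIota m (x + y) = psiIota m x + psiIota m y := by
  simp only [psiIota, psi_add, map_add]

theorem psiIota_smul (a : Kq) (x : T m) : psiIota m (a • x) = bar a • psiIota m x := by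
  simp only [psiIota, psi_smul, map_smul]

/-- An invariant element without constant coordinates vanishes. -/
theorem eq_zero_of_psiIota_eq {x : T m} (h : psiIota m x = x)
    (hs : ∀ l, (stdBasis m).repr x l ∈ smallCoeff) : x = 0 := by
  -- invariance makes all coordinates in the dual canonical basis bar invariant
  have hsum : ∀ s : Finset (Idx m), ∀ c : Idx m → Kq,
      psiIota m (∑ a ∈ s, c a • dualElt m a) = ∑ a ∈ s, bar (c a) • dualElt m a := by
    intro s c
    induction s using Finset.induction_on with
    | empty => simpa using psiIota_smul m 0 0
    | insert a s ha ih =>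
      rw [Finset.sum_insert ha, Finset.sum_insert ha, psiIota_add, psiIota_smul, ih, dualElt,
        psiIota_dualVec m (length_arrows m a)]
  obtain ⟨c, hx⟩ : ∃ c : Idx m → Kq, x = ∑ a, c a • dualElt m a := by
    refine ⟨(dualBasis m).repr x, ?_⟩
    conv_lhs => rw [← (dualBasis m).sum_repr x]
    simp only [dualBasis_apply]
  have hbar : ∀ a, bar (c a) = c a := by
    intro a
    have h1 := h
    rw [hx, hsum] at h1
    have h2 := congrArg (fun x => ⇑((dualBasis m).repr x)) h1
    simp only [← dualBasis_apply, Module.Basis.repr_sum_self] at h2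
    exact congrFun h2 a
  by_cases h0 : c = 0
  · rw [hx, h0]; simp
  · obtain ⟨a, ha, h'⟩ := exists_repr_sum_dualElt m h0
    rw [← hx] at h'
    exact absurd (eq_zero_of_mem_smallCoeff (h' ▸ hs a) (hbar a)) ha

/-- Existence and uniqueness of the dual canonical basis elements. -/
theorem isDualCanonical_iff (a : Idx m) (x : T m) : IsDualCanonical m a x ↔ x = dualElt m a := by
  constructor
  · rintro ⟨h1, h2⟩
    rw [← sub_eq_zero]
    refine eq_zero_of_psiIota_eq m ?_ fun l => ?_
    · have : psiIota m (x - dualElt m a) = psiIota m x - psiIota m (dualElt m a) :=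
        map_sub (AddMonoidHom.mk' (psiIota m) (psiIota_add m)) _ _
      rw [this, h1, dualElt, psiIota_dualVec m (length_arrows m a)]
    · rw [← sub_sub_sub_cancel_right _ _ (stdBasis m a), map_sub, Finsupp.sub_apply]
      exact sub_mem (mem_smallCoeff.2 (h2 l)) (repr_dualElt_sub m a l).1
  · rintro rfl
    exact ⟨psiIota_dualVec m (length_arrows m a),
      fun l => mem_smallCoeff.1 (repr_dualElt_sub m a l).1⟩

/-- If a word does not belong to an index, its own image has a coefficient in `q⁻¹ ℤ[q⁻¹]`, so that
the invariant image of its dual canonical basis element has no room for a leading term. -/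
theorem wordMap_dualVec_eq_zero {w : List Arrow} (hw : w.length = ∑ i, m i)
    (h : ∀ a, w ≠ arrows m a) : wordMap m (dualVec w) = 0 := by
  refine eq_zero_of_psiIota_eq m (psiIota_dualVec m hw) fun l => ?_
  obtain ⟨l', k, h1, -, h3⟩ := exists_wordMap_eq m w hw
  have h4 := (repr_wordMap_of_mem_lowerTerms m hw (hasLead_dualVec w) l).1
  have h5 : wordMap m (dualVec w) = wordMap m (dualVec w - vec w) + wordMap m (vec w) := by
    rw [← map_add, sub_add_cancel]
  rw [h5, map_add, Finsupp.add_apply, h1, map_smul, Module.Basis.repr_self, Finsupp.smul_apply,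
    Finsupp.single_apply]
  refine add_mem h4 ?_
  split_ifs
  · rw [smul_eq_mul, mul_one]
    exact inv_q_pow_mem_smallCoeff fun hk => h l' (h3 hk)
  · rw [smul_zero]; exact zero_mem _

/-! ### The eigenvector -/

theorem wordSum_ite {M : Type*} [AddCommMonoid M] (f : List Arrow → M) (w : List Arrow) :
    wordSum w.length (fun v => if v = w then f v else 0) = f w := by
  induction w generalizing f with
  | nil => simp [wordSum]
  | cons s w ih =>
    rw [List.length_cons, wordSum]
    cases s
    · have := ih fun v => f (.up :: v)
      simpa [wordSum_zero] using this
    · have := ih fun v => f (.down :: v)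
      simpa [wordSum_zero] using this

theorem repr_wordMap_dualVec {w : List Arrow} (hw : w.length = ∑ i, m i) (a : Idx m) :
    (dualBasis m).repr (wordMap m (dualVec w)) a = if w = arrows m a then 1 else 0 := by
  by_cases h : ∃ a', w = arrows m a'
  · obtain ⟨a', rfl⟩ := h
    have e : wordMap m (dualVec (arrows m a')) = dualBasis m a' := (dualBasis_apply m a').symm
    rw [e, Module.Basis.repr_self, Finsupp.single_apply]
    simp only [(arrows_injective m).eq_iff]
  · rw [wordMap_dualVec_eq_zero m hw fun a' h' => h ⟨a', h'⟩, map_zero, if_neg fun h' => h ⟨a, h'⟩]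
    rfl

/-- Of the expansion of the eigenvector in the tensor power of `V_1`, only the words that belong to
an index survive. -/
theorem repr_wordMap_eigenVec (a : Idx m) :
    (dualBasis m).repr (wordMap m (eigenVec (∑ i, m i))) a = weight 0 (arrows m a) := by
  rw [← wordSum_weight_smul_dualVec]
  have e : ∀ x : WordSpace, (dualBasis m).repr (wordMap m x) a =
      (Finsupp.lapply a ∘ₗ (dualBasis m).repr.toLinearMap ∘ₗ wordMap m) x := fun x => rfl
  rw [e, map_wordSum]
  have h : ∀ w : List Arrow, w.length = ∑ i, m i →
      (Finsupp.lapply a ∘ₗ (dualBasis m).repr.toLinearMap ∘ₗ wordMap m)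
        (weight 0 w • dualVec w) = if w = arrows m a then weight 0 w else 0 := by
    intro w hw
    rw [map_smul, ← e, repr_wordMap_dualVec m hw]
    simp
  rw [wordSum_congr h, ← length_arrows m a]
  exact wordSum_ite _ _

theorem map_wordMap_degree : (degree (∑ i, m i)).map (wordMap m) = ⊤ := by
  rw [eq_top_iff, ← (stdBasis m).span_eq, Submodule.span_le]
  rintro _ ⟨a, rfl⟩
  refine ⟨vec (arrows m a), ?_, wordMap_arrows m a⟩
  have := vec_mem_degree (arrows m a)
  rwa [length_arrows] at this

/-- The eigenspace for `[L + 1]` is a line, because `Y` is diagonalizable with only one eigenvector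
for this eigenvalue. -/
theorem eigenspace_opY : (opY m).eigenspace (qint ((∑ i, (m i : ℤ)) + 1)) =
    Submodule.span Kq {wordMap m (eigenVec (∑ i, m i))} := by
  have hL : (∑ i, (m i : ℤ)) = ((∑ i, m i : ℕ) : ℤ) := by push_cast; rfl
  rw [hL]
  set L := ∑ i, m i with hLdef
  have hmem : wordMap m (eigenVec L) ∈ (opY m).eigenspace (qint (L + 1)) := by
    rw [Module.End.mem_eigenspace_iff, ← wordMap_wordY, wordY_eigenVec, map_smul]
  refine le_antisymm (fun x hx => ?_) ((Submodule.span_singleton_le_iff_mem _ _).2 hmem)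
  have h1 : (eigenSum L).map (wordMap m) ≤ Submodule.span Kq {wordMap m (eigenVec L)} ⊔
      ⨆ μ : Kq, ⨆ _ : μ ≠ qint (L + 1), (opY m).eigenspace μ := by
    rw [eigenSum, Submodule.map_sup, Submodule.map_span, Set.image_singleton]
    refine sup_le_sup le_rfl ?_
    simp only [Submodule.map_iSup]
    refine iSup₂_le fun l hl => ?_
    rintro _ ⟨y, hy, rfl⟩
    refine Submodule.mem_iSup_of_mem (qint l) (Submodule.mem_iSup_of_mem
      (qint_injective.ne hl.ne) ?_)
    rw [Module.End.mem_eigenspace_iff, ← wordMap_wordY, Module.End.mem_eigenspace_iff.1 hy,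
      map_smul]
  -- `x` is the sum of a multiple of the eigenvector and of eigenvectors for other eigenvalues
  have hx' : x ∈ (degree L).map (wordMap m) := by rw [map_wordMap_degree]; trivial
  obtain ⟨y, hy, z, hz, rfl⟩ := Submodule.mem_sup.1
    (h1 (Submodule.map_mono (degree_le_eigenSum L) hx'))
  have hy' : y ∈ (opY m).eigenspace (qint (L + 1)) :=
    (Submodule.span_singleton_le_iff_mem _ _).2 hmem hy
  have hz' : z ∈ (opY m).eigenspace (qint (L + 1)) := by
    have := sub_mem hx hy'
    rwa [add_sub_cancel_left] at this
  have hz0 := (Submodule.disjoint_def.1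
    ((Module.End.eigenspaces_iSupIndep (opY m)) (qint (L + 1)))) z hz' hz
  rwa [hz0, add_zero]

theorem weight_replicate_down (N : ℕ) : weight 0 (List.replicate N .down) = 1 := by
  induction N with
  | zero => simp [weight, shape, objects, shapeWeight, coreArcs, Forest.size, evenFact, Forest.hook,
      coreHook, coreWeight]
  | succ N ih => rw [List.replicate_succ, weight_down, ih]

theorem arrows_lowest {n : ℕ} (m : Fin n → ℕ) :
    arrows m (lowest m) = List.replicate (∑ i, m i) .down := by
  induction n with
  | zero => simp [arrows]
  | succ n ih =>
    have := ih fun i => m i.succ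
    rw [arrows_succ, Fin.sum_univ_succ, List.replicate_add, ← this]
    simp [sortedBlock, lowest]
    rfl

end Basis

/-! ### The diagram of a word -/

/-- The arcs of a system of arcs that starts at the position `p`. -/
def arcsAt : ℕ → Forest → Finset (ℕ × ℕ)
  | _, .nil => ∅
  | p, .node a b => insert (p, p + 2 * a.size + 1)
      (arcsAt (p + 1) a ∪ arcsAt (p + 2 * a.size + 2) b)

/-- The arcs of a core that starts at the position `p`. -/
def coreArcsAt : ℕ → List Forest → Finset (ℕ × ℕ)
  | _, [] => ∅
  | p, u :: c => arcsAt (p + 1) u ∪ coreArcsAt (p + 2 * u.size + 1) c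

/-- The positions of the down arrows of a core that starts at the position `p`. -/
def coreDowns : ℕ → List Forest → List ℕ
  | _, [] => []
  | p, u :: c => p :: coreDowns (p + 2 * u.size + 1) c

/-- The arcs to the left of the last up arrow, if the word starts at the position `p`. -/
def headArcs : ℕ → List Forest → Finset (ℕ × ℕ)
  | _, [] => ∅
  | p, v :: U => arcsAt p v ∪ headArcs (p + 2 * v.size + 1) U

/-- The up arrows, if the word starts at the position `p`. -/
def headUps : ℕ → List Forest → Finset ℕ
  | _, [] => ∅
  | p, v :: U => insert (p + 2 * v.size) (headUps (p + 2 * v.size + 1) U)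

/-- The number of arrows up to the last up arrow. -/
def headLength : List Forest → ℕ
  | [] => 0
  | v :: U => 2 * v.size + 1 + headLength U

theorem joinArcs_forest (p : ℕ) (ds : List ℕ) (u : Forest) (w : List Arrow) :
    joinArcs p ds (u.toList ++ w) = ⟨arcsAt p u ∪ (joinArcs (p + 2 * u.size) ds w).arcs,
      (joinArcs (p + 2 * u.size) ds w).ups, (joinArcs (p + 2 * u.size) ds w).downs⟩ := by
  induction u generalizing p ds w with
  | nil => simp [Forest.toList, arcsAt, Forest.size]
  | node a b iha ihb =>
    simp only [Forest.toList, List.cons_append, List.append_assoc, joinArcs, iha, ihb, arcsAt,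
      Forest.size]
    rw [show p + 1 + 2 * a.size + 1 + 2 * b.size = p + 2 * (a.size + b.size + 1) by ring,
      show p + 1 + 2 * a.size = p + 2 * a.size + 1 by ring]
    simp only [Finset.insert_union, Finset.union_insert, Finset.union_assoc]

theorem joinArcs_coreList (p : ℕ) (ds : List ℕ) (c : List Forest) : joinArcs p ds (coreList c) =
    ⟨coreArcsAt p c, ∅, (coreDowns p c).reverse ++ ds⟩ := by
  induction c generalizing p ds with
  | nil => rfl
  | cons u c ih =>
    rw [coreList, joinArcs, joinArcs_forest, ih, coreArcsAt, coreDowns,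
      show p + 1 + 2 * u.size = p + 2 * u.size + 1 by ring]
    simp

/-- The outcome of joining arrows for a word of given shape. -/
theorem joinArcs_wordOf (p : ℕ) (U : List Forest) (u : Forest) (c : List Forest) :
    joinArcs p [] (wordOf U u c) =
      ⟨headArcs p U ∪ (arcsAt (p + headLength U) u ∪
          coreArcsAt (p + headLength U + 2 * u.size) c), headUps p U,
        (coreDowns (p + headLength U + 2 * u.size) c).reverse⟩ := by
  induction U generalizing p with
  | nil => simp [wordOf, joinArcs_forest, joinArcs_coreList, headArcs, headUps, headLength]
  | cons v U ih =>
    rw [wordOf, joinArcs_forest, joinArcs, ih, headArcs, headUps, headLength,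
      show p + 2 * v.size + 1 + headLength U = p + (2 * v.size + 1 + headLength U) by ring]
    simp only [Finset.union_assoc]

theorem joinDashed_append {l : List ℕ} (h : Even l.length) (l' : List ℕ) :
    joinDashed (l ++ l') = joinDashed l ∪ joinDashed l' := by
  induction l using List.twoStepInduction with
  | nil => simp [joinDashed]
  | singleton x => simp at h
  | cons_cons x y l ih _ =>
    have h' : Even l.length := by simpa [Nat.even_add_one] using h
    simp only [List.cons_append, joinDashed, ih h', Finset.insert_union]

theorem leftOver_append {l : List ℕ} (h : Even l.length) (l' : List ℕ) :
    leftOver (l ++ l') = leftOver l' := by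
  induction l using List.twoStepInduction with
  | nil => rfl
  | singleton x => simp at h
  | cons_cons x y l ih _ =>
    have h' : Even l.length := by simpa [Nat.even_add_one] using h
    simp only [List.cons_append, leftOver, ih h']

/-- The dashed arcs of a core of odd length that starts at the position `p`. -/
def dashedAt : ℕ → List Forest → Finset (ℕ × ℕ)
  | p, x :: y :: c => insert (p, p + 2 * x.size + 1) (dashedAt (p + 2 * x.size + 2 * y.size + 2) c)
  | _, _ => ∅

/-- The position of the star of a core of odd length that starts at the position `p`. -/
def starAt : ℕ → List Forest → ℕ
  | p, x :: y :: c => starAt (p + 2 * x.size + 2 * y.size + 2) c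
  | p, _ => p

/-- The arcs to the left of the star of a core of odd length that starts at the position `p`. -/
def midArcsAt : ℕ → List Forest → Finset (ℕ × ℕ)
  | p, x :: y :: c => arcsAt (p + 1) x ∪ (arcsAt (p + 2 * x.size + 2) y ∪
      midArcsAt (p + 2 * x.size + 2 * y.size + 2) c)
  | _, _ => ∅

/-- The system of arcs to the right of the star of a core of odd length. -/
def lastForest : List Forest → Forest
  | _ :: _ :: c => lastForest c
  | [z] => z
  | [] => .nil

/-- The star and the dashed arcs of a core of odd length. -/
theorem coreDowns_reverse_of_odd (p : ℕ) (c : List Forest) (h : Odd c.length) :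
    ∃ l, (coreDowns p c).reverse = starAt p c :: l ∧ Even l.length ∧
      joinDashed l = dashedAt p c ∧ leftOver l = none := by
  induction c using List.twoStepInduction generalizing p with
  | nil => simp at h
  | singleton z => exact ⟨[], rfl, by simp, rfl, rfl⟩
  | cons_cons x y c ih _ =>
    have h' : Odd c.length := by simpa [Nat.odd_add_one, Nat.not_odd_iff_even] using h
    obtain ⟨l, h1, h2, h3, h4⟩ := ih (p + 2 * x.size + 2 * y.size + 2) h'
    refine ⟨l ++ [p + 2 * x.size + 1, p], ?_, ?_, ?_, ?_⟩
    · rw [coreDowns, coreDowns, List.reverse_cons, List.reverse_cons,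
        show p + 2 * x.size + 1 + 2 * y.size + 1 = p + 2 * x.size + 2 * y.size + 2 by ring, h1]
      simp [starAt]
    · simpa [Nat.even_add_one] using h2
    · rw [joinDashed_append h2, h3, dashedAt, Finset.union_comm]
      rfl
    · rw [leftOver_append h2]; rfl

/-- The arcs of a core of odd length to the left and to the right of the star. -/
theorem coreArcsAt_of_odd (p : ℕ) (c : List Forest) (h : Odd c.length) :
    coreArcsAt p c = midArcsAt p c ∪ arcsAt (starAt p c + 1) (lastForest c) := by
  induction c using List.twoStepInduction generalizing p with
  | nil => simp at h
  | singleton z => simp [coreArcsAt, midArcsAt, starAt, lastForest]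
  | cons_cons x y c ih _ =>
    have h' : Odd c.length := by simpa [Nat.odd_add_one, Nat.not_odd_iff_even] using h
    rw [coreArcsAt, coreArcsAt,
      show p + 2 * x.size + 1 + 2 * y.size + 1 = p + 2 * x.size + 2 * y.size + 2 by ring, ih _ h',
      midArcsAt, starAt, lastForest]
    simp only [Finset.union_assoc]

/-! ### Positions of arcs -/

/-- All arcs lie at the positions from `a` to `b - 1`. -/
def Within (a b : ℕ) (G : Finset (ℕ × ℕ)) : Prop := ∀ A ∈ G, a ≤ A.1 ∧ A.1 < A.2 ∧ A.2 < b

theorem Within.mono {a b a' b' : ℕ} {G : Finset (ℕ × ℕ)} (h : Within a b G) (ha : a' ≤ a)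
    (hb : b ≤ b') : Within a' b' G := fun A hA => by
  have := h A hA
  omega

theorem Within.union {a b : ℕ} {G G' : Finset (ℕ × ℕ)} (h : Within a b G) (h' : Within a b G') :
    Within a b (G ∪ G') := fun A hA => (Finset.mem_union.1 hA).elim (h A) (h' A)

theorem Within.disjoint {a b a' b' : ℕ} {G G' : Finset (ℕ × ℕ)} (h : Within a b G)
    (h' : Within a' b' G') (hb : b ≤ a') : Disjoint G G' :=
  Finset.disjoint_left.2 fun A hA hA' => by
    have := h A hA
    have := h' A hA'
    omega

theorem within_empty (a b : ℕ) : Within a b ∅ := fun A hA => by simp at hA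

theorem within_arcsAt (p : ℕ) (u : Forest) : Within p (p + 2 * u.size) (arcsAt p u) := by
  induction u generalizing p with
  | nil => exact within_empty _ _
  | node a b iha ihb =>
    intro A hA
    simp only [Forest.size]
    rw [arcsAt, Finset.mem_insert, Finset.mem_union] at hA
    rcases hA with rfl | hA | hA
    · dsimp only; omega
    · have := iha _ A hA; omega
    · have := ihb _ A hA; omega

theorem prod_arcsAt_node {M : Type*} [CommMonoid M] (p : ℕ) (a b : Forest) (f : ℕ × ℕ → M) :
    ∏ A ∈ arcsAt p (.node a b), f A = f (p, p + 2 * a.size + 1) *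
      ((∏ A ∈ arcsAt (p + 1) a, f A) * ∏ A ∈ arcsAt (p + 2 * a.size + 2) b, f A) := by
  have ha := within_arcsAt (p + 1) a
  have hb := within_arcsAt (p + 2 * a.size + 2) b
  rw [arcsAt, Finset.prod_insert, Finset.prod_union (ha.disjoint hb (by omega))]
  intro h
  rcases Finset.mem_union.1 h with h | h
  · have := (ha _ h).1; dsimp only at this; omega
  · have := (hb _ h).1; dsimp only at this; omega

theorem card_arcsAt (p : ℕ) (u : Forest) : (arcsAt p u).card = u.size := by
  induction u generalizing p with
  | nil => rfl
  | node a b iha ihb =>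
    -- cardinalities are products in `Multiplicative ℕ`
    have h := prod_arcsAt_node (M := Multiplicative ℕ) p a b fun _ => Multiplicative.ofAdd 1
    have e : ∀ s : Finset (ℕ × ℕ), ∏ _A ∈ s, Multiplicative.ofAdd 1 =
      Multiplicative.ofAdd s.card := by intro s; simp [← ofAdd_nsmul]
    rw [e, e, e, iha, ihb, ← ofAdd_add, ← ofAdd_add] at h
    rw [Multiplicative.ofAdd.injective h, Forest.size]
    ring

theorem within_midArcsAt (p : ℕ) (c : List Forest) :
    Within (p + 1) (starAt p c) (midArcsAt p c) ∧ p ≤ starAt p c := by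
  induction c using List.twoStepInduction generalizing p with
  | nil => exact ⟨within_empty _ _, le_rfl⟩
  | singleton z => exact ⟨within_empty _ _, le_rfl⟩
  | cons_cons x y c ih _ =>
    obtain ⟨h1, h2⟩ := ih (p + 2 * x.size + 2 * y.size + 2)
    rw [midArcsAt, starAt]
    refine ⟨((within_arcsAt _ x).mono le_rfl (by omega)).union
      (((within_arcsAt _ y).mono (by omega) (by omega)).union (h1.mono (by omega) le_rfl)),
      by omega⟩

theorem within_dashedAt (p : ℕ) (c : List Forest) :
    Within p (starAt p c) (dashedAt p c) := by
  induction c using List.twoStepInduction generalizing p with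
  | nil => exact within_empty _ _
  | singleton z => exact within_empty _ _
  | cons_cons x y c ih _ =>
    have h2 := (within_midArcsAt (p + 2 * x.size + 2 * y.size + 2) c).2
    rw [dashedAt, starAt]
    intro A hA
    rcases Finset.mem_insert.1 hA with rfl | hA
    · dsimp only; omega
    · have := ih _ A hA; omega

theorem within_headArcs (p : ℕ) (U : List Forest) :
    Within p (p + headLength U) (headArcs p U) := by
  induction U generalizing p with
  | nil => exact within_empty _ _
  | cons v U ih =>
    rw [headArcs, headLength]
    exact ((within_arcsAt p v).mono le_rfl (by omega)).union
      ((ih (p + 2 * v.size + 1)).mono (by omega) (by omega))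

theorem coreLength_of_odd (p : ℕ) (c : List Forest) (h : Odd c.length) :
    p + coreLength c = starAt p c + 1 + 2 * (lastForest c).size := by
  induction c using List.twoStepInduction generalizing p with
  | nil => simp at h
  | singleton z => simp [coreLength, starAt, lastForest]; ring
  | cons_cons x y c ih _ =>
    have h' : Odd c.length := by simpa [Nat.odd_add_one, Nat.not_odd_iff_even] using h
    rw [starAt, lastForest, ← ih _ h', coreLength, coreLength]
    ring

/-! ### The product of the inverse sizes -/

theorem prod_arcSize_arcsAt (p : ℕ) (u : Forest) :
    ∏ A ∈ arcsAt p u, (qint (arcSize A))⁻¹ = u.hook := by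
  induction u generalizing p with
  | nil => rfl
  | node a b iha ihb =>
    have e : arcSize (p, p + 2 * a.size + 1) = a.size + 1 := by simp only [arcSize]; omega
    rw [prod_arcsAt_node, iha, ihb, Forest.hook, e]
    push_cast
    rw [div_eq_inv_mul]

theorem within_coreArcsAt (p : ℕ) (c : List Forest) :
    Within p (p + coreLength c) (coreArcsAt p c) := by
  induction c generalizing p with
  | nil => exact within_empty _ _
  | cons u c ih =>
    rw [coreArcsAt, coreLength]
    exact ((within_arcsAt _ u).mono (by omega) (by omega)).union ((ih _).mono (by omega) (by omega))

theorem prod_coreArcsAt_cons {M : Type*} [CommMonoid M] (p : ℕ) (u : Forest) (c : List Forest)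
    (f : ℕ × ℕ → M) : ∏ A ∈ coreArcsAt p (u :: c), f A =
      (∏ A ∈ arcsAt (p + 1) u, f A) * ∏ A ∈ coreArcsAt (p + 2 * u.size + 1) c, f A := by
  rw [coreArcsAt, Finset.prod_union ((within_arcsAt _ u).disjoint (within_coreArcsAt _ c) (by omega))]

theorem prod_headArcs_cons {M : Type*} [CommMonoid M] (p : ℕ) (v : Forest) (U : List Forest)
    (f : ℕ × ℕ → M) : ∏ A ∈ headArcs p (v :: U), f A =
      (∏ A ∈ arcsAt p v, f A) * ∏ A ∈ headArcs (p + 2 * v.size + 1) U, f A := by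
  rw [headArcs, Finset.prod_union ((within_arcsAt _ v).disjoint (within_headArcs _ U) (by omega))]

theorem prod_arcSize_coreArcsAt (p : ℕ) (c : List Forest) :
    ∏ A ∈ coreArcsAt p c, (qint (arcSize A))⁻¹ = coreHook c := by
  induction c generalizing p with
  | nil => rfl
  | cons u c ih => rw [prod_coreArcsAt_cons, prod_arcSize_arcsAt, ih, coreHook]

theorem card_coreArcsAt (p : ℕ) (c : List Forest) : (coreArcsAt p c).card = coreArcs c := by
  induction c generalizing p with
  | nil => rfl
  | cons u c ih =>
    rw [coreArcsAt, Finset.card_union_of_disjoint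
      ((within_arcsAt _ u).disjoint (within_coreArcsAt _ c) (by omega)), card_arcsAt, ih, coreArcs]

/-! ### The enumeration of the objects of a diagram -/

/-- The number of elements of `O` below `x`. -/
def countBelow (O : Finset ℕ) (x : ℕ) : ℕ := (O.filter (· < x)).card

theorem countBelow_succ_of_mem {O : Finset ℕ} {x : ℕ} (h : x ∈ O) :
    countBelow O (x + 1) = countBelow O x + 1 := by
  rw [countBelow, countBelow, ← Finset.card_insert_of_notMem (a := x) (by simp)]
  congr 1
  ext y
  simp only [Finset.mem_filter, Finset.mem_insert]
  constructor
  · rintro ⟨h1, h2⟩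
    rcases Nat.lt_succ_iff_lt_or_eq.1 h2 with h3 | h3
    · exact Or.inr ⟨h1, h3⟩
    · exact Or.inl h3
  · rintro (rfl | ⟨h1, h2⟩)
    · exact ⟨h, by omega⟩
    · exact ⟨h1, by omega⟩

theorem countBelow_succ_of_notMem {O : Finset ℕ} {x : ℕ} (h : x ∉ O) :
    countBelow O (x + 1) = countBelow O x := by
  rw [countBelow, countBelow]
  congr 1
  ext y
  simp only [Finset.mem_filter]
  constructor
  · rintro ⟨h1, h2⟩
    have : y ≠ x := by rintro rfl; exact h h1
    exact ⟨h1, by omega⟩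
  · rintro ⟨h1, h2⟩
    exact ⟨h1, by omega⟩

theorem Within.notMem_image {a b x : ℕ} {G : Finset (ℕ × ℕ)} (h : Within a b G)
    (hx : x < a ∨ b ≤ x + 1) : x ∉ G.image Prod.fst := by
  intro hx'
  obtain ⟨A, hA, rfl⟩ := Finset.mem_image.1 hx'
  have := h A hA
  omega

/-- The numbers of the arcs in a stretch of the word without other objects are consecutive. -/
theorem enumerate_arcsAt {O : Finset ℕ} {p : ℕ} {u : Forest}
    (hO : ∀ x, p ≤ x → x < p + 2 * u.size → (x ∈ O ↔ x ∈ (arcsAt p u).image Prod.fst)) (g : ℕ → Kq) :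
    countBelow O (p + 2 * u.size) = countBelow O p + u.size ∧
      ∏ A ∈ arcsAt p u, g (countBelow O (A.1 + 1)) =
        ∏ i ∈ Finset.range u.size, g (countBelow O p + i + 1) := by
  induction u generalizing p with
  | nil => simp [Forest.size, arcsAt]
  | node a b iha ihb =>
    simp only [Forest.size] at hO ⊢
    simp only [arcsAt, Finset.image_insert, Finset.image_union, Finset.mem_insert,
      Finset.mem_union] at hO
    have wa := within_arcsAt (p + 1) a
    have wb := within_arcsAt (p + 2 * a.size + 2) b
    obtain ⟨a1, a2⟩ := iha (p := p + 1) fun x h1 h2 => by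
      have := wb.notMem_image (x := x) (by omega)
      rw [hO x (by omega) (by omega)]
      simp only [this, or_false, show x ≠ p by omega, false_or]
    obtain ⟨b1, b2⟩ := ihb (p := p + 2 * a.size + 2) fun x h1 h2 => by
      have := wa.notMem_image (x := x) (by omega)
      rw [hO x (by omega) (by omega)]
      simp only [this, false_or, show x ≠ p by omega]
    have c1 : countBelow O (p + 1) = countBelow O p + 1 :=
      countBelow_succ_of_mem ((hO p le_rfl (by omega)).2 (Or.inl rfl))
    have c2 : countBelow O (p + 1 + 2 * a.size + 1) = countBelow O (p + 1 + 2 * a.size) := by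
      apply countBelow_succ_of_notMem
      rw [hO _ (by omega) (by omega)]
      have h1 := wa.notMem_image (x := p + 1 + 2 * a.size) (by omega)
      have h2 := wb.notMem_image (x := p + 1 + 2 * a.size) (by omega)
      simp only [h1, h2, or_false, show p + 1 + 2 * a.size ≠ p by omega, not_false_eq_true]
    rw [show p + 1 + 2 * a.size + 1 = p + 2 * a.size + 2 by ring] at c2
    rw [show p + 2 * (a.size + b.size + 1) = p + 2 * a.size + 2 + 2 * b.size by ring, b1, c2, a1, c1]
    refine ⟨by ring, ?_⟩
    rw [prod_arcsAt_node, a2, b2, c2, a1, c1, Finset.prod_range_succ', Finset.prod_range_add,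
      mul_comm (g _)]
    congr 1
    congr 1
    · exact Finset.prod_congr rfl fun i _ => by congr 1; ring
    · exact Finset.prod_congr rfl fun i _ => by congr 1; ring

theorem prod_dashedAt_cons {M : Type*} [CommMonoid M] (p : ℕ) (x y : Forest) (c : List Forest)
    (f : ℕ × ℕ → M) : ∏ A ∈ dashedAt p (x :: y :: c), f A = f (p, p + 2 * x.size + 1) *
      ∏ A ∈ dashedAt (p + 2 * x.size + 2 * y.size + 2) c, f A := by
  rw [dashedAt, Finset.prod_insert]
  intro h
  have := (within_dashedAt _ c _ h).1
  dsimp only at this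
  omega

theorem starAt_lt {p : ℕ} {c : List Forest} (h : Odd c.length) : starAt p c < p + coreLength c := by
  have := coreLength_of_odd p c h
  omega

/-- The numbers of the arcs and dashed arcs of a core of odd length are consecutive. -/
theorem enumerate_core {O : Finset ℕ} {p : ℕ} {c : List Forest} (hc : Odd c.length)
    (hO : ∀ x, p ≤ x → x < p + coreLength c →
      (x ∈ O ↔ x ∈ (coreArcsAt p c).image Prod.fst ∪ (dashedAt p c).image Prod.fst)) (g : ℕ → Kq) :
    (∏ A ∈ coreArcsAt p c, g (countBelow O (A.1 + 1))) *
      ∏ A ∈ dashedAt p c, g (countBelow O (A.1 + 1)) =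
        ∏ i ∈ Finset.range (coreArcs c + c.length / 2), g (countBelow O p + i + 1) := by
  induction c using List.twoStepInduction generalizing p with
  | nil => simp at hc
  | singleton z =>
    simp only [coreArcsAt, dashedAt, Finset.union_empty, coreLength, add_zero, Finset.image_empty]
      at hO ⊢
    have wz := within_arcsAt (p + 1) z
    have := (enumerate_arcsAt (O := O) (p := p + 1) (u := z)
      (fun x h1 h2 => hO x (by omega) (by omega)) g).2
    have c1 : countBelow O (p + 1) = countBelow O p := by
      apply countBelow_succ_of_notMem
      rw [hO _ le_rfl (by omega)]
      exact wz.notMem_image (by omega)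
    rw [this, c1, Finset.prod_empty, mul_one]
    simp [coreArcs]
  | cons_cons x y c ih _ =>
    have h' : Odd c.length := by simpa [Nat.odd_add_one, Nat.not_odd_iff_even] using hc
    simp only [coreArcsAt, dashedAt, coreLength, Finset.image_insert, Finset.image_union,
      Finset.mem_insert, Finset.mem_union] at hO
    rw [show p + 2 * x.size + 1 + 2 * y.size + 1 = p + 2 * x.size + 2 * y.size + 2 by ring] at hO
    set p' := p + 2 * x.size + 2 * y.size + 2 with hp'
    have wx := within_arcsAt (p + 1) x
    have wy := within_arcsAt (p + 2 * x.size + 1 + 1) y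
    have wc := within_coreArcsAt p' c
    have wd := (within_dashedAt p' c).mono le_rfl (starAt_lt h').le
    obtain ⟨x1, x2⟩ := enumerate_arcsAt (O := O) (p := p + 1) (u := x) (fun t h1 h2 => by
      rw [hO t (by omega) (by omega)]
      have n1 := wy.notMem_image (x := t) (by omega)
      have n2 := wc.notMem_image (x := t) (by omega)
      have n3 := wd.notMem_image (x := t) (by omega)
      simp only [n1, n2, n3, or_false, show t ≠ p by omega]) g
    obtain ⟨y1, y2⟩ := enumerate_arcsAt (O := O) (p := p + 2 * x.size + 1 + 1) (u := y)
      (fun t h1 h2 => by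
      rw [hO t (by omega) (by omega)]
      have n1 := wx.notMem_image (x := t) (by omega)
      have n2 := wc.notMem_image (x := t) (by omega)
      have n3 := wd.notMem_image (x := t) (by omega)
      simp only [n1, n2, n3, or_false, false_or, show t ≠ p by omega]) g
    have z2 := ih (p := p') h' (fun t h1 h2 => by
      rw [hO t (by omega) (by omega)]
      have n1 := wx.notMem_image (x := t) (by omega)
      have n2 := wy.notMem_image (x := t) (by omega)
      simp only [n1, n2, false_or, show t ≠ p by omega, Finset.mem_union])
    have c1 : countBelow O (p + 1) = countBelow O p + 1 :=
      countBelow_succ_of_mem ((hO p le_rfl (by omega)).2 (Or.inr (Or.inl rfl)))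
    have c2 : countBelow O (p + 1 + 2 * x.size + 1) = countBelow O (p + 1 + 2 * x.size) := by
      apply countBelow_succ_of_notMem
      rw [hO _ (by omega) (by omega)]
      have n0 := wx.notMem_image (x := p + 1 + 2 * x.size) (by omega)
      have n1 := wy.notMem_image (x := p + 1 + 2 * x.size) (by omega)
      have n2 := wc.notMem_image (x := p + 1 + 2 * x.size) (by omega)
      have n3 := wd.notMem_image (x := p + 1 + 2 * x.size) (by omega)
      simp only [n0, n1, n2, n3, or_false, show p + 1 + 2 * x.size ≠ p by omega, not_false_eq_true]
    rw [show p + 1 + 2 * x.size + 1 = p + 2 * x.size + 1 + 1 by ring] at c2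
    rw [show p + 2 * x.size + 1 + 1 + 2 * y.size = p' by rw [hp']; ring] at y1
    rw [y1, c2, x1, c1] at z2
    rw [c2, x1, c1] at y2
    rw [c1] at x2
    have e1 : p + 2 * x.size + 1 + 2 * y.size + 1 = p' := by rw [hp']; ring
    rw [prod_coreArcsAt_cons, prod_coreArcsAt_cons, prod_dashedAt_cons, x2, y2, e1, ← hp']
    have e : coreArcs (x :: y :: c) + (x :: y :: c).length / 2 =
        x.size + (y.size + (coreArcs c + c.length / 2)) + 1 := by
      simp only [coreArcs, List.length_cons]; omega
    rw [e, Finset.prod_range_succ', Finset.prod_range_add, Finset.prod_range_add, ← mul_assoc,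
      mul_right_comm _ (g _), mul_assoc _ _ (∏ A ∈ dashedAt p' c, _), mul_assoc _ _ (∏ A ∈ dashedAt p' c, _),
      z2, c1]
    refine congr_arg₂ _ (congr_arg₂ _ ?_ (congr_arg₂ _ ?_ ?_)) rfl
    all_goals exact Finset.prod_congr rfl fun i _ => by congr 1; ring

/-- The numbers of the unpaired down arrow, of the arcs and of the dashed arcs of a core of even
length are consecutive. -/
theorem enumerate_even_core {O : Finset ℕ} {p : ℕ} {x : Forest} {c : List Forest}
    (hc : Odd c.length) (hO : ∀ t, p ≤ t → t < p + coreLength (x :: c) →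
      (t ∈ O ↔ t = p ∨ t ∈ (coreArcsAt p (x :: c)).image Prod.fst ∪
        (dashedAt (p + 2 * x.size + 1) c).image Prod.fst)) (g : ℕ → Kq) :
    g (countBelow O (p + 1)) * ((∏ A ∈ coreArcsAt p (x :: c), g (countBelow O (A.1 + 1))) *
      ∏ A ∈ dashedAt (p + 2 * x.size + 1) c, g (countBelow O (A.1 + 1))) =
        ∏ i ∈ Finset.range (coreArcs (x :: c) + (x :: c).length / 2),
          g (countBelow O p + i + 1) := by
  simp only [coreArcsAt, coreLength, Finset.image_union, Finset.mem_union] at hO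
  set p' := p + 2 * x.size + 1 with hp'
  have wx := within_arcsAt (p + 1) x
  have wc := within_coreArcsAt p' c
  have wd := (within_dashedAt p' c).mono le_rfl (starAt_lt hc).le
  obtain ⟨x1, x2⟩ := enumerate_arcsAt (O := O) (p := p + 1) (u := x) (fun t h1 h2 => by
    rw [hO t (by omega) (by omega)]
    have n2 := wc.notMem_image (x := t) (by omega)
    have n3 := wd.notMem_image (x := t) (by omega)
    simp only [n2, n3, or_false, show t ≠ p by omega, false_or]) g
  have z2 := enumerate_core (O := O) (p := p') hc (fun t h1 h2 => by
    rw [hO t (by omega) (by omega)]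
    have n1 := wx.notMem_image (x := t) (by omega)
    simp only [n1, false_or, show t ≠ p by omega, Finset.mem_union]) g
  have c1 : countBelow O (p + 1) = countBelow O p + 1 :=
    countBelow_succ_of_mem ((hO p le_rfl (by omega)).2 (Or.inl rfl))
  rw [show p + 1 + 2 * x.size = p' by rw [hp']; ring, c1] at x1
  rw [x1] at z2
  rw [c1] at x2
  have e : coreArcs (x :: c) + (x :: c).length / 2 =
      x.size + (coreArcs c + c.length / 2) + 1 := by
    obtain ⟨k, hk⟩ := hc
    simp only [coreArcs, List.length_cons]; omega
  rw [prod_coreArcsAt_cons, x2, ← hp', mul_assoc, z2, e, Finset.prod_range_succ',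
    Finset.prod_range_add _ x.size, mul_comm (g _), c1]
  refine congr_arg₂ _ (congr_arg₂ _ ?_ ?_) rfl
  all_goals exact Finset.prod_congr rfl fun i _ => by congr 1; ring

/-- The number of up arrows and of arcs up to the last up arrow. -/
def headCount : List Forest → ℕ
  | [] => 0
  | v :: U => v.size + 1 + headCount U

theorem objects_eq (u : Forest) (c : List Forest) (U : List Forest) :
    objects u c U = headCount U + (u.size + (coreArcs c + c.length / 2)) := by
  induction U with
  | nil => simp only [objects, headCount]; ring
  | cons v U ih => simp only [objects, headCount, ih]; ring

theorem headUps_bounds {p x : ℕ} {U : List Forest} (h : x ∈ headUps p U) :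
    p ≤ x ∧ x < p + headLength U := by
  induction U generalizing p with
  | nil => simp [headUps] at h
  | cons v U ih =>
    rw [headUps, Finset.mem_insert] at h
    rw [headLength]
    rcases h with rfl | h
    · omega
    · have := ih h
      omega

/-- The numbers of the arcs to the left of the last up arrow are all numbers that are not taken by
up arrows; the factors `1 / [p + v.size + 1]` in `shapeWeight` compensate for the latter. -/
theorem enumerate_head {O : Finset ℕ} {p : ℕ} {U : List Forest}
    (hO : ∀ x, p ≤ x → x < p + headLength U →
      (x ∈ O ↔ x ∈ headUps p U ∪ (headArcs p U).image Prod.fst)) (u : Forest) (c : List Forest) :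
    countBelow O (p + headLength U) = countBelow O p + headCount U ∧
      (∏ A ∈ headArcs p U, (qint (arcSize A))⁻¹) *
        (∏ A ∈ headArcs p U, qint (countBelow O (A.1 + 1) : ℕ)) *
          shapeWeight u c (countBelow O p + headCount U) [] =
      (∏ i ∈ Finset.range (headCount U), qint (countBelow O p + i + 1 : ℕ)) *
        shapeWeight u c (countBelow O p) U := by
  induction U generalizing p with
  | nil => simp [headArcs, headLength, headCount]
  | cons v U ih =>
    simp only [headUps, headArcs, headLength, Finset.image_union, Finset.mem_insert,
      Finset.mem_union] at hO
    have wv := within_arcsAt p v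
    have wU := within_headArcs (p + 2 * v.size + 1) U
    obtain ⟨v1, v2⟩ := enumerate_arcsAt (O := O) (p := p) (u := v) (fun t h1 h2 => by
      rw [hO t (by omega) (by omega)]
      have n1 := wU.notMem_image (x := t) (by omega)
      have n2 : t ∉ headUps (p + 2 * v.size + 1) U := fun h => by
        have := headUps_bounds h; omega
      simp only [n1, n2, or_false, show t ≠ p + 2 * v.size by omega, false_or]) fun i => qint i
    have c1 : countBelow O (p + 2 * v.size + 1) = countBelow O (p + 2 * v.size) + 1 :=
      countBelow_succ_of_mem ((hO _ (by omega) (by omega)).2 (Or.inl (Or.inl rfl)))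
    obtain ⟨U1, U2⟩ := ih (p := p + 2 * v.size + 1) (fun t h1 h2 => by
      rw [hO t (by omega) (by omega)]
      have n1 := wv.notMem_image (x := t) (by omega)
      simp only [n1, show t ≠ p + 2 * v.size by omega, false_or, Finset.mem_union])
    rw [c1, v1] at U1 U2
    rw [headLength, headCount, show p + (2 * v.size + 1 + headLength U) =
      p + 2 * v.size + 1 + headLength U by ring, U1]
    refine ⟨by ring, ?_⟩
    have h0 : qint ((countBelow O p : ℤ) + v.size + 1) ≠ 0 := qint_pos_ne_zero (by positivity)
    have sw : shapeWeight u c (countBelow O p) (v :: U) =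
      v.hook / qint (countBelow O p + v.size + 1) *
        shapeWeight u c (countBelow O p + v.size + 1) U := rfl
    rw [prod_headArcs_cons, prod_headArcs_cons, prod_arcSize_arcsAt, v2, Finset.prod_range_add,
      Finset.prod_range_succ, sw, show countBelow O p + (v.size + 1 + headCount U) =
        countBelow O p + v.size + 1 + headCount U by ring]
    generalize shapeWeight u c (countBelow O p + v.size + 1 + headCount U) [] = W' at *
    have e : ∀ i, countBelow O p + (v.size + 1 + i) + 1 = countBelow O p + v.size + 1 + i + 1 :=
      fun i => by ring
    simp only [e]
    generalize shapeWeight u c (countBelow O p + v.size + 1) U = W at *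
    generalize ∏ A ∈ headArcs (p + 2 * v.size + 1) U, (qint (arcSize A))⁻¹ = Z at *
    push_cast at U2 ⊢
    field_simp
    linear_combination (v.hook * ∏ i ∈ Finset.range v.size, qint ((countBelow O p : ℤ) + i + 1)) * U2

/-! ### Outer arcs -/

/-- The outer arcs of a system of arcs that starts at the position `p`. -/
def outerAt : ℕ → Forest → Finset (ℕ × ℕ)
  | _, .nil => ∅
  | p, .node a b => insert (p, p + 2 * a.size + 1) (outerAt (p + 2 * a.size + 2) b)

/-- The arcs to the left of the star of a core of odd length that are outer arcs of the diagram. -/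
def midOuterAt : ℕ → List Forest → Finset (ℕ × ℕ)
  | p, x :: y :: c => outerAt (p + 2 * x.size + 2) y ∪
      midOuterAt (p + 2 * x.size + 2 * y.size + 2) c
  | _, _ => ∅

theorem outerAt_subset (p : ℕ) (u : Forest) : outerAt p u ⊆ arcsAt p u := by
  induction u generalizing p with
  | nil => exact subset_rfl
  | node a b _ ihb =>
    exact Finset.insert_subset_insert _ ((ihb _).trans Finset.subset_union_right)

theorem within_outerAt (p : ℕ) (u : Forest) : Within p (p + 2 * u.size) (outerAt p u) :=
  fun A hA => within_arcsAt p u A (outerAt_subset p u hA)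

theorem within_midOuterAt (p : ℕ) (c : List Forest) :
    Within p (starAt p c) (midOuterAt p c) := by
  induction c using List.twoStepInduction generalizing p with
  | nil => exact within_empty _ _
  | singleton z => exact within_empty _ _
  | cons_cons x y c ih _ =>
    have h2 := (within_midArcsAt (p + 2 * x.size + 2 * y.size + 2) c).2
    rw [midOuterAt, starAt]
    exact ((within_outerAt _ y).mono (by omega) (by omega)).union ((ih _).mono (by omega) le_rfl)

/-- The arcs of `X` form the part of `G` at the positions from `a` to `b - 1`, and no other arc of `G`
has an end there. -/
def Fits (G : Finset (ℕ × ℕ)) (a b : ℕ) (X : Finset (ℕ × ℕ)) : Prop :=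
  X ⊆ G ∧ ∀ B ∈ G, B ∈ X ∨ B.2 < a ∨ b ≤ B.1

theorem filter_outer_arcsAt {G : Finset (ℕ × ℕ)} {p : ℕ} {u : Forest} (hs : arcsAt p u ⊆ G)
    (h : ∀ B ∈ G, ∀ A ∈ arcsAt p u, Encloses B A → B ∈ arcsAt p u) :
    (arcsAt p u).filter (fun A => ∀ B ∈ G, ¬ Encloses B A) = outerAt p u := by
  induction u generalizing p with
  | nil => rfl
  | node a b _ ihb =>
    have wa := within_arcsAt (p + 1) a
    have wb := within_arcsAt (p + 2 * a.size + 2) b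
    rw [arcsAt, outerAt, ← ihb (p := p + 2 * a.size + 2), Finset.filter_insert, if_pos,
      Finset.filter_union, Finset.filter_false_of_mem (s := arcsAt (p + 1) a), Finset.empty_union]
    · intro A hA hA'
      have := wa A hA
      refine hA' (p, p + 2 * a.size + 1) (hs (Finset.mem_insert_self _ _)) ⟨?_, ?_⟩ <;>
        dsimp only <;> omega
    · intro B hB hBA
      have := h B hB _ (Finset.mem_insert_self _ _) hBA
      have := within_arcsAt _ _ B this
      have := hBA.1
      dsimp only at *
      omega
    · exact fun B hB => hs (Finset.mem_insert_of_mem (Finset.mem_union_right _ hB))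
    · intro B hB A hA hBA
      have h1 := h B hB A (Finset.mem_insert_of_mem (Finset.mem_union_right _ hA)) hBA
      have h2 := wb A hA
      have h3 := hBA.2
      rw [arcsAt, Finset.mem_insert, Finset.mem_union] at h1
      rcases h1 with rfl | h1 | h1
      · dsimp only at h3; omega
      · have := wa B h1; omega
      · exact h1

theorem filter_outer_of_fits {G : Finset (ℕ × ℕ)} {p b : ℕ} {u : Forest}
    (h : Fits G p b (arcsAt p u)) (hb : p + 2 * u.size ≤ b + 1) :
    (arcsAt p u).filter (fun A => ∀ B ∈ G, ¬ Encloses B A) = outerAt p u := by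
  refine filter_outer_arcsAt h.1 fun B hB A hA hBA => ?_
  have := within_arcsAt _ _ A hA
  obtain ⟨h1, h2⟩ := hBA
  rcases h.2 B hB with h3 | h3 | h3
  · exact h3
  · omega
  · omega

/-- Dashed arcs hide the arcs inside of them. -/
theorem filter_outer_midArcsAt {G : Finset (ℕ × ℕ)} {p : ℕ} {c : List Forest}
    (h : Fits G p (starAt p c) (midArcsAt p c ∪ dashedAt p c)) :
    (midArcsAt p c).filter (fun A => ∀ B ∈ G, ¬ Encloses B A) = midOuterAt p c := by
  induction c using List.twoStepInduction generalizing p with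
  | nil => rfl
  | singleton z => rfl
  | cons_cons x y c ih _ =>
    obtain ⟨hs, h⟩ := h
    rw [midArcsAt, dashedAt] at hs h
    rw [starAt] at h
    rw [midArcsAt, midOuterAt]
    set p' := p + 2 * x.size + 2 * y.size + 2 with hp'
    have wx := within_arcsAt (p + 1) x
    have wy := within_arcsAt (p + 2 * x.size + 2) y
    have wm := (within_midArcsAt p' c).1
    have wm' := (within_midArcsAt p' c).2
    have wd := within_dashedAt p' c
    have hG : ∀ B ∈ G, B ∈ arcsAt (p + 1) x ∨ B ∈ arcsAt (p + 2 * x.size + 2) y ∨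
        B ∈ midArcsAt p' c ∨ B = (p, p + 2 * x.size + 1) ∨ B ∈ dashedAt p' c ∨
        B.2 < p ∨ starAt p' c ≤ B.1 := by
      intro B hB
      have := h B hB
      simp only [Finset.mem_union, Finset.mem_insert] at this
      tauto
    rw [Finset.filter_union, Finset.filter_union,
      Finset.filter_false_of_mem (s := arcsAt (p + 1) x), Finset.empty_union,
      filter_outer_of_fits (b := p'), ih]
    · refine ⟨fun B hB => hs ?_, fun B hB => ?_⟩
      · simp only [Finset.mem_union, Finset.mem_insert] at hB ⊢
        tauto
      · rw [Finset.mem_union]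
        rcases hG B hB with h1 | h1 | h1 | rfl | h1 | h1 | h1
        · have := wx B h1; omega
        · have := wy B h1; omega
        · tauto
        · dsimp only; omega
        · tauto
        · omega
        · omega
    · refine ⟨fun B hB => hs ?_, fun B hB => ?_⟩
      · simp only [Finset.mem_union]
        tauto
      · rcases hG B hB with h1 | h1 | h1 | rfl | h1 | h1 | h1
        · have := wx B h1; omega
        · tauto
        · have := wm B h1; omega
        · dsimp only; omega
        · have := wd B h1; omega
        · omega
        · omega
    · omega
    · intro A hA hA'
      have := wx A hA
      refine hA' (p, p + 2 * x.size + 1) (hs ?_) ⟨?_, ?_⟩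
      · simp
      all_goals dsimp only; omega

theorem prod_outerAt_node {M : Type*} [CommMonoid M] (p : ℕ) (a b : Forest) (f : ℕ × ℕ → M) :
    ∏ A ∈ outerAt p (.node a b), f A = f (p, p + 2 * a.size + 1) *
      ∏ A ∈ outerAt (p + 2 * a.size + 2) b, f A := by
  rw [outerAt, Finset.prod_insert]
  intro h
  have := (within_outerAt _ _ _ h).1
  dsimp only at this
  omega

theorem prod_midOuterAt_cons {M : Type*} [CommMonoid M] (p : ℕ) (x y : Forest) (c : List Forest)
    (f : ℕ × ℕ → M) : ∏ A ∈ midOuterAt p (x :: y :: c), f A =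
      (∏ A ∈ outerAt (p + 2 * x.size + 2) y, f A) *
        ∏ A ∈ midOuterAt (p + 2 * x.size + 2 * y.size + 2) c, f A := by
  rw [midOuterAt, Finset.prod_union]
  exact (within_outerAt _ _).disjoint (within_midOuterAt _ _) (by omega)

theorem prod_outerAt_ratio (N y p : ℕ) (u : Forest) (hN : N + 1 = p + 2 * u.size + y) :
    ∏ A ∈ outerAt p u, qint (1 + arcSize A + (N - A.2 : ℕ)) /
      qint (1 + 2 * arcSize A + (N - A.2 : ℕ)) = u.outerRatio y := by
  induction u generalizing p with
  | nil => rfl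
  | node a b _ ihb =>
    simp only [Forest.size] at hN
    have e : arcSize (p, p + 2 * a.size + 1) = a.size + 1 := by simp only [arcSize]; omega
    have e2 : N - (p + 2 * a.size + 1) = 2 * b.size + y := by omega
    rw [prod_outerAt_node, ihb _ (by omega), Forest.outerRatio, e, e2]
    congr 3 <;> (push_cast; ring)

/-- The product over the outer arcs of a system of arcs to the right of the star telescopes. -/
theorem prod_outerAt_telescope (s k t : ℕ) (z : Forest) :
    ∏ A ∈ outerAt (s + 1 + 2 * k) z, qint (((A.1 - s + 1) / 2 : ℕ) + t) /
      qint (((A.1 - s + 1) / 2 : ℕ) + arcSize A + t) =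
        qint (k + 1 + t) / qint (k + 1 + z.size + t) := by
  have hq : ∀ n : ℕ, qint ((n : ℤ) + 1) ≠ 0 := fun n => qint_pos_ne_zero (by positivity)
  induction z generalizing k with
  | nil =>
    have := hq (k + t)
    push_cast at this
    rw [outerAt, Finset.prod_empty, Forest.size, Nat.cast_zero, add_zero, div_self]
    rwa [add_right_comm]
  | node a b _ ihb =>
    have e : arcSize (s + 1 + 2 * k, s + 1 + 2 * k + 2 * a.size + 1) = a.size + 1 := by
      simp only [arcSize]; omega
    have e2 : (s + 1 + 2 * k - s + 1) / 2 = k + 1 := by omega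
    rw [prod_outerAt_node, show s + 1 + 2 * k + 2 * a.size + 2 = s + 1 + 2 * (k + a.size + 1) by ring,
      ihb, e, Forest.size]
    dsimp only
    rw [e2, show ((k + a.size + 1 : ℕ) : ℤ) + 1 + t = (k + 1 : ℕ) + (a.size + 1 : ℕ) + t by
      push_cast; ring, div_mul_div_cancel₀]
    · congr 2 <;> (push_cast; ring)
    · exact qint_pos_ne_zero (by positivity)

/-! ### The arcs to the right of, outside or equal to a given arc -/

/-- The number of arcs of `S` that are to the right of `B`, outside of `B` or equal to `B`. -/
def rank (S : Finset (ℕ × ℕ)) (B : ℕ × ℕ) : ℕ :=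
  (S.filter fun A => B.2 < A.1 ∨ Encloses A B ∨ A = B).card

theorem rank_union {S S' : Finset (ℕ × ℕ)} (h : Disjoint S S') (B : ℕ × ℕ) :
    rank (S ∪ S') B = rank S B + rank S' B := by
  rw [rank, Finset.filter_union, Finset.card_union_of_disjoint
    (Finset.disjoint_filter_filter h)]
  rfl

theorem rank_eq_zero {a b : ℕ} {S : Finset (ℕ × ℕ)} {B : ℕ × ℕ} (h : Within a b S)
    (hB : b ≤ B.2) : rank S B = 0 := by
  rw [rank, Finset.card_eq_zero, Finset.filter_eq_empty_iff]
  intro A hA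
  have := h A hA
  rintro (h1 | ⟨h1, h2⟩ | rfl) <;> omega

theorem rank_eq_card {a b : ℕ} {S : Finset (ℕ × ℕ)} {B : ℕ × ℕ} (h : Within a b S)
    (hB : B.2 < a) : rank S B = S.card := by
  rw [rank, Finset.filter_true_of_mem]
  intro A hA
  have := h A hA
  omega

/-- The values of `rank` on a system of arcs are `1, …, u.size`. -/
theorem prod_rank_arcsAt {M : Type*} [CommMonoid M] (r : ℕ → M) (K p : ℕ) (u : Forest) :
    ∏ B ∈ arcsAt p u, r (K + rank (arcsAt p u) B) = ∏ i ∈ Finset.range u.size, r (K + i + 1) := by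
  induction u generalizing K p with
  | nil => rfl
  | node a b iha ihb =>
    have wa := within_arcsAt (p + 1) a
    have wb := within_arcsAt (p + 2 * a.size + 2) b
    have hab := wa.disjoint wb (by omega)
    have wr : Within p (p + 2 * a.size + 2) {(p, p + 2 * a.size + 1)} := by
      intro A hA
      rw [Finset.mem_singleton.1 hA]
      dsimp only
      omega
    have hr : Disjoint {(p, p + 2 * a.size + 1)}
        (arcsAt (p + 1) a ∪ arcsAt (p + 2 * a.size + 2) b) := by
      rw [Finset.disjoint_singleton_left, Finset.mem_union]
      rintro (h | h)
      · have := wa _ h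
        dsimp only at this
        omega
      · have := wb _ h
        dsimp only at this
        omega
    have e : ∀ B, rank (arcsAt p (.node a b)) B = rank {(p, p + 2 * a.size + 1)} B +
        (rank (arcsAt (p + 1) a) B + rank (arcsAt (p + 2 * a.size + 2) b) B) := fun B => by
      rw [← rank_union hab, ← rank_union hr]
      rfl
    rw [prod_arcsAt_node]
    simp only [e]
    have e1 : rank {(p, p + 2 * a.size + 1)} (p, p + 2 * a.size + 1) = 1 := by
      rw [rank, Finset.filter_true_of_mem, Finset.card_singleton]
      exact fun A hA => Or.inr (Or.inr (Finset.mem_singleton.1 hA))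
    rw [e1, rank_eq_zero (B := (p, p + 2 * a.size + 1)) wa (by dsimp only; omega),
      rank_eq_card (B := (p, p + 2 * a.size + 1)) wb (by dsimp only; omega), card_arcsAt]
    have ea : ∀ B ∈ arcsAt (p + 1) a, r (K + (rank {(p, p + 2 * a.size + 1)} B +
        (rank (arcsAt (p + 1) a) B + rank (arcsAt (p + 2 * a.size + 2) b) B))) =
        r (K + b.size + 1 + rank (arcsAt (p + 1) a) B) := by
      intro B hB
      have := wa B hB
      have e2 : rank {(p, p + 2 * a.size + 1)} B = 1 := by
        rw [rank, Finset.filter_true_of_mem, Finset.card_singleton]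
        intro A hA
        rw [Finset.mem_singleton.1 hA]
        exact Or.inr (Or.inl ⟨by dsimp only; omega, by dsimp only; omega⟩)
      rw [rank_eq_card (B := B) wb (by omega), card_arcsAt, e2]
      congr 1
      ring
    have eb : ∀ B ∈ arcsAt (p + 2 * a.size + 2) b, r (K + (rank {(p, p + 2 * a.size + 1)} B +
        (rank (arcsAt (p + 1) a) B + rank (arcsAt (p + 2 * a.size + 2) b) B))) =
        r (K + rank (arcsAt (p + 2 * a.size + 2) b) B) := by
      intro B hB
      have := wb B hB
      rw [rank_eq_zero (B := B) wa (by omega), rank_eq_zero (B := B) wr (by omega), zero_add,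
        zero_add]
    rw [Finset.prod_congr rfl ea, Finset.prod_congr rfl eb, iha, ihb, Forest.size,
      show a.size + b.size + 1 = b.size + 1 + a.size by ring, Finset.prod_range_add,
      Finset.prod_range_succ, mul_comm (∏ k ∈ Finset.range a.size, _), ← mul_assoc,
      mul_comm (r _)]
    refine congr_arg₂ _ (congr_arg₂ _ rfl ?_) (Finset.prod_congr rfl fun i _ => ?_) <;> congr 1 <;>
      ring

/-- To the left of the star, every position of a core of odd length is an end of an arc or of a
dashed arc. -/
theorem starAt_eq {p : ℕ} {c : List Forest} :
    starAt p c = p + 2 * ((midArcsAt p c).card + (dashedAt p c).card) := by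
  induction c using List.twoStepInduction generalizing p with
  | nil => rfl
  | singleton z => rfl
  | cons_cons x y c ih _ =>
    set p' := p + 2 * x.size + 2 * y.size + 2 with hp'
    have wx := within_arcsAt (p + 1) x
    have wy := within_arcsAt (p + 2 * x.size + 2) y
    have wm := (within_midArcsAt p' c).1
    have wm' := (within_midArcsAt p' c).2
    have wd := within_dashedAt p' c
    rw [starAt, ← hp', ih, midArcsAt, dashedAt, Finset.card_insert_of_notMem,
      Finset.card_union_of_disjoint, Finset.card_union_of_disjoint, card_arcsAt, card_arcsAt, ← hp']
    · omega
    · exact wy.disjoint wm (by omega)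
    · exact Finset.disjoint_union_right.2
        ⟨wx.disjoint wy (by omega), wx.disjoint wm (by omega)⟩
    · intro h
      have := wd _ h
      dsimp only at this
      omega

/-- The numbers `c_B` of the arcs to the left of the star of a core of odd length, together with
half the distances of the left ends of the dashed arcs from the star, are `1, …, N_3`. -/
theorem prod_rank_midArcsAt {M : Type*} [CommMonoid M] (r : ℕ → M) (p : ℕ) (c : List Forest) :
    (∏ B ∈ midArcsAt p c, r (rank (midArcsAt p c) B +
        ((dashedAt p c).filter fun A => B.2 < A.1).card)) *
      ∏ A ∈ dashedAt p c, r ((starAt p c - A.1) / 2) =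
    ∏ i ∈ Finset.range ((midArcsAt p c).card + (dashedAt p c).card), r (i + 1) := by
  induction c using List.twoStepInduction generalizing p with
  | nil => simp [midArcsAt, dashedAt]
  | singleton z => simp [midArcsAt, dashedAt]
  | cons_cons x y c ih _ =>
    have hs := starAt_eq (p := p) (c := x :: y :: c)
    set p' := p + 2 * x.size + 2 * y.size + 2 with hp'
    have wx := within_arcsAt (p + 1) x
    have wy := within_arcsAt (p + 2 * x.size + 2) y
    have wm := (within_midArcsAt p' c).1
    have wm' := (within_midArcsAt p' c).2
    have wd := within_dashedAt p' c
    have hym := wy.disjoint wm (by omega)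
    have hx := Finset.disjoint_union_right.2
      ⟨wx.disjoint wy (by omega), wx.disjoint wm (by omega)⟩
    have hd : (p, p + 2 * x.size + 1) ∉ dashedAt p' c := by
      intro h
      have := wd _ h
      dsimp only at this
      omega
    have ih' := ih p'
    set n := (midArcsAt p' c).card + (dashedAt p' c).card with hn
    have hc : (midArcsAt p (x :: y :: c)).card + (dashedAt p (x :: y :: c)).card =
        n + y.size + x.size + 1 := by
      rw [midArcsAt, dashedAt, Finset.card_insert_of_notMem hd, Finset.card_union_of_disjoint hx,
        Finset.card_union_of_disjoint hym, card_arcsAt, card_arcsAt]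
      omega
    rw [hc] at hs ⊢
    rw [midArcsAt, Finset.prod_union hx, Finset.prod_union hym, prod_dashedAt_cons, ← hp', hs]
    have hdf : ∀ B : ℕ × ℕ, p < B.2 → ((dashedAt p (x :: y :: c)).filter fun A => B.2 < A.1) =
        (dashedAt p' c).filter fun A => B.2 < A.1 := by
      intro B hB
      rw [dashedAt, Finset.filter_insert, if_neg (by dsimp only; omega)]
    have hdc : ∀ B : ℕ × ℕ, B.2 < p' → ((dashedAt p' c).filter fun A => B.2 < A.1).card =
        (dashedAt p' c).card := by
      intro B hB
      rw [Finset.filter_true_of_mem]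
      intro A hA
      have := wd A hA
      omega
    have ex : ∀ B ∈ arcsAt (p + 1) x, r (rank (arcsAt (p + 1) x ∪ (arcsAt (p + 2 * x.size + 2) y ∪
        midArcsAt p' c)) B + ((dashedAt p (x :: y :: c)).filter fun A => B.2 < A.1).card) =
        r (n + y.size + rank (arcsAt (p + 1) x) B) := by
      intro B hB
      have := wx B hB
      rw [hdf B (by omega), hdc B (by omega), rank_union hx, rank_union hym,
        rank_eq_card (B := B) wy (by omega), rank_eq_card (B := B) wm (by omega), card_arcsAt]
      congr 1
      omega
    have ey : ∀ B ∈ arcsAt (p + 2 * x.size + 2) y, r (rank (arcsAt (p + 1) x ∪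
        (arcsAt (p + 2 * x.size + 2) y ∪ midArcsAt p' c)) B +
          ((dashedAt p (x :: y :: c)).filter fun A => B.2 < A.1).card) =
        r (n + rank (arcsAt (p + 2 * x.size + 2) y) B) := by
      intro B hB
      have := wy B hB
      rw [hdf B (by omega), hdc B (by omega), rank_union hx, rank_union hym,
        rank_eq_zero (B := B) wx (by omega), rank_eq_card (B := B) wm (by omega)]
      congr 1
      omega
    have em : ∀ B ∈ midArcsAt p' c, r (rank (arcsAt (p + 1) x ∪
        (arcsAt (p + 2 * x.size + 2) y ∪ midArcsAt p' c)) B +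
          ((dashedAt p (x :: y :: c)).filter fun A => B.2 < A.1).card) =
        r (rank (midArcsAt p' c) B + ((dashedAt p' c).filter fun A => B.2 < A.1).card) := by
      intro B hB
      have := wm B hB
      rw [hdf B (by omega), rank_union hx, rank_union hym,
        rank_eq_zero (B := B) wx (by omega), rank_eq_zero (B := B) wy (by omega), zero_add, zero_add]
    have hs' : starAt p' c = p + 2 * (n + y.size + x.size + 1) := by rw [← hs]; rfl
    rw [hs'] at ih'
    rw [Finset.prod_congr rfl ex, Finset.prod_congr rfl ey, Finset.prod_congr rfl em,
      prod_rank_arcsAt, prod_rank_arcsAt, Finset.prod_range_succ, Finset.prod_range_add,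
      Finset.prod_range_add, ← ih', show (p + 2 * (n + y.size + x.size + 1) - p) / 2 =
        n + y.size + x.size + 1 by omega]
    ac_rfl

/-! ### The factors of the product formula -/

/-- The even quantum integers produce the numerator of `N9` by `[2 i] = [i] (q^i + q^{-i})`. -/
theorem evenFact_eq (n : ℕ) : evenFact n = (∏ i ∈ Finset.range n, qint (i + 1 : ℕ)) *
    ∏ i ∈ Finset.Icc 1 n, (q ^ i + q⁻¹ ^ i) := by
  induction n with
  | zero => simp [evenFact]
  | succ n ih =>
    rw [evenFact_succ, ih, Finset.prod_range_succ, Finset.prod_Icc_succ_top (by omega)]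
    have := qint_two_mul ((n + 1 : ℕ) : ℤ)
    rw [zpow_neg, zpow_natCast, ← inv_pow] at this
    push_cast at this ⊢
    rw [this]
    ring

theorem headLength_eq (p : ℕ) (U : List Forest) :
    headLength U = headCount U + (headArcs p U).card := by
  induction U generalizing p with
  | nil => rfl
  | cons v U ih =>
    rw [headArcs, Finset.card_union_of_disjoint
      ((within_arcsAt _ v).disjoint (within_headArcs _ U) (by omega)), card_arcsAt, headLength,
      headCount, ih (p + 2 * v.size + 1)]
    ring

theorem last_mem_headUps {p : ℕ} {U : List Forest} (h : U ≠ []) :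
    p + headLength U - 1 ∈ headUps p U := by
  induction U generalizing p with
  | nil => exact absurd rfl h
  | cons v U ih =>
    rw [headUps, headLength, Finset.mem_insert]
    by_cases hU : U = []
    · subst hU
      left
      simp only [headLength]
      omega
    · right
      have := ih (p := p + 2 * v.size + 1) hU
      rwa [show p + (2 * v.size + 1 + headLength U) = p + 2 * v.size + 1 + headLength U by ring]

theorem card_dashedAt (p : ℕ) (c : List Forest) : (dashedAt p c).card = c.length / 2 := by
  induction c using List.twoStepInduction generalizing p with
  | nil => rfl
  | singleton z => simp [dashedAt]
  | cons_cons x y c ih _ =>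
    rw [dashedAt, Finset.card_insert_of_notMem, ih, List.length_cons, List.length_cons]
    · omega
    · intro h
      have := within_dashedAt _ _ _ h
      dsimp only at this
      omega

theorem disjoint_coreArcsAt_dashedAt {p : ℕ} {c : List Forest} (h : Odd c.length) :
    Disjoint (coreArcsAt p c) (dashedAt p c) := by
  induction c using List.twoStepInduction generalizing p with
  | nil => simp at h
  | singleton z => exact Finset.disjoint_empty_right _
  | cons_cons x y c ih _ =>
    have h' : Odd c.length := by simpa [Nat.odd_add_one, Nat.not_odd_iff_even] using h
    have wx := within_arcsAt (p + 1) x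
    have wy := within_arcsAt (p + 2 * x.size + 1 + 1) y
    have wc := within_coreArcsAt (p + 2 * x.size + 2 * y.size + 2) c
    have wd := within_dashedAt (p + 2 * x.size + 2 * y.size + 2) c
    rw [coreArcsAt, coreArcsAt, dashedAt,
      show p + 2 * x.size + 1 + 2 * y.size + 1 = p + 2 * x.size + 2 * y.size + 2 by ring]
    rw [Finset.disjoint_insert_right, Finset.disjoint_union_left, Finset.disjoint_union_left]
    refine ⟨fun hm => ?_, wx.disjoint wd (by omega), wy.disjoint wd (by omega), ih h'⟩
    rw [Finset.mem_union, Finset.mem_union] at hm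
    rcases hm with hm | hm | hm
    · have := wx _ hm; dsimp only at this; omega
    · have := wy _ hm; dsimp only at this; omega
    · have := wc _ hm; dsimp only at this; omega

/-- The star and the two ends of a dashed arc are at positions of alternating parity. -/
theorem dashedAt_parity {p : ℕ} {c : List Forest} {A : ℕ × ℕ} (hA : A ∈ dashedAt p c) :
    ∃ i j, A.2 = A.1 + 2 * i + 1 ∧ starAt p c = A.2 + 2 * j + 1 := by
  induction c using List.twoStepInduction generalizing p with
  | nil => simp [dashedAt] at hA
  | singleton z => simp [dashedAt] at hA
  | cons_cons x y c ih _ =>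
    rw [dashedAt, Finset.mem_insert] at hA
    rcases hA with rfl | hA
    · refine ⟨x.size, y.size + ((midArcsAt (p + 2 * x.size + 2 * y.size + 2) c).card +
        (dashedAt (p + 2 * x.size + 2 * y.size + 2) c).card), rfl, ?_⟩
      rw [starAt, starAt_eq]
      ring
    · exact ih hA

/-- `coreWeight` contributes the factors of `N6` for the outer arcs to the left of the star and the
inverse of `[2 d_{4,A}]` for the dashed arcs and the star. -/
theorem coreWeight_of_odd {N p : ℕ} {c : List Forest} (h : Odd c.length)
    (hN : N + 1 = p + coreLength c) :
    coreWeight c = (∏ A ∈ midOuterAt p c, qint (1 + arcSize A + (N - A.2 : ℕ)) /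
        qint (1 + 2 * arcSize A + (N - A.2 : ℕ))) *
      ((∏ A ∈ dashedAt p c, (qint (2 * (1 + (N - A.1) / 2 : ℕ)))⁻¹) *
        (qint (2 * (1 + (N - starAt p c) / 2 : ℕ)))⁻¹) := by
  induction c using List.twoStepInduction generalizing p with
  | nil => simp at h
  | singleton z =>
    simp only [coreLength] at hN
    have e : (N - p) / 2 = z.size := by omega
    simp only [coreWeight, midOuterAt, dashedAt, starAt, Finset.prod_empty, one_mul, e,
      List.length_nil, coreLength, if_neg (show ¬ Odd 0 by simp), one_div]
    congr 2
    push_cast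
    ring
  | cons_cons x y c ih _ =>
    have h' : Odd c.length := by simpa [Nat.odd_add_one, Nat.not_odd_iff_even] using h
    have hl := coreLength_eq (y :: c)
    obtain ⟨k, hk⟩ := h'
    simp only [coreLength, List.length_cons] at hN hl
    rw [prod_midOuterAt_cons, prod_dashedAt_cons, starAt, coreWeight,
      if_neg (by simp [Nat.odd_add_one, hk]), coreWeight, if_pos ⟨k, hk⟩,
      ih (p := p + 2 * x.size + 2 * y.size + 2) ⟨k, hk⟩ (by omega),
      prod_outerAt_ratio N (coreLength c) _ y (by omega)]
    have e : ((2 : ℤ) * (1 + (N - p) / 2 : ℕ)) = (coreLength (y :: c) : ℤ) + 2 * x.size + 2 := by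
      simp only [coreLength]
      push_cast
      omega
    rw [e, div_eq_mul_inv]
    ring

theorem q_pow_add_inv_pow_mul_qint (d : ℕ) :
    (q ^ d + q⁻¹ ^ d) * qint d = qint (2 * d) := by
  rw [qint_two_mul, zpow_neg, zpow_natCast, inv_pow, mul_comm]

namespace Diagram

variable {D : Diagram}

/-- The value of `N7`, given the arcs to the right of the star and the numbers `c_B`. -/
theorem N7_eq {s : ℕ} {z : Forest} (hs : D.star = some s)
    (hR : D.outer D.SR = outerAt (s + 1) z)
    (hc : ∀ r : ℕ → Kq, (∏ B ∈ D.SM, r (D.c B)) * ∏ A ∈ D.dashed, r ((s - A.1) / 2) =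
      ∏ i ∈ Finset.range D.N3, r (i + 1)) :
    D.N7 = (qint (1 + z.size))⁻¹ * ∏ A ∈ D.dashed,
      qint (1 + ((s - A.1) / 2 : ℕ)) / qint (1 + z.size + ((s - A.1) / 2 : ℕ)) := by
  set r : ℕ → Kq := fun t => qint (1 + t) / qint (1 + z.size + t) with hr
  have hr0 : ∀ t, r t ≠ 0 := fun t =>
    div_ne_zero (qint_pos_ne_zero (by positivity)) (qint_pos_ne_zero (by positivity))
  have hd : ∀ A, D.d2 A = (A.1 - s + 1) / 2 := fun A => by simp [d2, starPos, hs]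
  have key : ∀ t : ℕ, ∏ A ∈ outerAt (s + 1) z, qint (D.d2 A + t) /
      qint (D.d2 A + arcSize A + t) = r t := fun t => by
    have := prod_outerAt_telescope s 0 t z
    simp only [Nat.cast_zero, zero_add, mul_zero, add_zero] at this
    simp only [hd, this, hr]
  have key' : ∀ t : ℕ, ∏ A ∈ outerAt (s + 1) z, qint (D.d2 A + arcSize A + t) /
      qint (D.d2 A + t) = (r t)⁻¹ := fun t => by
    rw [← key, ← Finset.prod_inv_distrib]
    simp only [inv_div]
  rw [N7, hR, Finset.prod_mul_distrib, Finset.prod_comm, Finset.prod_comm (t := D.SM)]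
  simp only [key, key']
  have r0 : r 0 = (qint (1 + z.size))⁻¹ := by simp [hr]
  rw [Finset.prod_range_succ', ← hc r, Finset.prod_inv_distrib, mul_right_comm, mul_comm (∏ B ∈ D.SM, _),
    mul_inv_cancel_right₀ (Finset.prod_ne_zero_iff.2 fun B _ => hr0 _), r0, mul_comm]

/-- The factors `N7`, `N8` and `N9` combine to a product over the dashed arcs and the star. -/
theorem N7_mul_N9 {s : ℕ} {z : Forest} (hs : D.star = some s)
    (hR : D.outer D.SR = outerAt (s + 1) z)
    (hc : ∀ r : ℕ → Kq, (∏ B ∈ D.SM, r (D.c B)) * ∏ A ∈ D.dashed, r ((s - A.1) / 2) =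
      ∏ i ∈ Finset.range D.N3, r (i + 1))
    (hN : D.size = s + 2 * z.size)
    (hd : ∀ A ∈ D.dashed, ∃ i j, A.2 = A.1 + 2 * i + 1 ∧ s = A.2 + 2 * j + 1) :
    D.N7 * (∏ A ∈ D.dashed, (qint (D.d3 A + arcSize A))⁻¹) * D.N9 =
      (∏ i ∈ Finset.Icc 1 (D.size - D.N2), (q ^ i + q⁻¹ ^ i)) *
        ((∏ A ∈ D.dashed, (qint (2 * (1 + (D.size - A.1) / 2 : ℕ)))⁻¹) *
          (qint (2 * (1 + (D.size - s) / 2 : ℕ)))⁻¹) := by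
  have e : ∀ A ∈ D.dashed, (qint (2 * (1 + (D.size - A.1) / 2 : ℕ)))⁻¹ =
      qint (1 + ((s - A.1) / 2 : ℕ)) / qint (1 + z.size + ((s - A.1) / 2 : ℕ)) *
        (qint (D.d3 A + arcSize A))⁻¹ * (q ^ D.d4 A.1 + q⁻¹ ^ D.d4 A.1)⁻¹ := by
    intro A hA
    obtain ⟨i, j, h1, h2⟩ := hd A hA
    have e1 : (D.d3 A : ℤ) + arcSize A = 1 + ((s - A.1) / 2 : ℕ) := by
      simp only [d3, starPos, hs, Option.getD_some, arcSize]
      omega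
    have e2 : (1 : ℤ) + z.size + ((s - A.1) / 2 : ℕ) = D.d4 A.1 := by
      simp only [d4]
      omega
    have h0 : qint (1 + ((s - A.1) / 2 : ℕ)) ≠ 0 := qint_pos_ne_zero (by positivity)
    rw [e1, e2, div_mul_eq_mul_div, mul_inv_cancel₀ h0, one_div, ← mul_inv, mul_comm (qint _),
      q_pow_add_inv_pow_mul_qint]
    rfl
  have e' : (qint (2 * (1 + (D.size - s) / 2 : ℕ)))⁻¹ =
      (qint (1 + z.size))⁻¹ * (q ^ D.d4 s + q⁻¹ ^ D.d4 s)⁻¹ := by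
    have e2 : (1 : ℤ) + z.size = D.d4 s := by
      simp only [d4]
      omega
    rw [e2, ← mul_inv, mul_comm (qint _), q_pow_add_inv_pow_mul_qint]
    rfl
  rw [N7_eq hs hR hc, N9, hs, Option.toFinset_some, Finset.prod_singleton,
    Finset.prod_congr rfl e, e', Finset.prod_mul_distrib, Finset.prod_mul_distrib,
    Finset.prod_inv_distrib (f := fun A : ℕ × ℕ => q ^ D.d4 A.1 + q⁻¹ ^ D.d4 A.1), div_eq_mul_inv,
    mul_inv]
  ring

end Diagram

/-! ### The product formula of a word -/

section

variable (U : List Forest) (u : Forest)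

/-- The product of the inverse sizes and `N10`, for all kinds of cores.  The set `O` holds the left
ends of all objects, `E` those in the core, `ds` the dashed arcs, and `e` is the factor of the
unpaired down arrow, if there is one. -/
theorem prod_sizes_mul_prod_numbers {O E : Finset ℕ} {c : List Forest} {ds : Finset (ℕ × ℕ)}
    {e : Kq} {P Q : ℕ} (hP : P = 1 + headLength U) (hQ : Q = P + 2 * u.size)
    (hO : ∀ t, t ∈ O ↔ t ∈ headUps 1 U ∪ (headArcs 1 U).image Prod.fst ∨
      t ∈ (arcsAt P u).image Prod.fst ∨ t ∈ E)
    (hE : ∀ t ∈ E, Q ≤ t) (hds : Within Q (Q + coreLength c) ds)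
    (hdis : Disjoint (coreArcsAt Q c) ds)
    (he : e * ((∏ A ∈ coreArcsAt Q c, qint (countBelow O (A.1 + 1))) *
      ∏ A ∈ ds, qint (countBelow O (A.1 + 1))) =
        ∏ i ∈ Finset.range (coreArcs c + c.length / 2), qint (countBelow O Q + i + 1 : ℕ)) :
    (∏ A ∈ headArcs 1 U ∪ (arcsAt P u ∪ coreArcsAt Q c), (qint (arcSize A))⁻¹) *
      (e * ∏ A ∈ headArcs 1 U ∪ (arcsAt P u ∪ coreArcsAt Q c) ∪ ds,
        qint (countBelow O (A.1 + 1))) *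
      (coreWeight c * if Odd c.length then
        qint (coreLength c + 2 * u.size + 1 + headCount U) * u.outerRatio (coreLength c) else 1) =
    (∏ i ∈ Finset.range (objects u c U), qint (i + 1 : ℕ)) * shapeWeight u c 0 U := by
  have wH := within_headArcs 1 U
  have wu := within_arcsAt P u
  have wc := within_coreArcsAt Q c
  have huc := wu.disjoint wc (by omega)
  have hH := Finset.disjoint_union_right.2
    ⟨wH.disjoint wu (by omega), wH.disjoint wc (by omega)⟩
  have hall : Disjoint (headArcs 1 U ∪ (arcsAt P u ∪ coreArcsAt Q c)) ds :=
    Finset.disjoint_union_left.2 ⟨wH.disjoint hds (by omega),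
      Finset.disjoint_union_left.2 ⟨wu.disjoint hds (by omega), hdis⟩⟩
  have hE' : ∀ t, t < Q → t ∉ E := fun t ht h => by
    have := hE t h
    omega
  obtain ⟨H1, H2⟩ := enumerate_head (O := O) (p := 1) (U := U) (fun t h1 h2 => by
    rw [hO]
    have n1 := wu.notMem_image (x := t) (by omega)
    have n2 := hE' t (by omega)
    simp only [n1, n2, or_false]) u c
  rw [← hP] at H1
  obtain ⟨u1, u2⟩ := enumerate_arcsAt (O := O) (p := P) (u := u) (fun t h1 h2 => by
    rw [hO]
    have n1 := wH.notMem_image (x := t) (by omega)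
    have n2 := hE' t (by omega)
    have n3 : t ∉ headUps 1 U := fun h => by
      have := headUps_bounds h
      omega
    simp only [Finset.mem_union, n1, n2, n3, or_false, false_or]) fun i => qint i
  rw [← hQ] at u1
  have h1 : countBelow O 1 = 0 := by
    rw [countBelow, Finset.card_eq_zero, Finset.filter_eq_empty_iff]
    intro t ht ht'
    rw [hO, Finset.mem_union] at ht
    rcases ht with (ht | ht) | ht | ht
    · have := headUps_bounds ht
      omega
    · exact wH.notMem_image (by omega) ht
    · exact wu.notMem_image (by omega) ht
    · have := hE t ht
      omega
  rw [h1, zero_add] at H1 H2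
  rw [H1] at u1 u2
  rw [u1] at he
  rw [Finset.prod_union hall, Finset.prod_union hH, Finset.prod_union hH, Finset.prod_union huc,
    Finset.prod_union huc, prod_arcSize_arcsAt, prod_arcSize_coreArcsAt, u2, objects_eq,
    Finset.prod_range_add, Finset.prod_range_add]
  rw [shapeWeight] at H2
  have e1 : ∀ i, headCount U + (u.size + i) + 1 = headCount U + u.size + i + 1 := fun i => by ring
  simp only [zero_add, e1] at H2 ⊢
  rw [← he]
  generalize ∏ A ∈ headArcs 1 U, (qint (arcSize A))⁻¹ = X1 at *
  generalize ∏ A ∈ headArcs 1 U, qint (countBelow O (A.1 + 1)) = X2 at *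
  generalize ∏ i ∈ Finset.range u.size, qint (headCount U + i + 1 : ℕ) = X3 at *
  linear_combination (X3 * e * ((∏ A ∈ coreArcsAt Q c, qint (countBelow O (A.1 + 1))) *
      ∏ A ∈ ds, qint (countBelow O (A.1 + 1)))) * H2

end

/-! ### The sets of arcs of a diagram with a star

In the following lemmas the arcs are split into the sets `H` to the left of the last up arrow, `W` behind
it and not in `S_M`, `M` in `S_M`, and `R` to the right of the star. -/

namespace Diagram

variable {D : Diagram} {s : ℕ} {H W M R : Finset (ℕ × ℕ)}

theorem SR_eq (hs : D.star = some s) (ha : D.arcs = H ∪ (W ∪ (M ∪ R)))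
    (hL : ∀ A ∈ H ∪ (W ∪ M), A.1 ≤ s) (hR : ∀ A ∈ R, s < A.1) : D.SR = R := by
  rw [SR, hs, ha]
  ext A
  have h1 := hL A
  have h2 := hR A
  simp only [Finset.mem_filter, Finset.mem_union] at h1 h2 ⊢
  constructor
  · rintro ⟨h, h3⟩
    by_contra h4
    have := h1 (by tauto)
    omega
  · exact fun h => ⟨by tauto, h2 h⟩

theorem arcs_sdiff_SR (hs : D.star = some s) (ha : D.arcs = H ∪ (W ∪ (M ∪ R)))
    (hL : ∀ A ∈ H ∪ (W ∪ M), A.1 ≤ s) (hR : ∀ A ∈ R, s < A.1) :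
    D.arcs \ D.SR = H ∪ (W ∪ M) := by
  rw [SR_eq hs ha hL hR, ha]
  ext A
  have h1 := hL A
  have h2 := hR A
  simp only [Finset.mem_sdiff, Finset.mem_union] at h1 h2 ⊢
  constructor
  · tauto
  · intro h
    refine ⟨by tauto, fun h3 => ?_⟩
    have := h1 h
    have := h2 h3
    omega

theorem SM_eq_of_unpaired {p : ℕ} (hs : D.star = some s) (hp : D.unpaired = some p)
    (ha : D.arcs \ D.SR = H ∪ (W ∪ M)) (hL : ∀ A ∈ H ∪ W, A.1 ≤ p) (hM : ∀ A ∈ M, p < A.1) :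
    D.SM = M := by
  rw [SM, hs, hp]
  dsimp only
  rw [ha]
  ext A
  have h1 := hL A
  have h2 := hM A
  simp only [Finset.mem_filter, Finset.mem_union] at h1 h2 ⊢
  constructor
  · rintro ⟨h, h3⟩
    by_contra h4
    have := h1 (by tauto)
    omega
  · exact fun h => ⟨by tauto, h2 h⟩

theorem SM_eq_of_dashed (hs : D.star = some s) (hp : D.unpaired = none)
    (ha : D.arcs \ D.SR = H ∪ (W ∪ M)) (hL : ∀ A ∈ H ∪ W, ∀ B ∈ D.dashed, A.1 ≤ B.1)
    (hM : ∀ A ∈ M, ∃ B ∈ D.dashed, B.1 < A.1) :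
    D.SM = M := by
  rw [SM, hs, hp]
  dsimp only
  rw [ha]
  ext A
  have h1 := hL A
  have h2 := hM A
  simp only [Finset.mem_filter, Finset.mem_union] at h1 h2 ⊢
  constructor
  · rintro ⟨h, B, hB, h3⟩
    by_contra h4
    have := h1 (by tauto) B hB
    omega
  · exact fun h => ⟨by tauto, h2 h⟩

theorem SL_eq (hs : D.star = some s) (ha : D.arcs = H ∪ (W ∪ (M ∪ R)))
    (hW : Disjoint W (M ∪ R)) (hM : D.SM = M) (hR : D.SR = R)
    (hH : ∀ A ∈ H, ∃ t ∈ D.ups, A.1 ≤ t) (hW' : ∀ A ∈ W, ∀ t ∈ D.ups, t < A.1) :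
    D.SL = W := by
  rw [SL, hs]
  dsimp only
  rw [hM, hR, ha]
  ext A
  have h1 := hH A
  have h2 := hW' A
  have h3 : A ∈ W → A ∉ M ∪ R := fun h => Finset.disjoint_left.1 hW h
  simp only [Finset.mem_filter, Finset.mem_union, Finset.mem_sdiff] at h1 h2 h3 ⊢
  constructor
  · rintro ⟨⟨h4, h5⟩, h6⟩
    by_contra h7
    obtain ⟨t, ht, h8⟩ := h1 (by tauto)
    have := h6 t ht
    omega
  · exact fun h => ⟨by tauto, h2 h⟩

/-- The enumeration of objects in terms of `countBelow`. -/
theorem number_eq (D : Diagram) (p : ℕ) : D.number p = countBelow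
    (D.ups ∪ D.arcs.image Prod.fst ∪ D.dashed.image Prod.fst ∪ D.unpaired.toFinset) (p + 1) := by
  simp only [number, countBelow, Nat.lt_succ_iff]

end Diagram

/-- Leaving out the leftmost dashed arc, as in `N8`, multiplies the product by `[N_3 + 1]`, which
cancels against `N5`.  Without dashed arcs both sides are `1`. -/
theorem prod_not_leftmost {p : ℕ} {c : List Forest} (f : ℕ × ℕ → Kq)
    (hf : ∀ A ∈ dashedAt p c, A.1 = p →
      f A = (qint ((midArcsAt p c).card + (dashedAt p c).card + 1))⁻¹) :
    ∏ A ∈ (dashedAt p c).filter fun A => ∃ B ∈ dashedAt p c, B.1 < A.1, f A =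
      (∏ A ∈ dashedAt p c, f A) * qint ((midArcsAt p c).card + (dashedAt p c).card + 1) := by
  have h0 : qint ((midArcsAt p c).card + (dashedAt p c).card + 1) ≠ 0 :=
    qint_pos_ne_zero (by positivity)
  rcases c with _ | ⟨x, _ | ⟨y, c⟩⟩
  · simp [dashedAt, midArcsAt]
  · simp [dashedAt, midArcsAt]
  · have hd := within_dashedAt (p + 2 * x.size + 2 * y.size + 2) c
    rw [prod_dashedAt_cons, hf _ (by rw [dashedAt]; exact Finset.mem_insert_self _ _) rfl,
      mul_right_comm, inv_mul_cancel₀ h0, one_mul]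
    refine Finset.prod_congr (Finset.ext fun A => ?_) fun A _ => rfl
    rw [Finset.mem_filter, dashedAt, Finset.mem_insert]
    simp only [Finset.mem_insert]
    constructor
    · rintro ⟨rfl | hA, B, rfl | hB, h⟩
      · dsimp only at h; omega
      · have := hd B hB; dsimp only at h; omega
      · exact hA
      · exact hA
    · intro hA
      have := hd A hA
      exact ⟨Or.inr hA, _, Or.inl rfl, by dsimp only; omega⟩

/-! ### The diagram and the product formula for the three kinds of cores -/

theorem length_wordOf (U : List Forest) (u : Forest) (c : List Forest) :
    (wordOf U u c).length = headLength U + 2 * u.size + coreLength c := by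
  induction U with
  | nil => simp [wordOf, headLength, length_coreList]
  | cons v U ih => simp [wordOf, headLength, ih]; ring

section

variable (U : List Forest) (u : Forest)

/-- The diagram of a word with a star and without unpaired down arrow. -/
theorem diagramOfWord_of_odd (c : List Forest) (h : Odd c.length) {P Q : ℕ}
    (hP : P = 1 + headLength U) (hQ : Q = P + 2 * u.size) : diagramOfWord (wordOf U u c) =
      ⟨headLength U + 2 * u.size + coreLength c, headArcs 1 U ∪ (arcsAt P u ∪ coreArcsAt Q c),
        headUps 1 U, some (starAt Q c), dashedAt Q c, none⟩ := by
  obtain ⟨l, h1, -, h3, h4⟩ := coreDowns_reverse_of_odd Q c h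
  rw [diagramOfWord, joinArcs_wordOf, length_wordOf, ← hP, ← hQ, h1]
  simp only [List.head?_cons, List.tail_cons, h3, h4]

/-- The diagram of a word with an unpaired down arrow. -/
theorem diagramOfWord_of_even (x : Forest) (c : List Forest) (h : Odd c.length) {P Q : ℕ}
    (hP : P = 1 + headLength U) (hQ : Q = P + 2 * u.size) :
    diagramOfWord (wordOf U u (x :: c)) =
      ⟨headLength U + 2 * u.size + coreLength (x :: c),
        headArcs 1 U ∪ (arcsAt P u ∪ coreArcsAt Q (x :: c)), headUps 1 U,
        some (starAt (Q + 2 * x.size + 1) c), dashedAt (Q + 2 * x.size + 1) c, some Q⟩ := by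
  obtain ⟨l, h1, h2, h3, h4⟩ := coreDowns_reverse_of_odd (Q + 2 * x.size + 1) c h
  rw [diagramOfWord, joinArcs_wordOf, length_wordOf, ← hP, ← hQ, coreDowns, List.reverse_cons, h1]
  simp only [List.cons_append, List.head?_cons, List.tail_cons, joinDashed_append h2,
    leftOver_append h2, h3]
  simp [joinDashed, leftOver]

/-- The diagram of a word all of whose down arrows belong to arcs. -/
theorem diagramOfWord_of_nil {P Q : ℕ}
    (hP : P = 1 + headLength U) (hQ : Q = P + 2 * u.size) : diagramOfWord (wordOf U u []) =
      ⟨headLength U + 2 * u.size, headArcs 1 U ∪ (arcsAt P u ∪ coreArcsAt Q []), headUps 1 U,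
        none, ∅, none⟩ := by
  rw [diagramOfWord, joinArcs_wordOf, length_wordOf, ← hP, ← hQ]
  rfl

/-- Without a star, `N5`, `N6`, `N7` and `N8` are trivial. -/
theorem productFormula_of_nil : (diagramOfWord (wordOf U u [])).productFormula =
    evenFact (objects u [] U) * shapeWeight u [] 0 U := by
  obtain ⟨P, hP⟩ : ∃ P, P = 1 + headLength U := ⟨_, rfl⟩
  obtain ⟨Q, hQ⟩ : ∃ Q, Q = P + 2 * u.size := ⟨_, rfl⟩
  have wH := within_headArcs 1 U
  have wu := within_arcsAt P u
  rw [diagramOfWord_of_nil U u hP hQ]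
  set D : Diagram := ⟨headLength U + 2 * u.size, headArcs 1 U ∪ (arcsAt P u ∪ coreArcsAt Q []),
    headUps 1 U, none, ∅, none⟩ with hD
  have key := prod_sizes_mul_prod_numbers U u (c := []) (E := ∅) (ds := ∅) (e := 1)
    (O := headUps 1 U ∪ (headArcs 1 U ∪ (arcsAt P u ∪ coreArcsAt Q [])).image Prod.fst) hP hQ
    (fun t => by simp [Finset.image_union, coreArcsAt, or_assoc]) (by simp) (within_empty _ _)
    (Finset.disjoint_empty_right _) (by simp [coreArcsAt, coreArcs])
  have hcard : D.arcs.card = (headArcs 1 U).card + u.size := by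
    rw [hD]
    dsimp only
    rw [coreArcsAt, Finset.union_empty, Finset.card_union_of_disjoint
      (wH.disjoint wu (by omega)), card_arcsAt]
  have hn : D.size - D.N2 = objects u [] U := by
    have h1 : D.N2 = D.arcs.card := rfl
    rw [h1, hcard, objects_eq]
    have h2 : D.size = headLength U + 2 * u.size := rfl
    have h3 := headLength_eq 1 U
    rw [h2]
    simp only [coreArcs, List.length_nil]
    omega
  have h9 : D.N9 = ∏ i ∈ Finset.Icc 1 (objects u [] U), (q ^ i + q⁻¹ ^ i) := by
    rw [Diagram.N9, hn]
    simp [hD]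
  have h5 : D.N5 = 1 := by simp [Diagram.N5, hD]
  have h6 : D.N6 = 1 := by simp [Diagram.N6, Diagram.outer, Diagram.SL, Diagram.SM, hD]
  have h7 : D.N7 = 1 := by simp [Diagram.N7, Diagram.outer, Diagram.SR, hD]
  have h8 : D.N8 = 1 := by simp [Diagram.N8, hD]
  have h10 : D.N10 = 1 * ∏ A ∈ headArcs 1 U ∪ (arcsAt P u ∪ coreArcsAt Q []) ∪ ∅, qint (countBelow
      (headUps 1 U ∪ (headArcs 1 U ∪ (arcsAt P u ∪ coreArcsAt Q [])).image Prod.fst)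
        (A.1 + 1)) := by
    simp [Diagram.N10, Diagram.number_eq, hD]
  rw [Diagram.productFormula, h5, h6, h7, h8, h9, h10, evenFact_eq, mul_right_comm _ _ (shapeWeight u [] 0 U),
    ← key]
  simp only [hD, coreWeight, List.length_nil, show ¬ Odd 0 by simp, if_false]
  ring

end

section

variable (U : List Forest) (u : Forest)

/-- With a star and without unpaired down arrow, the arcs behind the last up arrow form `S_L`, and
`N5` is not trivial. -/
theorem productFormula_of_odd (c : List Forest) (h : Odd c.length) :
    (diagramOfWord (wordOf U u c)).productFormula =
      evenFact (objects u c U) * shapeWeight u c 0 U := by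
  obtain ⟨P, hP⟩ : ∃ P, P = 1 + headLength U := ⟨_, rfl⟩
  obtain ⟨Q, hQ⟩ : ∃ Q, Q = P + 2 * u.size := ⟨_, rfl⟩
  obtain ⟨s, hs⟩ : ∃ s, s = starAt Q c := ⟨_, rfl⟩
  have wH := within_headArcs 1 U
  have wu := within_arcsAt P u
  have wc := within_coreArcsAt Q c
  have wm := (within_midArcsAt Q c).1
  have wm' := (within_midArcsAt Q c).2
  have wd := within_dashedAt Q c
  have wR := within_arcsAt (s + 1) (lastForest c)
  have hlen := coreLength_of_odd Q c h
  have hcoreLength := coreLength_eq c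
  have hcore := coreArcsAt_of_odd Q c h
  rw [← hs] at wm wm' wd hlen hcore
  rw [diagramOfWord_of_odd U u c h hP hQ, ← hs]
  obtain ⟨D, hD⟩ : ∃ D : Diagram, D = ⟨headLength U + 2 * u.size + coreLength c,
    headArcs 1 U ∪ (arcsAt P u ∪ coreArcsAt Q c), headUps 1 U, some s, dashedAt Q c, none⟩ :=
    ⟨_, rfl⟩
  rw [← hD]
  have dsize : D.size = headLength U + 2 * u.size + coreLength c := by rw [hD]
  have darcs : D.arcs = headArcs 1 U ∪ (arcsAt P u ∪ coreArcsAt Q c) := by rw [hD]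
  have dups : D.ups = headUps 1 U := by rw [hD]
  have dstar : D.star = some s := by rw [hD]
  have ddashed : D.dashed = dashedAt Q c := by rw [hD]
  have dunp : D.unpaired = none := by rw [hD]
  clear hD
  -- `S_R`, `S_M`, `S_L` are the arcs to the right of the star, in the core to the left of the star, and
  -- between the last up arrow and the core
  have darcs' := darcs
  rw [hcore] at darcs'
  have hL : ∀ A ∈ headArcs 1 U ∪ (arcsAt P u ∪ midArcsAt Q c), A.1 ≤ s := by
    intro A hA
    rw [Finset.mem_union, Finset.mem_union] at hA
    rcases hA with hA | hA | hA
    · have := wH A hA; omega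
    · have := wu A hA; omega
    · have := wm A hA; omega
  have hR : ∀ A ∈ arcsAt (s + 1) (lastForest c), s < A.1 := fun A hA => by
    have := wR A hA
    omega
  have hSR := Diagram.SR_eq dstar darcs' hL hR
  have hdis : Disjoint (arcsAt P u) (midArcsAt Q c ∪ arcsAt (s + 1) (lastForest c)) := by
    rw [← hcore]
    exact wu.disjoint wc (by omega)
  have hSM : D.SM = midArcsAt Q c := by
    refine Diagram.SM_eq_of_dashed dstar dunp (Diagram.arcs_sdiff_SR dstar darcs' hL hR) ?_ ?_
    · intro A hA B hB
      rw [ddashed] at hB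
      have := wd B hB
      rcases Finset.mem_union.1 hA with hA | hA
      · have := wH A hA; omega
      · have := wu A hA; omega
    · intro A hA
      have := wm A hA
      rw [ddashed]
      rcases c with _ | ⟨x, _ | ⟨y, c⟩⟩
      · simp [midArcsAt] at hA
      · simp [midArcsAt] at hA
      · exact ⟨_, Finset.mem_insert_self _ _, by dsimp only; omega⟩
  have hSL : D.SL = arcsAt P u := by
    refine Diagram.SL_eq dstar darcs' hdis hSM hSR ?_ ?_
    · intro A hA
      have := wH A hA
      rw [dups]
      refine ⟨_, last_mem_headUps (U := U) ?_, by omega⟩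
      rintro rfl
      simp [headArcs] at hA
    · intro A hA t ht
      rw [dups] at ht
      have := wu A hA
      have := headUps_bounds ht
      omega
  -- no arc outside of these sets encloses an arc in them, but dashed arcs do
  have hG : ∀ B ∈ D.arcs ∪ D.dashed, B ∈ headArcs 1 U ∨ B ∈ arcsAt P u ∨ B ∈ midArcsAt Q c ∨
      B ∈ arcsAt (s + 1) (lastForest c) ∨ B ∈ dashedAt Q c := by
    intro B hB
    rw [darcs', ddashed] at hB
    simp only [Finset.mem_union] at hB
    tauto
  have hG' : ∀ B, (B ∈ headArcs 1 U ∨ B ∈ arcsAt P u ∨ B ∈ midArcsAt Q c ∨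
      B ∈ arcsAt (s + 1) (lastForest c) ∨ B ∈ dashedAt Q c) → B ∈ D.arcs ∪ D.dashed := by
    intro B hB
    rw [darcs', ddashed]
    simp only [Finset.mem_union]
    tauto
  have oR : D.outer D.SR = outerAt (s + 1) (lastForest c) := by
    rw [hSR, Diagram.outer, filter_outer_of_fits (b := Q + coreLength c)
      ⟨fun B hB => hG' B (by tauto), fun B hB => ?_⟩ (by omega)]
    rcases hG B hB with h1 | h1 | h1 | h1 | h1
    · have := wH B h1; omega
    · have := wu B h1; omega
    · have := wm B h1; omega
    · tauto
    · have := wd B h1; omega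
  have ou : (arcsAt P u).filter (fun A => ∀ B ∈ D.arcs ∪ D.dashed, ¬ Encloses B A) =
      outerAt P u := by
    rw [filter_outer_of_fits (b := Q)
      ⟨fun B hB => hG' B (by tauto), fun B hB => ?_⟩ (by omega)]
    rcases hG B hB with h1 | h1 | h1 | h1 | h1
    · have := wH B h1; omega
    · tauto
    · have := wm B h1; omega
    · have := wR B h1; omega
    · have := wd B h1; omega
  have om : (midArcsAt Q c).filter (fun A => ∀ B ∈ D.arcs ∪ D.dashed, ¬ Encloses B A) =
      midOuterAt Q c := by
    rw [filter_outer_midArcsAt ⟨fun B hB => hG' B ?_, fun B hB => ?_⟩]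
    · rw [Finset.mem_union] at hB
      tauto
    · rw [Finset.mem_union, ← hs]
      rcases hG B hB with h1 | h1 | h1 | h1 | h1
      · have := wH B h1; omega
      · have := wu B h1; omega
      · tauto
      · have := wR B h1; omega
      · tauto
  -- the factors of the product formula in terms of the shape
  have hN3 : D.N3 = (midArcsAt Q c).card + (dashedAt Q c).card := by
    rw [Diagram.N3, hSM, ddashed]
  have hc : ∀ r : ℕ → Kq, (∏ B ∈ D.SM, r (D.c B)) * ∏ A ∈ D.dashed, r ((s - A.1) / 2) =
      ∏ i ∈ Finset.range D.N3, r (i + 1) := by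
    intro r
    rw [hN3, ← prod_rank_midArcsAt, ← hs]
    simp only [Diagram.c, hSM, ddashed]
    rfl
  have hcard : D.arcs.card = (headArcs 1 U).card + u.size + coreArcs c := by
    rw [darcs, Finset.card_union_of_disjoint, Finset.card_union_of_disjoint, card_arcsAt,
      card_coreArcsAt, add_assoc]
    · exact wu.disjoint wc (by omega)
    · exact Finset.disjoint_union_right.2
        ⟨wH.disjoint wu (by omega), wH.disjoint wc (by omega)⟩
  have hhead := headLength_eq 1 U
  obtain ⟨k, hk⟩ := h
  have hn : D.size - D.N2 = objects u c U := by
    have h1 : D.N2 = D.arcs.card + D.dashed.card + 1 := by rw [Diagram.N2, dstar]; rfl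
    rw [h1, hcard, objects_eq, dsize, ddashed, card_dashedAt]
    omega
  have h5 : D.N5 = qint (coreLength c + 2 * u.size + 1 + headCount U) /
      qint ((midArcsAt Q c).card + (dashedAt Q c).card + 1) := by
    have hcc : coreArcs c = (midArcsAt Q c).card + (arcsAt (s + 1) (lastForest c)).card := by
      rw [← card_coreArcsAt Q, hcore, Finset.card_union_of_disjoint (wm.disjoint wR (by omega))]
    have h4 : D.N4 = coreLength c + 2 * u.size + 1 + headCount U := by
      rw [Diagram.N4, hcard, hSR, hSM, hSL, dsize, card_arcsAt P]
      omega
    rw [Diagram.N5, if_pos ⟨by rw [dstar]; rfl, dunp⟩, h4, hN3]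
    push_cast
    rfl
  have h6 : D.N6 = u.outerRatio (coreLength c) *
      ∏ A ∈ midOuterAt Q c, qint (1 + arcSize A + (D.size - A.2 : ℕ)) /
        qint (1 + 2 * arcSize A + (D.size - A.2 : ℕ)) := by
    rw [Diagram.N6, if_pos dunp, hSL, hSM, Diagram.outer, Finset.filter_union, ou, om,
      Finset.prod_union ((within_outerAt P u).disjoint (within_midOuterAt Q c) (by omega))]
    simp only [Diagram.d1]
    rw [prod_outerAt_ratio D.size (coreLength c) P u (by omega)]
  have h8 : D.N8 = (∏ A ∈ D.dashed, (qint (D.d3 A + arcSize A))⁻¹) *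
      qint ((midArcsAt Q c).card + (dashedAt Q c).card + 1) := by
    rw [Diagram.N8, if_pos dunp, ddashed, prod_not_leftmost]
    intro A hA hA'
    obtain ⟨i, j, h1, h2⟩ := dashedAt_parity hA
    have h3 := starAt_eq (p := Q) (c := c)
    congr 2
    simp only [Diagram.d3, Diagram.starPos, dstar, Option.getD_some, arcSize]
    omega
  have h79 := Diagram.N7_mul_N9 dstar oR hc (by omega) (by
    intro A hA
    rw [ddashed] at hA
    rw [hs]
    exact dashedAt_parity hA)
  rw [hn] at h79
  have hcw := coreWeight_of_odd (N := D.size) (p := Q) ⟨k, hk⟩ (by omega)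
  rw [← hs, ← ddashed] at hcw
  have h10 : D.N10 = 1 * ∏ A ∈ headArcs 1 U ∪ (arcsAt P u ∪ coreArcsAt Q c) ∪ dashedAt Q c,
      qint (countBelow (headUps 1 U ∪ (headArcs 1 U ∪ (arcsAt P u ∪ coreArcsAt Q c)).image Prod.fst ∪
        (dashedAt Q c).image Prod.fst) (A.1 + 1)) := by
    simp [Diagram.N10, Diagram.number_eq, dunp, dups, darcs, ddashed]
  have key := prod_sizes_mul_prod_numbers U u (c := c) (ds := dashedAt Q c) (e := 1)
    (E := (coreArcsAt Q c).image Prod.fst ∪ (dashedAt Q c).image Prod.fst)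
    (O := headUps 1 U ∪ (headArcs 1 U ∪ (arcsAt P u ∪ coreArcsAt Q c)).image Prod.fst ∪
        (dashedAt Q c).image Prod.fst) hP hQ
    (fun t => by simp only [Finset.image_union, Finset.mem_union]; tauto)
    (fun t ht => by
      by_contra h1
      rcases Finset.mem_union.1 ht with h2 | h2
      · exact wc.notMem_image (by omega) h2
      · exact wd.notMem_image (by omega) h2)
    (wd.mono le_rfl (by omega))
    (disjoint_coreArcsAt_dashedAt ⟨k, hk⟩) (by
      rw [one_mul]
      refine enumerate_core ⟨k, hk⟩ (fun t h1 h2 => ?_) fun i => qint i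
      have n1 := wH.notMem_image (x := t) (by omega)
      have n2 := wu.notMem_image (x := t) (by omega)
      have n3 : t ∉ headUps 1 U := fun h => by
        have := headUps_bounds h
        omega
      simp only [Finset.image_union, Finset.mem_union, n1, n2, n3, false_or])
  have h0 : qint (((midArcsAt Q c).card : ℤ) + (dashedAt Q c).card + 1) ≠ 0 :=
    qint_pos_ne_zero (by positivity)
  rw [if_pos ⟨k, hk⟩, ← h10, ← darcs] at key
  rw [Diagram.productFormula, evenFact_eq, mul_right_comm _ _ (shapeWeight u c 0 U), ← key, h5, h8,
    h6, hcw]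
  generalize qint (((midArcsAt Q c).card : ℤ) + (dashedAt Q c).card + 1) = y at *
  generalize (∏ A ∈ midOuterAt Q c, qint (1 + arcSize A + (D.size - A.2 : ℕ)) /
        qint (1 + 2 * arcSize A + (D.size - A.2 : ℕ))) = X1 at *
  generalize (∏ A ∈ D.arcs, (qint (arcSize A))⁻¹) = X2 at *
  rw [div_eq_mul_inv]
  linear_combination (X1 * X2 * u.outerRatio (coreLength c) *
    qint (coreLength c + 2 * u.size + 1 + headCount U) * D.N10) * h79 +
    (X1 * X2 * u.outerRatio (coreLength c) *
    qint (coreLength c + 2 * u.size + 1 + headCount U) * D.N10 * D.N7 * D.N9 *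
      ∏ A ∈ D.dashed, (qint (D.d3 A + arcSize A))⁻¹) * inv_mul_cancel₀ h0

end

/-- The statement of `prod_rank_midArcsAt` if the arcs between an unpaired down arrow and the next
down arrow outside of arcs are added. -/
theorem prod_rank_even {M : Type*} [CommMonoid M] (r : ℕ → M) (p : ℕ) (x : Forest)
    (c : List Forest) {p' : ℕ} (hp : p' = p + 2 * x.size + 1) :
    (∏ B ∈ arcsAt (p + 1) x ∪ midArcsAt p' c, r (rank (arcsAt (p + 1) x ∪ midArcsAt p' c) B +
        ((dashedAt p' c).filter fun A => B.2 < A.1).card)) *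
      ∏ A ∈ dashedAt p' c, r ((starAt p' c - A.1) / 2) =
    ∏ i ∈ Finset.range ((arcsAt (p + 1) x ∪ midArcsAt p' c).card + (dashedAt p' c).card),
      r (i + 1) := by
  have wx := within_arcsAt (p + 1) x
  have wm := (within_midArcsAt p' c).1
  have wd := within_dashedAt p' c
  have hx := wx.disjoint wm (by omega)
  have ex : ∀ B ∈ arcsAt (p + 1) x, r (rank (arcsAt (p + 1) x ∪ midArcsAt p' c) B +
      ((dashedAt p' c).filter fun A => B.2 < A.1).card) =
      r ((midArcsAt p' c).card + (dashedAt p' c).card + rank (arcsAt (p + 1) x) B) := by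
    intro B hB
    have := wx B hB
    rw [rank_union hx, rank_eq_card (B := B) wm (by omega), Finset.filter_true_of_mem]
    · congr 1
      ring
    · intro A hA
      have := wd A hA
      omega
  have em : ∀ B ∈ midArcsAt p' c, r (rank (arcsAt (p + 1) x ∪ midArcsAt p' c) B +
      ((dashedAt p' c).filter fun A => B.2 < A.1).card) =
      r (rank (midArcsAt p' c) B + ((dashedAt p' c).filter fun A => B.2 < A.1).card) := by
    intro B hB
    have := wm B hB
    rw [rank_union hx, rank_eq_zero (B := B) wx (by omega), zero_add]
  rw [Finset.prod_union hx, Finset.prod_congr rfl ex, Finset.prod_congr rfl em, prod_rank_arcsAt,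
    mul_assoc, prod_rank_midArcsAt, Finset.card_union_of_disjoint hx, card_arcsAt,
    show x.size + (midArcsAt p' c).card + (dashedAt p' c).card =
      (midArcsAt p' c).card + (dashedAt p' c).card + x.size by ring,
    Finset.prod_range_add _ ((midArcsAt p' c).card + (dashedAt p' c).card), mul_comm]

section

variable (U : List Forest) (u : Forest)

/-- With an unpaired down arrow, `N6` does not involve `S_L`, `N5` is trivial, and `N10` has the
additional factor of the unpaired down arrow. -/
theorem productFormula_of_even (x : Forest) (c : List Forest) (h : Odd c.length) :
    (diagramOfWord (wordOf U u (x :: c))).productFormula =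
      evenFact (objects u (x :: c) U) * shapeWeight u (x :: c) 0 U := by
  obtain ⟨P, hP⟩ : ∃ P, P = 1 + headLength U := ⟨_, rfl⟩
  obtain ⟨Q, hQ⟩ : ∃ Q, Q = P + 2 * u.size := ⟨_, rfl⟩
  obtain ⟨p', hp'⟩ : ∃ p', p' = Q + 2 * x.size + 1 := ⟨_, rfl⟩
  obtain ⟨s, hs⟩ : ∃ s, s = starAt p' c := ⟨_, rfl⟩
  have wH := within_headArcs 1 U
  have wu := within_arcsAt P u
  have wc := within_coreArcsAt Q (x :: c)
  have wx := within_arcsAt (Q + 1) x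
  have wm := (within_midArcsAt p' c).1
  have wm' := (within_midArcsAt p' c).2
  have wd := within_dashedAt p' c
  have wR := within_arcsAt (s + 1) (lastForest c)
  have hlen := coreLength_of_odd p' c h
  have hcoreLength := coreLength_eq (x :: c)
  have hcore : coreArcsAt Q (x :: c) = arcsAt (Q + 1) x ∪ midArcsAt p' c ∪
      arcsAt (s + 1) (lastForest c) := by
    rw [coreArcsAt, ← hp', coreArcsAt_of_odd p' c h, hs, Finset.union_assoc]
  have hcl : coreLength (x :: c) = 2 * x.size + 1 + coreLength c := rfl
  rw [← hs] at wm wm' wd hlen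
  rw [diagramOfWord_of_even U u x c h hP hQ, ← hp', ← hs]
  obtain ⟨D, hD⟩ : ∃ D : Diagram, D = ⟨headLength U + 2 * u.size + coreLength (x :: c),
    headArcs 1 U ∪ (arcsAt P u ∪ coreArcsAt Q (x :: c)), headUps 1 U, some s, dashedAt p' c,
    some Q⟩ := ⟨_, rfl⟩
  rw [← hD]
  have dsize : D.size = headLength U + 2 * u.size + coreLength (x :: c) := by rw [hD]
  have darcs : D.arcs = headArcs 1 U ∪ (arcsAt P u ∪ coreArcsAt Q (x :: c)) := by rw [hD]
  have dups : D.ups = headUps 1 U := by rw [hD]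
  have dstar : D.star = some s := by rw [hD]
  have ddashed : D.dashed = dashedAt p' c := by rw [hD]
  have dunp : D.unpaired = some Q := by rw [hD]
  have dunp' : D.unpaired ≠ none := by rw [dunp]; exact Option.some_ne_none Q
  clear hD
  -- `S_R` and `S_M` are the arcs to the right of the star and in the core to the left of the star
  have darcs' := darcs
  rw [hcore] at darcs'
  have hL : ∀ A ∈ headArcs 1 U ∪ (arcsAt P u ∪ (arcsAt (Q + 1) x ∪ midArcsAt p' c)),
      A.1 ≤ s := by
    intro A hA
    rw [Finset.mem_union, Finset.mem_union, Finset.mem_union] at hA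
    rcases hA with hA | hA | hA | hA
    · have := wH A hA; omega
    · have := wu A hA; omega
    · have := wx A hA; omega
    · have := wm A hA; omega
  have hR : ∀ A ∈ arcsAt (s + 1) (lastForest c), s < A.1 := fun A hA => by
    have := wR A hA
    omega
  have hSR := Diagram.SR_eq dstar darcs' hL hR
  have hSM : D.SM = arcsAt (Q + 1) x ∪ midArcsAt p' c := by
    refine Diagram.SM_eq_of_unpaired dstar dunp (Diagram.arcs_sdiff_SR dstar darcs' hL hR) ?_ ?_
    · intro A hA
      rcases Finset.mem_union.1 hA with hA | hA
      · have := wH A hA; omega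
      · have := wu A hA; omega
    · intro A hA
      rcases Finset.mem_union.1 hA with hA | hA
      · have := wx A hA; omega
      · have := wm A hA; omega
  -- no arc outside of these sets encloses an arc in them, but dashed arcs do
  have hG : ∀ B ∈ D.arcs ∪ D.dashed, B ∈ headArcs 1 U ∨ B ∈ arcsAt P u ∨ B ∈ arcsAt (Q + 1) x ∨
      B ∈ midArcsAt p' c ∨ B ∈ arcsAt (s + 1) (lastForest c) ∨ B ∈ dashedAt p' c := by
    intro B hB
    rw [darcs', ddashed] at hB
    simp only [Finset.mem_union] at hB
    tauto
  have hG' : ∀ B, (B ∈ headArcs 1 U ∨ B ∈ arcsAt P u ∨ B ∈ arcsAt (Q + 1) x ∨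
      B ∈ midArcsAt p' c ∨ B ∈ arcsAt (s + 1) (lastForest c) ∨ B ∈ dashedAt p' c) →
        B ∈ D.arcs ∪ D.dashed := by
    intro B hB
    rw [darcs', ddashed]
    simp only [Finset.mem_union]
    tauto
  have oR : D.outer D.SR = outerAt (s + 1) (lastForest c) := by
    rw [hSR, Diagram.outer, filter_outer_of_fits (b := Q + coreLength (x :: c))
      ⟨fun B hB => hG' B (by tauto), fun B hB => ?_⟩ (by omega)]
    rcases hG B hB with h1 | h1 | h1 | h1 | h1 | h1
    · have := wH B h1; omega
    · have := wu B h1; omega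
    · have := wx B h1; omega
    · have := wm B h1; omega
    · tauto
    · have := wd B h1; omega
  have ox : (arcsAt (Q + 1) x).filter (fun A => ∀ B ∈ D.arcs ∪ D.dashed, ¬ Encloses B A) =
      outerAt (Q + 1) x := by
    rw [filter_outer_of_fits (b := p')
      ⟨fun B hB => hG' B (by tauto), fun B hB => ?_⟩ (by omega)]
    rcases hG B hB with h1 | h1 | h1 | h1 | h1 | h1
    · have := wH B h1; omega
    · have := wu B h1; omega
    · tauto
    · have := wm B h1; omega
    · have := wR B h1; omega
    · have := wd B h1; omega
  have om : (midArcsAt p' c).filter (fun A => ∀ B ∈ D.arcs ∪ D.dashed, ¬ Encloses B A) =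
      midOuterAt p' c := by
    rw [filter_outer_midArcsAt ⟨fun B hB => hG' B ?_, fun B hB => ?_⟩]
    · rw [Finset.mem_union] at hB
      tauto
    · rw [Finset.mem_union, ← hs]
      rcases hG B hB with h1 | h1 | h1 | h1 | h1 | h1
      · have := wH B h1; omega
      · have := wu B h1; omega
      · have := wx B h1; omega
      · tauto
      · have := wR B h1; omega
      · tauto
  -- the factors of the product formula in terms of the shape
  have hN3 : D.N3 = (arcsAt (Q + 1) x ∪ midArcsAt p' c).card + (dashedAt p' c).card := by
    rw [Diagram.N3, hSM, ddashed]
  have hc : ∀ r : ℕ → Kq, (∏ B ∈ D.SM, r (D.c B)) * ∏ A ∈ D.dashed, r ((s - A.1) / 2) =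
      ∏ i ∈ Finset.range D.N3, r (i + 1) := by
    intro r
    rw [hN3, ← prod_rank_even r Q x c hp', ← hs]
    simp only [Diagram.c, hSM, ddashed]
    rfl
  have hcard : D.arcs.card = (headArcs 1 U).card + u.size + coreArcs (x :: c) := by
    rw [darcs, Finset.card_union_of_disjoint, Finset.card_union_of_disjoint, card_arcsAt,
      card_coreArcsAt, add_assoc]
    · exact wu.disjoint wc (by omega)
    · exact Finset.disjoint_union_right.2
        ⟨wH.disjoint wu (by omega), wH.disjoint wc (by omega)⟩
  have hhead := headLength_eq 1 U
  obtain ⟨k, hk⟩ := h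
  have hk' : (x :: c).length = 2 * k + 2 := by rw [List.length_cons, hk]
  have hn : D.size - D.N2 = objects u (x :: c) U := by
    have h1 : D.N2 = D.arcs.card + D.dashed.card + 1 := by rw [Diagram.N2, dstar]; rfl
    rw [h1, hcard, objects_eq, dsize, ddashed, card_dashedAt]
    omega
  have h5 : D.N5 = 1 := by
    rw [Diagram.N5, if_neg fun h => dunp' h.2]
  have h6 : D.N6 = x.outerRatio (coreLength c) *
      ∏ A ∈ midOuterAt p' c, qint (1 + arcSize A + (D.size - A.2 : ℕ)) /
        qint (1 + 2 * arcSize A + (D.size - A.2 : ℕ)) := by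
    rw [Diagram.N6, if_neg dunp', hSM, Diagram.outer, Finset.filter_union, ox, om,
      Finset.prod_union ((within_outerAt (Q + 1) x).disjoint (within_midOuterAt p' c) (by omega))]
    simp only [Diagram.d1]
    rw [prod_outerAt_ratio D.size (coreLength c) (Q + 1) x (by omega)]
  have h8 : D.N8 = ∏ A ∈ D.dashed, (qint (D.d3 A + arcSize A))⁻¹ := by
    rw [Diagram.N8, if_neg dunp']
  have h79 := Diagram.N7_mul_N9 dstar oR hc (by omega) (by
    intro A hA
    rw [ddashed] at hA
    rw [hs]
    exact dashedAt_parity hA)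
  rw [hn] at h79
  have hcw := coreWeight_of_odd (N := D.size) (p := p') ⟨k, hk⟩ (by omega)
  rw [← hs, ← ddashed] at hcw
  have hcw' : coreWeight (x :: c) = coreWeight c * x.outerRatio (coreLength c) := by
    rw [coreWeight, if_pos ⟨k, hk⟩]
  obtain ⟨O, hOdef⟩ : ∃ O, O = headUps 1 U ∪ (headArcs 1 U ∪ (arcsAt P u ∪
      coreArcsAt Q (x :: c))).image Prod.fst ∪ (dashedAt p' c).image Prod.fst ∪ {Q} := ⟨_, rfl⟩
  have h10 : D.N10 = qint (countBelow O (Q + 1)) *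
      ∏ A ∈ headArcs 1 U ∪ (arcsAt P u ∪ coreArcsAt Q (x :: c)) ∪ dashedAt p' c,
        qint (countBelow O (A.1 + 1)) := by
    simp only [Diagram.N10, Diagram.number_eq, dunp, dups, darcs, ddashed, Option.toFinset_some,
      Finset.prod_singleton, hOdef]
  have key := prod_sizes_mul_prod_numbers U u (c := x :: c) (ds := dashedAt p' c)
    (e := qint (countBelow O (Q + 1))) (O := O)
    (E := (coreArcsAt Q (x :: c)).image Prod.fst ∪ (dashedAt p' c).image Prod.fst ∪ {Q}) hP hQ
    (fun t => by
      simp only [hOdef, Finset.image_union, Finset.mem_union]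
      tauto)
    (fun t ht => by
      by_contra h1
      simp only [Finset.mem_union, Finset.mem_singleton] at ht
      rcases ht with (h2 | h2) | h2
      · exact wc.notMem_image (by omega) h2
      · exact wd.notMem_image (by omega) h2
      · omega)
    (wd.mono (by omega) (by omega))
    (by
      rw [coreArcsAt, ← hp', Finset.disjoint_union_left]
      exact ⟨wx.disjoint wd (by omega), disjoint_coreArcsAt_dashedAt ⟨k, hk⟩⟩) (by
      rw [hp']
      refine enumerate_even_core ⟨k, hk⟩ (fun t h1 h2 => ?_) fun i => qint i
      have n1 := wH.notMem_image (x := t) (by omega)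
      have n2 := wu.notMem_image (x := t) (by omega)
      have n3 : t ∉ headUps 1 U := fun h => by
        have := headUps_bounds h
        omega
      rw [hOdef, ← hp']
      simp only [Finset.image_union, Finset.mem_union, n1, n2, n3, false_or, Finset.mem_singleton]
      tauto)
  rw [if_neg (by rw [hk']; simp [Nat.odd_add]), mul_one, ← h10, ← darcs] at key
  rw [Diagram.productFormula, evenFact_eq, mul_right_comm _ _ (shapeWeight u (x :: c) 0 U), ← key,
    h5, h8, h6, hcw', hcw]
  generalize (∏ A ∈ midOuterAt p' c, qint (1 + arcSize A + (D.size - A.2 : ℕ)) /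
        qint (1 + 2 * arcSize A + (D.size - A.2 : ℕ))) = X1 at *
  generalize (∏ A ∈ D.arcs, (qint (arcSize A))⁻¹) = X2 at *
  linear_combination (X1 * X2 * x.outerRatio (coreLength c) * D.N10) * h79

end

/-- The product formula of a diagram is the weight of the word. -/
theorem productFormula_diagramOfWord (w : List Arrow) :
    (diagramOfWord w).productFormula = weight 0 w := by
  have e := wordOf_shape w
  rw [weight, add_zero]
  generalize shape w = S at e
  obtain ⟨U, u, c⟩ := S
  dsimp only at e ⊢
  rw [← e]
  rcases Nat.even_or_odd c.length with h | h
  · rcases c with _ | ⟨x, c⟩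
    · exact productFormula_of_nil U u
    · refine productFormula_of_even U u x c ?_
      rwa [List.length_cons, Nat.even_add_one, Nat.not_even_iff_odd] at h
  · exact productFormula_of_odd U u c h

end CoidealSl2

theorem mainTheorem1 {n : ℕ} (m : Fin n → ℕ) (hm : ∀ i, 0 < m i) :
    ∃ b : Module.Basis (CoidealSl2.Idx m) CoidealSl2.Kq (CoidealSl2.T m),
      (∀ (a : CoidealSl2.Idx m) (x : CoidealSl2.T m),
        CoidealSl2.IsDualCanonical m a x ↔ x = b a) ∧
      ∃ Ψ : CoidealSl2.T m,
        (CoidealSl2.opY m).eigenspace (CoidealSl2.qint ((∑ i, (m i : ℤ)) + 1)) =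
          Submodule.span CoidealSl2.Kq {Ψ} ∧
        b.repr Ψ (CoidealSl2.lowest m) = 1 ∧
        ∀ a : CoidealSl2.Idx m, b.repr Ψ a = (CoidealSl2.diagram m a).productFormula := by
  refine ⟨CoidealSl2.dualBasis m,
    fun a x => by rw [CoidealSl2.isDualCanonical_iff, CoidealSl2.dualBasis_apply],
    CoidealSl2.wordMap m (CoidealSl2.eigenVec (∑ i, m i)), CoidealSl2.eigenspace_opY m, ?_,
    fun a => ?_⟩
  · rw [CoidealSl2.repr_wordMap_eigenVec, CoidealSl2.arrows_lowest,
      CoidealSl2.weight_replicate_down]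
  · rw [CoidealSl2.repr_wordMap_eigenVec, CoidealSl2.diagram,
      CoidealSl2.productFormula_diagramOfWord]
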